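/- Let $n\ge 1$, $0<\gamma<1$, $p>1$, and, if $n\ge 3$, let also $p\le \frac{n}{n-2}$. Let $u_0\in H^1(\mathbb R^n)$ and $u_1\in L^2(\mathbb R^n)$ be real-valued with $\int_{\mathbb R^n}u_0\,dx>0$ and $\int_{\mathbb R^n}u_1\,dx>0$ (the integrals being assumed to exist). Consider the Cauchy problem $$u_{tt}-\Delta u+u_t=\int_0^t (t-s)^{-\gamma}|u(s)|^p\,ds\quad (t>0,\ x\in\mathbb R^n),\qquad u(0)=u_0,\quad u_t(0)=u_1 .$$ A mild solution on $[0,T)$, $0<T\le\infty$, is a real-valued function $u\in C([0,T),H^1(\mathbb R^n))\cap C^1([0,T),L^2(\mathbb R^n))$ with $$u(t)=K_0(t)\ast u_0+K_1(t)\ast\bigl(\tfrac12u_0+u_1\bigr)+\Gamma(\alpha)\int_0^tK_1(t-\tau)\ast J^{\alpha}_{0|\tau}(|u|^p)(\tau)\,d\tau\qquad(0\le t<T),$$ where $\alpha=1-\gamma$, $J^{\alpha}_{0|t}g(t)=\frac1{\Gamma(\alpha)}\int_0^t(t-s)^{\alpha-1}g(s)\,ds$, and $K_0(t)\ast$, $K_1(t)\ast$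 are the Fourier multipliers with symbols $e^{-t/2}\cos(ta(\xi))$ and $e^{-t/2}\frac{\sin(ta(\xi))}{a(\xi)}$, with $a(\xi)=\sqrt{|\xi|^2-1/4}$ for $|\xi|>1/2$ and $a(\xi)=i\sqrt{1/4-|\xi|^2}$ for $|\xi|\le 1/2$. We say that the mild solution blows up in finite time if there is a unique maximal mild solution (one of which every mild solution is a restriction) and its interval of existence $[0,T_{\max})$ has $T_{\max}<\infty$. Let $p_\gamma=1+\frac{2(2-\gamma)}{(n-2+2\gamma)_+}$, with $p_\gamma=\infty$ if $n-2+2\gamma\le 0$. (i) If $\frac{n-2}{n}<\gamma$, if $u_0$ and $u_1$ vanish outside some ball $\{|x|<K\}$, $K>0$, and if $p\le p_\gamma$, then the mild solution blows up in finite time. (ii) If $n\ge 3$ and $\gamma\le\frac{n-2}{n}$, then the mild solution blows up in finite time (compact support of the data is not required). -/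

import Mathlib

open MeasureTheory FourierTransform TemperedDistribution

noncomputable section

namespace DampedWave

/-- The space `ℝⁿ` with its Euclidean norm. -/
abbrev Space (n : ℕ) : Type := EuclideanSpace ℝ (Fin n)

/-- Real-valued `L²(ℝⁿ)`. -/
abbrev L2 (n : ℕ) : Type := Lp ℝ 2 (volume : Measure (Space n))

/-- Complex-valued `L²(ℝⁿ)`, on which the Fourier transform acts. -/
abbrev L2C (n : ℕ) : Type := Lp ℂ 2 (volume : Measure (Space n))

/-- A real `L²` function seen as a complex one. -/
def toComplex {n : ℕ} (f : L2 n) : L2C n := Complex.ofRealCLM.compLp f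

/-- `f ∈ H¹(ℝⁿ)`. -/
def MemH1 {n : ℕ} (f : L2 n) : Prop :=
  MemSobolev 1 2 (Lp.toTemperedDistribution (toComplex f))

/-- `u ∈ C(I, H¹(ℝⁿ))`. The map `f ↦ besselPotential 1 f = 𝓕⁻ ((1 + |ξ|²)^{1/2} 𝓕 f)` is an
isomorphism of `H¹` onto `L²`, so `u` is continuous into `H¹` iff its image `G` is continuous
into `L²`. -/
def ContinuousOnH1 {n : ℕ} (u : ℝ → L2 n) (I : Set ℝ) : Prop :=
  ∃ G : ℝ → L2C n, ContinuousOn G I ∧ ∀ t ∈ I,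
    besselPotential (Space n) ℂ 1 (Lp.toTemperedDistribution (toComplex (u t))) =
      Lp.toTemperedDistribution (G t)

/-- `a = √(r² - 1/4)` for `r > 1/2` and `a = i √(1/4 - r²)` for `r ≤ 1/2`. -/
def rootSymbol (r : ℝ) : ℂ :=
  if 1 / 2 < r then (Real.sqrt (r ^ 2 - 1 / 4) : ℂ)
  else Complex.I * (Real.sqrt (1 / 4 - r ^ 2) : ℂ)

/-- The symbol `e^{-t/2} cos (t a)` at the wave number `r`. -/
def symbolK0 (t r : ℝ) : ℂ :=
  (Real.exp (-t / 2) : ℂ) * Complex.cos ((t : ℂ) * rootSymbol r)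

/-- The symbol `e^{-t/2} sin (t a) / a` at the wave number `r`, extended by continuity (with the
value `t e^{-t/2}`) to `a = 0`. -/
def symbolK1 (t r : ℝ) : ℂ :=
  (Real.exp (-t / 2) : ℂ) *
    (if rootSymbol r = 0 then (t : ℂ) else Complex.sin ((t : ℂ) * rootSymbol r) / rootSymbol r)

open Classical in
/-- The operator on `L²(ℝⁿ)` that multiplies the Fourier transform by the radial symbol `m`.
Mathlib's transform is `𝓕 f ξ = ∫ e^{-2πi x·ξ} f x dx`, so that the wave number at `ξ` is
`2π|ξ|`. For the bounded measurable symbols used here the product is always in `L²`. -/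
def radialMultiplier {n : ℕ} (m : ℝ → ℂ) (f : L2C n) : L2C n :=
  if h : MemLp (fun ξ : Space n => m (2 * Real.pi * ‖ξ‖) * (𝓕 f : L2C n) ξ) 2 volume
  then 𝓕⁻ (h.toLp _) else 0

/-- `f ↦ K₀(t) ∗ f`. -/
def opK0 {n : ℕ} (t : ℝ) (f : L2C n) : L2C n := radialMultiplier (symbolK0 t) f

/-- `f ↦ K₁(t) ∗ f`. -/
def opK1 {n : ℕ} (t : ℝ) (f : L2C n) : L2C n := radialMultiplier (symbolK1 t) f

/-- The solution `w(t) = K₀(t) ∗ u₀ + K₁(t) ∗ (u₀/2 + u₁)` of the linear damped wave equation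
`w_tt - Δw + w_t = 0`, `w(0) = u₀`, `w_t(0) = u₁`. -/
def linearSolution {n : ℕ} (u₀ u₁ : L2 n) (t : ℝ) : L2C n :=
  opK0 t (toComplex u₀) + opK1 t (toComplex ((1 / 2 : ℝ) • u₀ + u₁))

open Classical in
/-- `|f|^p` as an element of `L²(ℝⁿ)`, if it is one. -/
def absPow {n : ℕ} (p : ℝ) (f : L2 n) : L2 n :=
  if h : MemLp (fun x : Space n => |f x| ^ p) 2 volume then h.toLp _ else 0

/-- The Riemann-Liouville integral `J^α_{0|t} g = Γ(α)⁻¹ ∫₀ᵗ (t - s)^{α-1} g(s) ds`, for a curve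
`g` in `L²(ℝⁿ)`. -/
def riemannLiouville {n : ℕ} (α : ℝ) (g : ℝ → L2 n) (t : ℝ) : L2 n :=
  (Real.Gamma α)⁻¹ • ∫ s in (0 : ℝ)..t, (t - s) ^ (α - 1) • g s

/-- The time interval `[0, T)`, where `T ≤ ∞`. -/
def timeInterval (T : EReal) : Set ℝ := {t : ℝ | 0 ≤ t ∧ (t : EReal) < T}

/-- `u` is a mild solution on `[0, T)`, `0 < T ≤ ∞`, of
`u_tt - Δu + u_t = ∫₀ᵗ (t - s)^{-γ} |u(s)|^p ds`, `u(0) = u₀`, `u_t(0) = u₁`. With `α = 1 - γ`: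
`u ∈ C([0,T), H¹) ∩ C¹([0,T), L²)` and
`u(t) = w(t) + Γ(α) ∫₀ᵗ K₁(t - τ) ∗ J^α_{0|τ}(|u|^p) dτ`, all terms being well defined in `L²`. -/
structure IsMildSolution {n : ℕ} (γ p : ℝ) (u₀ u₁ : L2 n) (T : EReal) (u : ℝ → L2 n) : Prop where
  pos : 0 < T
  continuousOn_H1 : ContinuousOnH1 u (timeInterval T)
  contDiffOn_L2 : ContDiffOn ℝ 1 u (timeInterval T)
  memLp_absPow : ∀ t ∈ timeInterval T, MemLp (fun x : Space n => |u t x| ^ p) 2 volume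
  integrable_memory : ∀ t ∈ timeInterval T,
    IntervalIntegrable (fun s => (t - s) ^ ((1 - γ) - 1) • absPow p (u s)) volume 0 t
  integrable_duhamel : ∀ t ∈ timeInterval T,
    IntervalIntegrable (fun τ => opK1 (t - τ)
      (toComplex (riemannLiouville (1 - γ) (fun s => absPow p (u s)) τ))) volume 0 t
  integral_equation : ∀ t ∈ timeInterval T,
    toComplex (u t) = linearSolution u₀ u₁ t +
      (Real.Gamma (1 - γ)) • ∫ τ in (0 : ℝ)..t, opK1 (t - τ)
        (toComplex (riemannLiouville (1 - γ) (fun s => absPow p (u s)) τ))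

/-- `u` on `[0, T)` is the unique maximal mild solution: it is a mild solution, and every mild
solution on any `[0, T')` is a restriction of it. -/
def IsMaximalMildSolution {n : ℕ} (γ p : ℝ) (u₀ u₁ : L2 n) (T : EReal) (u : ℝ → L2 n) : Prop :=
  IsMildSolution γ p u₀ u₁ T u ∧
    ∀ (T' : EReal) (v : ℝ → L2 n), IsMildSolution γ p u₀ u₁ T' v →
      T' ≤ T ∧ Set.EqOn v u (timeInterval T')

/-- The mild solution blows up in finite time: there is a unique maximal mild solution, and its
maximal existence time `Tmax` is finite. -/
def BlowsUpInFiniteTime {n : ℕ} (γ p : ℝ) (u₀ u₁ : L2 n) : Prop :=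
  ∃ (Tmax : EReal) (u : ℝ → L2 n), IsMaximalMildSolution γ p u₀ u₁ Tmax u ∧ Tmax < ⊤

/-- The exponent `p_γ = 1 + 2(2-γ)/(n-2+2γ)₊`, equal to `∞` where the positive part vanishes. -/
def pGamma (n : ℕ) (γ : ℝ) : EReal :=
  if 0 < (n : ℝ) - 2 + 2 * γ then ((1 + 2 * (2 - γ) / ((n : ℝ) - 2 + 2 * γ) : ℝ) : EReal) else ⊤

/-- The data vanish outside a ball `B(K) = {|x| < K}`, `K > 0`. -/
def CompactlySupportedData {n : ℕ} (u₀ u₁ : L2 n) : Prop :=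
  ∃ K : ℝ, 0 < K ∧ ∀ᵐ x ∂(volume : Measure (Space n)), K ≤ ‖x‖ → u₀ x = 0 ∧ u₁ x = 0

end DampedWave

end

/-! ### Abstract Volterra equations with a weakly singular memory kernel. -/

noncomputable section

namespace DampedWave

open Filter Topology Set

/-! Local theory. Write `u = (1 + |D|²)^{-1/2} g` with `g` in `L²`. Because `K₁(t)` gains one
derivative, its symbol is `(1 + |ξ|²)^{-1/2}` times a bounded symbol (`symK1_eq`), and the mild
equation in `H¹` becomes a Volterra equation for `g` in `L²` with a strongly continuous kernel. The
nonlinearity `g ↦ |u|^p` is Lipschitz on bounded sets of `L²`, by the embedding of `H¹` into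
`L^{2p}` (`sobolev_embedding`, `lipschitzOnBounded_nonlin`). A contraction gives local existence
(`volterra_exists`), an exponentially weighted supremum gives uniqueness (`volterra_unique`), and
gluing all mild solutions gives the maximal one. It remains to exclude a global solution.

Nonexistence. Test a global solution against `ψ(t) φ(x/R)` with `ψ(t) = (1 - t/T)^{m+2}` and `T =
(BR)²` (`integral_inner_adjointTest`). Let `X` be the integral of `(1 - t/T)^{m+3} |u|^p φ(x/R)`
over `[0, T] × ℝⁿ`, and `Y` its part over `|x| ≥ R`. As `(t - s)^{-γ} ≥ T^{-γ}`, the memory term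
contributes at least a multiple of `T^{1-γ} X`; the data contribute a positive amount once `R` is
large; and Hölder bounds the linear terms by a multiple of `(Rⁿ T)^q (T⁻¹ X^{1/p} + R⁻² Y^{1/p})`,
where `q = 1 - 1/p` (`IsGlobalSolution.weightedMass_le`). Hence `X ≤ K B^{-nq} (BR)^{(n+2)q - 4 +
2γ} (X^{1/p} + B² Y^{1/p})`. The power of `BR` is nonpositive exactly when `p (n - 2 + 2γ) ≤ n + 2`,
and this inequality follows from the assumptions in both parts of the theorem.

The second parameter `B` handles the critical case, where that power is zero
(`eq_zero_of_weightedIntegral_le`). With `B = 1` the estimate bounds `X`, so the total mass `I` of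
`|u|^p` over space-time is finite. For fixed `B` the outer part `Y` then tends to zero, leaving `I ≤
K B^{-nq} I^{1/p}`; letting `B → ∞` gives `I = 0`. So `u₀` pairs to zero with every cut-off, against
`∫ u₀ > 0`. -/

/-- Extension of a function on `[0, T]` to the line by constants. -/
def clamp {E : Type*} (T : ℝ) (h : ℝ → E) (t : ℝ) : E := h (max 0 (min T t))

lemma clamp_eq {E : Type*} {T : ℝ} {h : ℝ → E} {t : ℝ} (ht : t ∈ Icc 0 T) : clamp T h t = h t := by
  rw [clamp, min_eq_right ht.2, max_eq_right ht.1]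

lemma continuous_clamp {E : Type*} [TopologicalSpace E] {T : ℝ} (hT : 0 ≤ T) {h : ℝ → E} (hh : ContinuousOn h (Icc 0 T)) :
    Continuous (clamp T h) :=
  hh.comp_continuous (by fun_prop) fun t => ⟨le_max_left _ _, max_le hT (min_le_left _ _)⟩

section Volterra

variable {E : Type*} [NormedAddCommGroup E] [NormedSpace ℝ E]

/-- The integral `∫₀ᵗ (t - s)^β h(s) ds`. -/
def fracIntegral (β : ℝ) (h : ℝ → E) (t : ℝ) : E := ∫ s in (0 : ℝ)..t, (t - s) ^ β • h s

/-- The integral `∫₀ᵗ (t - s)^β h(s) ds` rescaled to the unit interval. -/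
def scaledFracIntegral (β : ℝ) (h : ℝ → E) (t : ℝ) : E :=
  (max t 0) ^ (β + 1) • ∫ θ in (0 : ℝ)..1, (1 - θ) ^ β • h (t * θ)

lemma intervalIntegrable_sub_rpow {β : ℝ} (hβ : -1 < β) (a b t : ℝ) :
    IntervalIntegrable (fun s => (t - s) ^ β) volume a b := by
  have := (intervalIntegral.intervalIntegrable_rpow' (a := t - a) (b := t - b) hβ).comp_sub_left t
  simpa using this

lemma integral_sub_rpow {β : ℝ} (hβ : -1 < β) (t : ℝ) :
    ∫ s in (0 : ℝ)..t, (t - s) ^ β = t ^ (β + 1) / (β + 1) := by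
  rw [intervalIntegral.integral_comp_sub_left (fun s => s ^ β) t, integral_rpow (Or.inl hβ)]
  simp [Real.zero_rpow (by linarith : β + 1 ≠ 0)]

lemma intervalIntegrable_fracIntegrand {β : ℝ} (hβ : -1 < β) {h : ℝ → E} {a b : ℝ} (t : ℝ)
    (hh : ContinuousOn h (uIcc a b)) :
    IntervalIntegrable (fun s => (t - s) ^ β • h s) volume a b :=
  (intervalIntegrable_sub_rpow hβ a b t).smul_continuousOn hh

lemma scaledFracIntegral_eq {β : ℝ} (hβ : -1 < β) (h : ℝ → E) {t : ℝ} (ht : 0 ≤ t) :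
    scaledFracIntegral β h t = fracIntegral β h t := by
  rcases ht.eq_or_lt with rfl | ht
  · simp [scaledFracIntegral, fracIntegral, Real.zero_rpow (by linarith : β + 1 ≠ 0)]
  · have := intervalIntegral.smul_integral_comp_mul_left (a := 0) (b := 1)
      (fun s => (t - s) ^ β • h s) t
    rw [fracIntegral, scaledFracIntegral, max_eq_left ht.le]
    rw [mul_zero, mul_one] at this
    rw [← this, Real.rpow_add ht, Real.rpow_one, mul_comm, mul_smul]
    congr 1
    rw [← intervalIntegral.integral_smul]
    apply intervalIntegral.integral_congr
    intro θ hθ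
    rw [uIcc_of_le zero_le_one] at hθ
    simp only
    rw [smul_smul, ← Real.mul_rpow ht.le (by linarith [hθ.2])]
    ring_nf

/-- After rescaling, the singular weight `(1 - θ)^β` no longer depends on `t`, so dominated
convergence applies; the prefactor is continuous because `β + 1 > 0`. -/
lemma continuous_scaledFracIntegral {β : ℝ} (hβ : -1 < β) {h : ℝ → E} (hh : Continuous h) :
    Continuous (scaledFracIntegral β h) := by
  have h1 : Continuous fun t : ℝ => (max t 0) ^ (β + 1) :=
    (continuous_id.max continuous_const).rpow_const fun _ => Or.inr (by linarith)
  refine h1.smul (continuous_iff_continuousAt.2 fun t₀ => ?_)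
  obtain ⟨M, hM⟩ := (isCompact_Icc (a := -(|t₀| + 1)) (b := |t₀| + 1)).exists_bound_of_continuousOn
    hh.continuousOn
  have hint : IntervalIntegrable (fun s : ℝ => (1 - s) ^ β) volume 0 1 :=
    intervalIntegrable_sub_rpow hβ 0 1 1
  refine intervalIntegral.continuousAt_of_dominated_interval
    (bound := fun θ => (1 - θ) ^ β * M) ?_ ?_ ?_ ?_
  · refine Eventually.of_forall fun t => ?_
    exact (intervalIntegrable_fracIntegrand hβ 1 (h := fun θ => h (t * θ))
      (by fun_prop)).aestronglyMeasurable_restrict_uIoc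
  · have : ∀ᶠ t in 𝓝 t₀, |t| < |t₀| + 1 :=
      (continuous_abs.tendsto t₀).eventually (gt_mem_nhds (by linarith))
    filter_upwards [this] with t ht
    refine Eventually.of_forall fun θ hθ => ?_
    rw [uIoc_of_le zero_le_one] at hθ
    rw [norm_smul, Real.norm_of_nonneg (Real.rpow_nonneg (by linarith [hθ.2]) _)]
    refine mul_le_mul_of_nonneg_left (hM _ ?_) (Real.rpow_nonneg (by linarith [hθ.2]) _)
    rw [mem_Icc, ← abs_le, abs_mul, abs_of_pos hθ.1]
    nlinarith [abs_nonneg t, hθ.1, hθ.2]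
  · exact hint.mul_const M
  · refine Eventually.of_forall fun θ _ => ?_
    exact (continuous_const.smul (hh.comp (by fun_prop))).continuousAt

lemma norm_fracIntegral_le {β : ℝ} (hβ : -1 < β) {h : ℝ → E} {t M : ℝ} (ht : 0 ≤ t)
    (hM : ∀ s ∈ Icc 0 t, ‖h s‖ ≤ M) :
    ‖fracIntegral β h t‖ ≤ t ^ (β + 1) / (β + 1) * M := by
  rw [fracIntegral, ← integral_sub_rpow hβ, ← intervalIntegral.integral_mul_const]
  refine intervalIntegral.norm_integral_le_of_norm_le ht ?_
    ((intervalIntegrable_sub_rpow hβ 0 t t).mul_const M)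
  refine Eventually.of_forall fun s hs => ?_
  rw [norm_smul, Real.norm_of_nonneg (Real.rpow_nonneg (by linarith [hs.2]) _)]
  exact mul_le_mul_of_nonneg_left (hM s ⟨hs.1.le, hs.2⟩) (Real.rpow_nonneg (by linarith [hs.2]) _)

lemma fracIntegral_congr {β : ℝ} {h₁ h₂ : ℝ → E} {t : ℝ} (ht : 0 ≤ t)
    (h : ∀ s ∈ Icc 0 t, h₁ s = h₂ s) : fracIntegral β h₁ t = fracIntegral β h₂ t := by
  refine intervalIntegral.integral_congr fun s hs => ?_
  rw [uIcc_of_le ht] at hs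
  simp only [h s hs]

lemma fracIntegral_sub {β : ℝ} (hβ : -1 < β) {h₁ h₂ : ℝ → E} {t : ℝ}
    (hh₁ : ContinuousOn h₁ (uIcc 0 t)) (hh₂ : ContinuousOn h₂ (uIcc 0 t)) :
    fracIntegral β h₁ t - fracIntegral β h₂ t = fracIntegral β (fun s => h₁ s - h₂ s) t := by
  rw [fracIntegral, fracIntegral, fracIntegral, ← intervalIntegral.integral_sub
    (intervalIntegrable_fracIntegrand hβ t hh₁) (intervalIntegrable_fracIntegrand hβ t hh₂)]
  simp only [smul_sub]

lemma continuousOn_fracIntegral {β : ℝ} (hβ : -1 < β) {h : ℝ → E} {T : ℝ}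
    (hh : ContinuousOn h (Icc 0 T)) : ContinuousOn (fracIntegral β h) (Icc 0 T) := by
  rcases lt_or_ge T 0 with hT | hT
  · simp [Icc_eq_empty (not_le.2 hT)]
  refine (continuous_scaledFracIntegral hβ (continuous_clamp hT hh)).continuousOn.congr
    fun t ht => ?_
  rw [scaledFracIntegral_eq hβ _ ht.1]
  exact fracIntegral_congr ht.1 fun s hs => (clamp_eq ⟨hs.1, hs.2.trans ht.2⟩).symm

/-- A strongly continuous, locally bounded family of operators. -/
structure IsStrongFamily (k : ℝ → E →L[ℝ] E) : Prop where
  continuous_apply : ∀ x, Continuous fun t => k t x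
  bounded : ∀ T : ℝ, ∃ C, ∀ t, |t| ≤ T → ‖k t‖ ≤ C

/-- Split `k(t)x - k(t₀)x₀` into `k(t)(x - x₀)`, small by local boundedness, and `(k(t) - k(t₀))x₀`,
small by strong continuity. -/
lemma IsStrongFamily.continuous_uncurry {k : ℝ → E →L[ℝ] E} (hk : IsStrongFamily k) :
    Continuous fun p : ℝ × E => k p.1 p.2 := by
  rw [continuous_iff_continuousAt]
  rintro ⟨t₀, x₀⟩
  obtain ⟨C, hC⟩ := hk.bounded (|t₀| + 1)
  have hev : ∀ᶠ p : ℝ × E in 𝓝 (t₀, x₀), |p.1| < |t₀| + 1 :=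
    ((continuous_abs.comp continuous_fst).tendsto (t₀, x₀)).eventually
      (gt_mem_nhds (by simp))
  have h1 : Tendsto (fun p : ℝ × E => k p.1 (p.2 - x₀)) (𝓝 (t₀, x₀)) (𝓝 0) := by
    have h2 : Tendsto (fun p : ℝ × E => C * ‖p.2 - x₀‖) (𝓝 (t₀, x₀)) (𝓝 0) := by
      have : Continuous fun p : ℝ × E => C * ‖p.2 - x₀‖ := by fun_prop
      simpa using this.tendsto (t₀, x₀)
    refine squeeze_zero_norm' ?_ h2
    filter_upwards [hev] with p hp
    exact (k p.1).le_of_opNorm_le (hC _ hp.le) _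
  have h3 : Tendsto (fun p : ℝ × E => k p.1 x₀) (𝓝 (t₀, x₀)) (𝓝 (k t₀ x₀)) :=
    ((hk.continuous_apply x₀).comp continuous_fst).tendsto (t₀, x₀)
  have := h1.add h3
  simpa [ContinuousAt] using this

lemma IsStrongFamily.continuous_comp {X : Type*} [TopologicalSpace X] {k : ℝ → E →L[ℝ] E}
    (hk : IsStrongFamily k) {f : X → ℝ} {g : X → E} (hf : Continuous f) (hg : Continuous g) :
    Continuous fun x => k (f x) (g x) :=
  hk.continuous_uncurry.comp (hf.prodMk hg)

/-- The Duhamel term `∫₀ᵗ k(t - τ) F(τ) dτ`. -/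
def duhamel (k : ℝ → E →L[ℝ] E) (F : ℝ → E) (t : ℝ) : E := ∫ τ in (0 : ℝ)..t, k (t - τ) (F τ)

lemma IsStrongFamily.continuous_duhamel {k : ℝ → E →L[ℝ] E} (hk : IsStrongFamily k) {F : ℝ → E}
    (hF : Continuous F) : Continuous (duhamel k F) := by
  refine intervalIntegral.continuous_parametric_intervalIntegral_of_continuous
    (f := fun t τ => k (t - τ) (F τ)) ?_ continuous_id
  exact hk.continuous_comp (by fun_prop) (by fun_prop)

lemma duhamel_congr {k : ℝ → E →L[ℝ] E} {F₁ F₂ : ℝ → E} {t : ℝ} (ht : 0 ≤ t)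
    (h : ∀ s ∈ Icc 0 t, F₁ s = F₂ s) : duhamel k F₁ t = duhamel k F₂ t := by
  refine intervalIntegral.integral_congr fun s hs => ?_
  rw [uIcc_of_le ht] at hs
  simp only [h s hs]

lemma IsStrongFamily.intervalIntegrable {k : ℝ → E →L[ℝ] E} (hk : IsStrongFamily k) {F : ℝ → E}
    {T t : ℝ} (ht : t ∈ Icc 0 T) (hF : ContinuousOn F (Icc 0 T)) :
    IntervalIntegrable (fun τ => k (t - τ) (F τ)) volume 0 t := by
  have hc : Continuous fun τ => k (t - τ) (clamp T F τ) :=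
    hk.continuous_comp (by fun_prop) (continuous_clamp (ht.1.trans ht.2) hF)
  refine (hc.intervalIntegrable 0 t).congr fun s hs => ?_
  rw [uIoc_of_le ht.1] at hs
  simp only [clamp_eq (T := T) (h := F) ⟨hs.1.le, hs.2.trans ht.2⟩]

end Volterra

/-- Fubini's theorem on a triangle. -/
lemma integral_triangle_swap {E : Type*} [NormedAddCommGroup E] [NormedSpace ℝ E]
    {φ : ℝ → ℝ → E} (hφ : Continuous (Function.uncurry φ)) {T : ℝ} (hT : 0 ≤ T) :
    ∫ t in (0 : ℝ)..T, ∫ τ in (0 : ℝ)..t, φ t τ = ∫ τ in (0 : ℝ)..T, ∫ t in τ..T, φ t τ := by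
  have hS : MeasurableSet {q : ℝ × ℝ | q.2 ≤ q.1} := measurableSet_le measurable_snd measurable_fst
  have h1 : ∫ t in (0 : ℝ)..T, ∫ τ in (0 : ℝ)..t, φ t τ =
      ∫ t in Ioc 0 T, ∫ τ in Ioc 0 T,
        {q : ℝ × ℝ | q.2 ≤ q.1}.indicator (Function.uncurry φ) (t, τ) := by
    rw [intervalIntegral.integral_of_le hT]
    refine setIntegral_congr_fun measurableSet_Ioc fun t ht => ?_
    rw [intervalIntegral.integral_of_le ht.1.le]
    have : (fun τ => {q : ℝ × ℝ | q.2 ≤ q.1}.indicator (Function.uncurry φ) (t, τ)) =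
        (Iic t).indicator (φ t) := by
      ext τ; simp [indicator, Function.uncurry]
    rw [this, setIntegral_indicator measurableSet_Iic, Ioc_inter_Iic, min_eq_right ht.2]
  have h2 : ∫ τ in (0 : ℝ)..T, ∫ t in τ..T, φ t τ =
      ∫ τ in Ioc 0 T, ∫ t in Ioc 0 T,
        {q : ℝ × ℝ | q.2 ≤ q.1}.indicator (Function.uncurry φ) (t, τ) := by
    rw [intervalIntegral.integral_of_le hT]
    refine setIntegral_congr_fun measurableSet_Ioc fun τ hτ => ?_
    rw [intervalIntegral.integral_of_le hτ.2]
    have : (fun t => {q : ℝ × ℝ | q.2 ≤ q.1}.indicator (Function.uncurry φ) (t, τ)) =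
        (Ici τ).indicator (fun t => φ t τ) := by
      ext t; simp [indicator, Function.uncurry]
    -- The slice at fixed `τ` is the closed interval `[τ, T]`, which differs from `(τ, T]` by a null
    -- set.
    rw [this, setIntegral_indicator measurableSet_Ici, ← integral_Icc_eq_integral_Ioc]
    congr 2
    ext t
    simp only [mem_Icc, mem_inter_iff, mem_Ioc, mem_Ici]
    exact ⟨fun h => ⟨⟨hτ.1.trans_le h.1, h.2⟩, h.1⟩, fun h => ⟨h.2, h.1.2⟩⟩
  rw [h1, h2]
  refine integral_integral_swap ?_
  rw [Measure.prod_restrict]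
  refine IntegrableOn.indicator ?_ hS
  exact (hφ.continuousOn.integrableOn_compact (isCompact_Icc.prod isCompact_Icc)).mono_set
    (prod_mono Ioc_subset_Icc_self Ioc_subset_Icc_self)

lemma norm_duhamel_le {E : Type*} [NormedAddCommGroup E] [NormedSpace ℝ E]
    {k : ℝ → E →L[ℝ] E} {F : ℝ → E} {t C : ℝ} {b : ℝ → ℝ} (ht : 0 ≤ t) (hb : Continuous b)
    (hC : ∀ s ∈ Icc 0 t, ‖k s‖ ≤ C) (hF : ∀ s ∈ Icc 0 t, ‖F s‖ ≤ b s) :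
    ‖duhamel k F t‖ ≤ C * ∫ s in (0 : ℝ)..t, b s := by
  rw [← intervalIntegral.integral_const_mul]
  refine intervalIntegral.norm_integral_le_of_norm_le ht (Eventually.of_forall fun s hs => ?_)
    ((hb.intervalIntegrable 0 t).const_mul C)
  have h1 := hC (t - s) ⟨by linarith [hs.2], by linarith [hs.1]⟩
  exact ((k (t - s)).le_of_opNorm_le h1 _).trans
    (mul_le_mul_of_nonneg_left (hF s ⟨hs.1.le, hs.2⟩) ((norm_nonneg _).trans h1))

lemma IsStrongFamily.duhamel_sub {E : Type*} [NormedAddCommGroup E] [NormedSpace ℝ E]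
    {k : ℝ → E →L[ℝ] E} (hk : IsStrongFamily k) {F₁ F₂ : ℝ → E} {T t : ℝ} (ht : t ∈ Icc 0 T)
    (h₁ : ContinuousOn F₁ (Icc 0 T)) (h₂ : ContinuousOn F₂ (Icc 0 T)) :
    duhamel k F₁ t - duhamel k F₂ t = duhamel k (fun s => F₁ s - F₂ s) t := by
  rw [duhamel, duhamel, duhamel, ← intervalIntegral.integral_sub
    (hk.intervalIntegrable ht h₁) (hk.intervalIntegrable ht h₂)]
  simp only [map_sub]

/-- A map that is Lipschitz on bounded sets. -/
def LipschitzOnBounded {E : Type*} [NormedAddCommGroup E] (N : E → E) : Prop :=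
  ∀ M : ℝ, ∃ L, 0 ≤ L ∧ ∀ x y, ‖x‖ ≤ M → ‖y‖ ≤ M → ‖N x - N y‖ ≤ L * ‖x - y‖

lemma LipschitzOnBounded.continuous {E : Type*} [NormedAddCommGroup E] {N : E → E}
    (hN : LipschitzOnBounded N) : Continuous N := by
  rw [continuous_iff_continuousAt]
  intro x₀
  obtain ⟨L, -, hL⟩ := hN (‖x₀‖ + 1)
  rw [ContinuousAt, tendsto_iff_norm_sub_tendsto_zero]
  have h2 : Tendsto (fun x => L * ‖x - x₀‖) (𝓝 x₀) (𝓝 0) := by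
    have : Continuous fun x => L * ‖x - x₀‖ := by fun_prop
    simpa using this.tendsto x₀
  refine squeeze_zero' (Eventually.of_forall fun _ => norm_nonneg _) ?_ h2
  have hev : ∀ᶠ x in 𝓝 x₀, ‖x‖ < ‖x₀‖ + 1 :=
    (continuous_norm.tendsto x₀).eventually (gt_mem_nhds (by simp))
  filter_upwards [hev] with x hx
  exact hL x x₀ hx.le (by linarith)

/-- Uniqueness for the Volterra equation. -/
lemma volterra_unique {E : Type*} [NormedAddCommGroup E] [NormedSpace ℝ E]
    {k : ℝ → E →L[ℝ] E} (hk : IsStrongFamily k) {N : E → E} (hN : LipschitzOnBounded N)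
    {β : ℝ} (hβ : -1 < β) {T : ℝ} {g₁ g₂ : ℝ → E} (h₁ : ContinuousOn g₁ (Icc 0 T))
    (h₂ : ContinuousOn g₂ (Icc 0 T))
    (h : ∀ t ∈ Icc 0 T, g₁ t - g₂ t = duhamel k (fracIntegral β fun s => N (g₁ s)) t -
      duhamel k (fracIntegral β fun s => N (g₂ s)) t) : EqOn g₁ g₂ (Icc 0 T) := by
  rcases lt_or_ge T 0 with hT | hT
  · simp [Icc_eq_empty (not_le.2 hT)]
  obtain ⟨M₁, hM₁⟩ := isCompact_Icc.exists_bound_of_continuousOn h₁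
  obtain ⟨M₂, hM₂⟩ := isCompact_Icc.exists_bound_of_continuousOn h₂
  obtain ⟨L, hL0, hL⟩ := hN (max M₁ M₂)
  obtain ⟨C, hC⟩ := hk.bounded T
  have hC0 : 0 ≤ C := (norm_nonneg _).trans (hC 0 (by simpa using hT))
  set A := C * (T ^ (β + 1) / (β + 1) * L) with hA
  have hA0 : 0 ≤ A := by
    have : 0 < β + 1 := by linarith
    positivity
  -- `A` bounds the combined kernel, memory and Lipschitz constants. In the norm weighted by
  -- `exp(-lam t)` the integral operator has size at most `A / lam < 1`, so the maximum `S`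
  -- satisfies `S ≤ A S / lam` and is zero.
  set lam := A + 1 with hlam
  have hlam0 : 0 < lam := by linarith
  obtain ⟨t₀, ht₀, hmax⟩ := isCompact_Icc.exists_isMaxOn (nonempty_Icc.2 hT)
    (f := fun t => Real.exp (-(lam * t)) * ‖g₁ t - g₂ t‖) (by fun_prop)
  set S := Real.exp (-(lam * t₀)) * ‖g₁ t₀ - g₂ t₀‖ with hS
  have hS0 : 0 ≤ S := by positivity
  have hle : ∀ s ∈ Icc 0 T, ‖g₁ s - g₂ s‖ ≤ S * Real.exp (lam * s) := by
    intro s hs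
    have : Real.exp (-(lam * s)) * ‖g₁ s - g₂ s‖ ≤ S := hmax hs
    rw [Real.exp_neg, inv_mul_le_iff₀ (Real.exp_pos _)] at this
    linarith
  have hcN : ∀ {g : ℝ → E}, ContinuousOn g (Icc 0 T) → ContinuousOn (fun s => N (g s)) (Icc 0 T) :=
    fun hg => hN.continuous.comp_continuousOn hg
  have key : ∀ t ∈ Icc 0 T, ‖g₁ t - g₂ t‖ ≤ A * S / lam * Real.exp (lam * t) := by
    intro t ht
    rw [h t ht, hk.duhamel_sub ht (continuousOn_fracIntegral hβ (hcN h₁))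
      (continuousOn_fracIntegral hβ (hcN h₂))]
    refine (norm_duhamel_le (C := C)
      (b := fun s => T ^ (β + 1) / (β + 1) * (L * (S * Real.exp (lam * s)))) ht.1 (by fun_prop)
      (fun s hs => hC s ?_) ?_).trans ?_
    · rw [abs_of_nonneg hs.1]; exact hs.2.trans ht.2
    · intro s hs
      have hsT : Icc 0 s ⊆ Icc 0 T := Icc_subset_Icc_right (hs.2.trans ht.2)
      rw [fracIntegral_sub hβ ((hcN h₁).mono (by rwa [uIcc_of_le hs.1]))
        ((hcN h₂).mono (by rwa [uIcc_of_le hs.1]))]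
      refine (norm_fracIntegral_le hβ hs.1 (M := L * (S * Real.exp (lam * s))) ?_).trans ?_
      · intro r hr
        refine (hL _ _ ((hM₁ r (hsT hr)).trans (le_max_left _ _))
          ((hM₂ r (hsT hr)).trans (le_max_right _ _))).trans ?_
        refine mul_le_mul_of_nonneg_left ((hle r (hsT hr)).trans ?_) hL0
        refine mul_le_mul_of_nonneg_left (Real.exp_le_exp.2 ?_) hS0
        exact mul_le_mul_of_nonneg_left hr.2 hlam0.le
      · refine mul_le_mul_of_nonneg_right ?_ (by positivity)
        exact div_le_div_of_nonneg_right
          (Real.rpow_le_rpow hs.1 (hs.2.trans ht.2) (by linarith)) (by linarith)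
    · have hI : ∫ s in (0 : ℝ)..t, Real.exp (lam * s) = lam⁻¹ * (Real.exp (lam * t) - 1) := by
        rw [intervalIntegral.integral_comp_mul_left _ hlam0.ne', integral_exp]
        simp
      simp only [intervalIntegral.integral_const_mul, hI]
      have : C * (T ^ (β + 1) / (β + 1) * (L * (S * (lam⁻¹ * (Real.exp (lam * t) - 1))))) =
          A * S / lam * (Real.exp (lam * t) - 1) := by
        rw [hA]; field_simp
      rw [this]
      exact mul_le_mul_of_nonneg_left (by linarith) (by positivity)
  have hSle : S ≤ A * S / lam := by
    calc S ≤ Real.exp (-(lam * t₀)) * (A * S / lam * Real.exp (lam * t₀)) :=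
          mul_le_mul_of_nonneg_left (key t₀ ht₀) (Real.exp_pos _).le
      _ = A * S / lam := by
          rw [mul_left_comm, ← Real.exp_add]; simp
  have hSz : S ≤ 0 := by
    rw [le_div_iff₀ hlam0] at hSle
    nlinarith
  intro t ht
  have := hle t ht
  rw [le_antisymm hSz hS0, zero_mul] at this
  exact sub_eq_zero.1 (norm_le_zero_iff.1 this)

lemma scaledFracIntegral_sub {E : Type*} [NormedAddCommGroup E] [NormedSpace ℝ E] {β : ℝ}
    (hβ : -1 < β) {h₁ h₂ : ℝ → E} {t : ℝ} (ht : 0 ≤ t) (hh₁ : Continuous h₁)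
    (hh₂ : Continuous h₂) : scaledFracIntegral β h₁ t - scaledFracIntegral β h₂ t =
      fracIntegral β (fun s => h₁ s - h₂ s) t := by
  rw [scaledFracIntegral_eq hβ _ ht, scaledFracIntegral_eq hβ _ ht,
    fracIntegral_sub hβ hh₁.continuousOn hh₂.continuousOn]

lemma rpow_div_le_of_le_one {β t : ℝ} (hβ : -1 < β) (ht : 0 ≤ t) (ht1 : t ≤ 1) :
    t ^ (β + 1) / (β + 1) ≤ 1 / (β + 1) :=
  div_le_div_of_nonneg_right (Real.rpow_le_one ht ht1 (by linarith)) (by linarith)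

/-- Local existence for the Volterra equation. -/
lemma volterra_exists {E : Type*} [NormedAddCommGroup E] [NormedSpace ℝ E] [CompleteSpace E]
    {k : ℝ → E →L[ℝ] E} (hk : IsStrongFamily k) {N : E → E} (hN : LipschitzOnBounded N)
    {β : ℝ} (hβ : -1 < β) {w : ℝ → E} (hw : Continuous w) :
    ∃ T > 0, ∃ g : ℝ → E, Continuous g ∧
      ∀ t ∈ Icc 0 T, g t = w t + duhamel k (fracIntegral β fun s => N (g s)) t := by
  obtain ⟨W, hW⟩ := (isCompact_Icc (a := (0 : ℝ)) (b := 1)).exists_bound_of_continuousOn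
    hw.continuousOn
  -- The linear part has norm at most `W` on `[0, 1]`; the radius `W + 1` leaves room of size one
  -- for the Duhamel term.
  obtain ⟨L, hL0, hL⟩ := hN (W + 1)
  obtain ⟨C, hC⟩ := hk.bounded 1
  have hC0 : 0 ≤ C := (norm_nonneg _).trans (hC 0 (by simp))
  have hW0 : 0 ≤ W := (norm_nonneg _).trans (hW 0 (by simp))
  have hβ1 : 0 < β + 1 := by linarith
  set M := L * (W + 1) + ‖N 0‖ with hM
  have hM0 : 0 ≤ M := by positivity
  set D := C * (1 / (β + 1) * (M + L)) with hD
  have hD0 : 0 ≤ D := by positivity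
  -- `D` dominates both the size and the Lipschitz constant of the Duhamel term per unit of time, so
  -- `D T ≤ 1/2` makes the ball invariant and the map a contraction at once.
  set T := 1 / (2 * (D + 1)) with hTdef
  have hT0 : 0 < T := by positivity
  have hDT : D * T ≤ 1 / 2 := by
    rw [hTdef, mul_one_div, div_le_div_iff₀ (by positivity) (by norm_num)]
    linarith
  have hT1 : T ≤ 1 := by
    rw [hTdef, div_le_one (by positivity)]
    linarith
  have hC' : ∀ t ∈ Icc 0 T, ∀ s ∈ Icc 0 t, ‖k s‖ ≤ C := fun t ht s hs =>
    hC s (by rw [abs_of_nonneg hs.1]; exact hs.2.trans (ht.2.trans hT1))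
  have hext : ∀ g : C(Icc 0 T, E), Continuous (IccExtend hT0.le g) := fun g => g.continuous.Icc_extend'
  have hNext : ∀ g : C(Icc 0 T, E), Continuous fun s => N (IccExtend hT0.le g s) :=
    fun g => hN.continuous.comp (hext g)
  -- The rescaled memory integral is used since it is continuous on the whole line; it agrees with
  -- the true one for nonnegative times.
  let Ψ : C(Icc 0 T, E) → C(Icc 0 T, E) := fun g =>
    ⟨fun t => w t + duhamel k (scaledFracIntegral β fun s => N (IccExtend hT0.le g s)) t,
      (hw.add (hk.continuous_duhamel (continuous_scaledFracIntegral hβ (hNext g)))).comp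
        continuous_subtype_val⟩
  have hnext : ∀ (g : C(Icc 0 T, E)) s, ‖IccExtend hT0.le g s‖ ≤ ‖g‖ := fun g s =>
    g.norm_coe_le_norm _
  have hnext2 : ∀ (g h : C(Icc 0 T, E)) s,
      ‖IccExtend hT0.le g s - IccExtend hT0.le h s‖ ≤ ‖g - h‖ := fun g h s =>
    (g - h).norm_coe_le_norm (projIcc 0 T hT0.le s)
  have hNM : ∀ x, ‖x‖ ≤ W + 1 → ‖N x‖ ≤ M := by
    intro x hx
    have h1 := hL x 0 hx (by simp; linarith)
    have h2 : ‖N x‖ ≤ ‖N x - N 0‖ + ‖N 0‖ := by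
      simpa using norm_add_le (N x - N 0) (N 0)
    rw [sub_zero] at h1
    nlinarith
  have hmem : ∀ g : C(Icc 0 T, E), ‖g‖ ≤ W + 1 → ‖Ψ g‖ ≤ W + 1 := by
    intro g hg
    rw [ContinuousMap.norm_le _ (by linarith)]
    rintro ⟨t, ht⟩
    refine (norm_add_le _ _).trans (add_le_add (hW t ⟨ht.1, ht.2.trans hT1⟩) ?_)
    refine (norm_duhamel_le (C := C) (b := fun _ => 1 / (β + 1) * M) ht.1 (by fun_prop)
      (hC' t ht) ?_).trans ?_
    · intro s hs
      rw [scaledFracIntegral_eq hβ _ hs.1]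
      refine (norm_fracIntegral_le hβ hs.1 (M := M) fun r _ => hNM _ ((hnext g r).trans hg)).trans ?_
      exact mul_le_mul_of_nonneg_right
        (rpow_div_le_of_le_one hβ hs.1 (hs.2.trans (ht.2.trans hT1))) hM0
    · rw [intervalIntegral.integral_const, smul_eq_mul, sub_zero]
      have h1 : C * (t * (1 / (β + 1) * M)) ≤ T * D := by
        rw [hD, mul_left_comm]
        refine mul_le_mul ht.2 ?_ (by positivity) hT0.le
        gcongr
        linarith
      linarith
  have hlip : ∀ g h : C(Icc 0 T, E), ‖g‖ ≤ W + 1 → ‖h‖ ≤ W + 1 →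
      ‖Ψ g - Ψ h‖ ≤ 1 / 2 * ‖g - h‖ := by
    intro g h hg hh
    rw [ContinuousMap.norm_le _ (by positivity)]
    rintro ⟨t, ht⟩
    have : (Ψ g - Ψ h) ⟨t, ht⟩ =
        duhamel k (fun s => scaledFracIntegral β (fun s => N (IccExtend hT0.le g s)) s -
          scaledFracIntegral β (fun s => N (IccExtend hT0.le h s)) s) t := by
      rw [← hk.duhamel_sub (T := T) ht
        (continuous_scaledFracIntegral hβ (hNext g)).continuousOn
        (continuous_scaledFracIntegral hβ (hNext h)).continuousOn]
      simp [Ψ]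
    rw [this]
    refine (norm_duhamel_le (C := C) (b := fun _ => 1 / (β + 1) * (L * ‖g - h‖)) ht.1
      (by fun_prop) (hC' t ht) ?_).trans ?_
    · intro s hs
      rw [scaledFracIntegral_sub hβ hs.1 (hNext g) (hNext h)]
      refine (norm_fracIntegral_le hβ hs.1 (M := L * ‖g - h‖) fun r _ => ?_).trans ?_
      · exact (hL _ _ ((hnext g r).trans hg) ((hnext h r).trans hh)).trans
          (mul_le_mul_of_nonneg_left (hnext2 g h r) hL0)
      · exact mul_le_mul_of_nonneg_right
          (rpow_div_le_of_le_one hβ hs.1 (hs.2.trans (ht.2.trans hT1))) (by positivity)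
    · rw [intervalIntegral.integral_const, smul_eq_mul, sub_zero]
      have h1 : C * (t * (1 / (β + 1) * (L * ‖g - h‖))) ≤ (T * D) * ‖g - h‖ := by
        have : C * (t * (1 / (β + 1) * (L * ‖g - h‖))) =
            t * (C * (1 / (β + 1) * L)) * ‖g - h‖ := by ring
        rw [this]
        refine mul_le_mul_of_nonneg_right ?_ (norm_nonneg _)
        refine mul_le_mul ht.2 ?_ (by positivity) hT0.le
        rw [hD]
        gcongr
        linarith
      refine h1.trans (mul_le_mul_of_nonneg_right ?_ (norm_nonneg _))
      linarith
  let Ψ' : Metric.closedBall (0 : C(Icc 0 T, E)) (W + 1) →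
      Metric.closedBall (0 : C(Icc 0 T, E)) (W + 1) := fun g =>
    ⟨Ψ g.1, mem_closedBall_zero_iff.2 (hmem _ (mem_closedBall_zero_iff.1 g.2))⟩
  have hcontr : ContractingWith (1 / 2) Ψ' := by
    refine ⟨?_, LipschitzWith.of_dist_le_mul fun g h => ?_⟩
    · rw [← NNReal.coe_lt_coe]; norm_num
    rw [Subtype.dist_eq, Subtype.dist_eq, dist_eq_norm, dist_eq_norm]
    simpa using hlip g.1 h.1 (mem_closedBall_zero_iff.1 g.2) (mem_closedBall_zero_iff.1 h.2)
  have : CompleteSpace (Metric.closedBall (0 : C(Icc 0 T, E)) (W + 1)) :=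
    Metric.isClosed_closedBall.completeSpace_coe
  have : Nonempty (Metric.closedBall (0 : C(Icc 0 T, E)) (W + 1)) :=
    ⟨⟨0, mem_closedBall_zero_iff.2 (by rw [norm_zero]; linarith)⟩⟩
  obtain ⟨g, hg⟩ : ∃ g, Ψ' g = g := ⟨_, hcontr.fixedPoint_isFixedPt⟩
  refine ⟨T, hT0, IccExtend hT0.le g.1, hext _, fun t ht => ?_⟩
  have h1 : Ψ g.1 = g.1 := congrArg Subtype.val hg
  have h2 : Ψ g.1 ⟨t, ht⟩ = g.1 ⟨t, ht⟩ := by rw [h1]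
  rw [IccExtend_of_mem _ _ ht, ← h2]
  show w t + duhamel k _ t = _
  rw [duhamel_congr ht.1 fun s hs => scaledFracIntegral_eq hβ _ hs.1]

section Derivative

variable {E : Type*} [NormedAddCommGroup E] [NormedSpace ℝ E] [CompleteSpace E]

/-- Since `k 0 = 0`, differentiating the Duhamel term produces no boundary term. The integrated form
follows by exchanging integrals over the triangle, and exhibits the Duhamel term as a primitive of a
continuous function. -/
lemma duhamel_eq_integral {k k' : ℝ → E →L[ℝ] E} (hk' : IsStrongFamily k')
    (hd : ∀ x t, HasDerivAt (fun t => k t x) (k' t x) t) (h0 : k 0 = 0) {F : ℝ → E}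
    (hF : Continuous F) {t : ℝ} (ht : 0 ≤ t) :
    duhamel k F t = ∫ s in (0 : ℝ)..t, duhamel k' F s := by
  unfold duhamel
  rw [integral_triangle_swap (φ := fun s τ => k' (s - τ) (F τ))
    (hk'.continuous_comp (by fun_prop) (by fun_prop)) ht]
  refine intervalIntegral.integral_congr fun τ _ => ?_
  show k (t - τ) (F τ) = ∫ s in τ..t, k' (s - τ) (F τ)
  rw [intervalIntegral.integral_eq_sub_of_hasDerivAt
    (f := fun s => k (s - τ) (F τ)) (f' := fun s => k' (s - τ) (F τ))]
  · simp [h0]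
  · exact fun s _ => (hd (F τ) (s - τ)).comp_sub_const s τ
  · exact (hk'.continuous_comp (by fun_prop) continuous_const).intervalIntegrable _ _

end Derivative

end DampedWave
end

/-! ### Pointwise properties of the symbols of `K₀` and `K₁`. -/

noncomputable section

namespace DampedWave

open Filter Topology Set

lemma rootSymbol_sq {r : ℝ} (hr : 0 ≤ r) : rootSymbol r ^ 2 = ((r ^ 2 - 1 / 4 : ℝ) : ℂ) := by
  unfold rootSymbol
  split_ifs with h
  · rw [← Complex.ofReal_pow, Real.sq_sqrt (by nlinarith)]
  · rw [mul_pow, Complex.I_sq, ← Complex.ofReal_pow, Real.sq_sqrt (by nlinarith [not_lt.1 h])]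
    push_cast; ring

/-- Controls the growth of `cos(ta)` and `sin(ta)` by `exp(|t|/2)`, uniformly in the frequency. -/
lemma abs_im_rootSymbol_le (r : ℝ) : |(rootSymbol r).im| ≤ 1 / 2 := by
  unfold rootSymbol
  split_ifs with h
  · simp
  · simp only [Complex.mul_im, Complex.I_re, Complex.I_im, Complex.ofReal_re, Complex.ofReal_im]
    rw [zero_mul, one_mul, zero_add, abs_of_nonneg (Real.sqrt_nonneg _)]
    rw [Real.sqrt_le_left (by norm_num)]
    nlinarith

lemma measurable_rootSymbol : Measurable rootSymbol := by
  unfold rootSymbol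
  refine Measurable.ite (measurableSet_lt measurable_const measurable_id) ?_ ?_
  · exact Complex.measurable_ofReal.comp (by fun_prop)
  · exact (Complex.measurable_ofReal.comp (by fun_prop)).const_mul _

/-- The root is real or purely imaginary. As `cos z` and `sin z / z` are even, both symbols are
therefore real. -/
lemma conj_rootSymbol (r : ℝ) :
    (starRingEnd ℂ) (rootSymbol r) = rootSymbol r ∨ (starRingEnd ℂ) (rootSymbol r) = -rootSymbol r := by
  unfold rootSymbol
  split_ifs <;> simp

lemma conj_symbolK0 (t r : ℝ) : (starRingEnd ℂ) (symbolK0 t r) = symbolK0 t r := by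
  unfold symbolK0
  rw [map_mul, ← Complex.cos_conj, map_mul, Complex.conj_ofReal, Complex.conj_ofReal]
  rcases conj_rootSymbol r with h | h <;> simp [h]

lemma conj_symbolK1 (t r : ℝ) : (starRingEnd ℂ) (symbolK1 t r) = symbolK1 t r := by
  unfold symbolK1
  split_ifs
  · simp only [map_mul, Complex.conj_ofReal]
  rw [map_mul, map_div₀, ← Complex.sin_conj, map_mul, Complex.conj_ofReal, Complex.conj_ofReal]
  rcases conj_rootSymbol r with h | h <;> simp [h]

lemma measurable_symbolK0 (t : ℝ) : Measurable (symbolK0 t) := by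
  unfold symbolK0
  have := measurable_rootSymbol
  fun_prop

lemma measurable_symbolK1 (t : ℝ) : Measurable (symbolK1 t) := by
  unfold symbolK1
  have := measurable_rootSymbol
  refine Measurable.const_mul (Measurable.ite ?_ measurable_const ?_) _
  · exact measurable_rootSymbol (measurableSet_singleton 0)
  · fun_prop

@[simp] lemma symbolK0_zero (r : ℝ) : symbolK0 0 r = 1 := by simp [symbolK0]

@[simp] lemma symbolK1_zero (r : ℝ) : symbolK1 0 r = 0 := by simp [symbolK1]

lemma hasDerivAt_exp_neg_half (t : ℝ) :
    HasDerivAt (fun t : ℝ => (Real.exp (-t / 2) : ℂ)) (-(1 / 2) * (Real.exp (-t / 2) : ℂ)) t := by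
  have h : HasDerivAt (fun t : ℝ => Real.exp (-t / 2)) (Real.exp (-t / 2) * (-1 / 2)) t :=
    (((hasDerivAt_id t).neg.div_const 2)).exp
  convert h.ofReal_comp using 1
  push_cast; ring

lemma hasDerivAt_cos_mul (a : ℂ) (t : ℝ) :
    HasDerivAt (fun t : ℝ => Complex.cos ((t : ℂ) * a)) (-Complex.sin ((t : ℂ) * a) * a) t := by
  have h := ((hasDerivAt_id (t : ℂ)).mul_const a).ccos.comp_ofReal
  simpa using h

lemma hasDerivAt_sin_mul (a : ℂ) (t : ℝ) :
    HasDerivAt (fun t : ℝ => Complex.sin ((t : ℂ) * a)) (Complex.cos ((t : ℂ) * a) * a) t := by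
  have h := ((hasDerivAt_id (t : ℂ)).mul_const a).csin.comp_ofReal
  simpa using h

lemma hasDerivAt_ofReal (t : ℝ) : HasDerivAt (fun t : ℝ => (t : ℂ)) 1 t :=
  (hasDerivAt_id (t : ℂ)).comp_ofReal

/-- The factor `r² - 1/4` is unbounded: differentiating `K₀(t)` in time costs one derivative in
space beyond what `K₁` gains. -/
lemma hasDerivAt_symbolK0 {r : ℝ} (hr : 0 ≤ r) (t : ℝ) :
    HasDerivAt (fun t => symbolK0 t r)
      (-(1 / 2) * symbolK0 t r - ((r ^ 2 - 1 / 4 : ℝ) : ℂ) * symbolK1 t r) t := by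
  have h := (hasDerivAt_exp_neg_half t).mul (hasDerivAt_cos_mul (rootSymbol r) t)
  refine h.congr_deriv ?_
  rw [← rootSymbol_sq hr]
  unfold symbolK0 symbolK1
  split_ifs with h0
  · simp [h0]
  · field_simp
    ring

lemma hasDerivAt_symbolK1 (r t : ℝ) :
    HasDerivAt (fun t => symbolK1 t r) (-(1 / 2) * symbolK1 t r + symbolK0 t r) t := by
  unfold symbolK1 symbolK0
  split_ifs with h0
  · have h := (hasDerivAt_exp_neg_half t).mul (hasDerivAt_ofReal t)
    refine h.congr_deriv ?_
    simp [h0]; ring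
  · have h := (hasDerivAt_exp_neg_half t).mul ((hasDerivAt_sin_mul (rootSymbol r) t).div_const (rootSymbol r))
    refine h.congr_deriv ?_
    field_simp

lemma norm_exp_I_mul_le (t r : ℝ) :
    ‖Complex.exp ((t : ℂ) * rootSymbol r * Complex.I)‖ ≤ Real.exp (|t| / 2) ∧
      ‖Complex.exp (-((t : ℂ) * rootSymbol r) * Complex.I)‖ ≤ Real.exp (|t| / 2) := by
  have h : |t * (rootSymbol r).im| ≤ |t| / 2 := by
    rw [abs_mul]
    nlinarith [abs_nonneg t, abs_im_rootSymbol_le r]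
  rw [Complex.norm_exp, Complex.norm_exp]
  constructor <;> refine Real.exp_le_exp.2 ?_
  · simp; linarith [neg_abs_le (t * (rootSymbol r).im)]
  · simp; linarith [le_abs_self (t * (rootSymbol r).im)]

lemma norm_cos_rootSymbol_le (t r : ℝ) :
    ‖Complex.cos ((t : ℂ) * rootSymbol r)‖ ≤ Real.exp (|t| / 2) := by
  obtain ⟨h1, h2⟩ := norm_exp_I_mul_le t r
  rw [Complex.cos, norm_div, Complex.norm_two, div_le_iff₀ two_pos]
  exact (norm_add_le _ _).trans (by linarith)

lemma norm_sin_rootSymbol_le (t r : ℝ) :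
    ‖Complex.sin ((t : ℂ) * rootSymbol r)‖ ≤ Real.exp (|t| / 2) := by
  obtain ⟨h1, h2⟩ := norm_exp_I_mul_le t r
  rw [Complex.sin, norm_div, Complex.norm_two, div_le_iff₀ two_pos, norm_mul, Complex.norm_I,
    mul_one]
  exact (norm_sub_le _ _).trans (by linarith)

lemma exp_neg_half_le (t : ℝ) : Real.exp (-t / 2) ≤ Real.exp (|t| / 2) :=
  Real.exp_le_exp.2 (by linarith [neg_abs_le t])

lemma exp_half_mul_exp_half (x : ℝ) : Real.exp (x / 2) * Real.exp (x / 2) = Real.exp x := by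
  rw [← Real.exp_add]; ring_nf

lemma norm_symbolK0_le (r t : ℝ) : ‖symbolK0 t r‖ ≤ Real.exp |t| := by
  unfold symbolK0
  rw [norm_mul, Complex.norm_real, Real.norm_of_nonneg (Real.exp_pos _).le,
    ← exp_half_mul_exp_half |t|]
  exact mul_le_mul (exp_neg_half_le t) (norm_cos_rootSymbol_le t r) (norm_nonneg _)
    (Real.exp_pos _).le

/-- The gain of one derivative at high frequency: multiplying by `a` cancels the denominator of
`sin(ta)/a`. -/
lemma norm_rootSymbol_mul_symbolK1_le (r t : ℝ) :
    ‖rootSymbol r‖ * ‖symbolK1 t r‖ ≤ Real.exp |t| := by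
  unfold symbolK1
  split_ifs with h0
  · simp [h0, (Real.exp_pos _).le]
  · rw [norm_mul, Complex.norm_real, Real.norm_of_nonneg (Real.exp_pos _).le, mul_left_comm,
      norm_div, mul_div_cancel₀ _ (norm_ne_zero_iff.2 h0), ← exp_half_mul_exp_half |t|]
    exact mul_le_mul (exp_neg_half_le t) (norm_sin_rootSymbol_le t r) (norm_nonneg _)
      (Real.exp_pos _).le

/-- The time derivative of `sin(ta)/a` is `cos(ta)`, so the mean value inequality gives a bound that
is uniform through `a = 0`. -/
lemma norm_symbolK1_le (r t : ℝ) : ‖symbolK1 t r‖ ≤ |t| * Real.exp |t| := by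
  set S : ℝ → ℂ := fun s =>
    if rootSymbol r = 0 then (s : ℂ) else Complex.sin ((s : ℂ) * rootSymbol r) / rootSymbol r
  have hd : ∀ s : ℝ, HasDerivAt S (Complex.cos ((s : ℂ) * rootSymbol r)) s := by
    intro s
    simp only [S]
    split_ifs with h0
    · have h := hasDerivAt_ofReal s
      refine h.congr_deriv ?_
      simp [h0]
    · refine ((hasDerivAt_sin_mul (rootSymbol r) s).div_const (rootSymbol r)).congr_deriv ?_
      field_simp
  have hS : ‖S t‖ ≤ |t| * Real.exp (|t| / 2) := by
    have h0 : S 0 = 0 := by simp [S]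
    have := (convex_Icc (-|t|) |t|).norm_image_sub_le_of_norm_hasDerivWithin_le
      (f := S) (C := Real.exp (|t| / 2)) (x := 0) (y := t) (fun s _ => (hd s).hasDerivWithinAt)
      (fun s hs => (norm_cos_rootSymbol_le s r).trans
        (Real.exp_le_exp.2 (by linarith [abs_le.2 hs]))) (by simp)
      ⟨neg_abs_le t, le_abs_self t⟩
    rw [h0, sub_zero, sub_zero, Real.norm_eq_abs] at this
    linarith
  show ‖(Real.exp (-t / 2) : ℂ) * S t‖ ≤ _
  rw [norm_mul, Complex.norm_real, Real.norm_of_nonneg (Real.exp_pos _).le,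
    ← exp_half_mul_exp_half |t|, mul_left_comm]
  exact mul_le_mul (exp_neg_half_le t) hS (norm_nonneg _) (Real.exp_pos _).le

/-- Combines the two previous bounds through `r ≤ |a| + 1/2`, which follows from `|a|² = |r² -
1/4|`. -/
lemma one_add_mul_norm_symbolK1_le {r : ℝ} (hr : 0 ≤ r) (t : ℝ) :
    (1 + r) * ‖symbolK1 t r‖ ≤ (1 + 2 * |t|) * Real.exp |t| := by
  have h1 := norm_rootSymbol_mul_symbolK1_le r t
  have h2 := norm_symbolK1_le r t
  have h3 : r ≤ ‖rootSymbol r‖ + 1 / 2 := by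
    have h4 : ‖rootSymbol r‖ ^ 2 = |r ^ 2 - 1 / 4| := by
      rw [← norm_pow, rootSymbol_sq hr, Complex.norm_real, Real.norm_eq_abs]
    nlinarith [norm_nonneg (rootSymbol r), le_abs_self (r ^ 2 - 1 / 4)]
  have h5 : 0 ≤ |t| * Real.exp |t| := by positivity
  have h6 : r * ‖symbolK1 t r‖ ≤ (‖rootSymbol r‖ + 1 / 2) * ‖symbolK1 t r‖ :=
    mul_le_mul_of_nonneg_right h3 (norm_nonneg _)
  linarith

end DampedWave
end

/-! ### Fourier multipliers on complex and on real `L²`. -/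

noncomputable section

namespace DampedWave

open Filter Topology Set
open scoped ENNReal SchwartzMap ComplexConjugate

variable {n : ℕ}

/-- A bounded measurable real-valued even function, to be used as a Fourier symbol. -/
structure IsSymbol (m : Space n → ℂ) : Prop where
  meas : Measurable m
  bdd : ∃ C, ∀ ξ, ‖m ξ‖ ≤ C
  conj_eq : ∀ ξ, conj (m ξ) = m ξ
  even : ∀ ξ, m (-ξ) = m ξ

namespace IsSymbol

lemma memLp_top {m : Space n → ℂ} (hm : IsSymbol m) : MemLp m ∞ volume :=
  let ⟨C, hC⟩ := hm.bdd
  memLp_top_of_bound hm.meas.aestronglyMeasurable C (Eventually.of_forall hC)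

lemma add {m₁ m₂ : Space n → ℂ} (h₁ : IsSymbol m₁) (h₂ : IsSymbol m₂) :
    IsSymbol fun ξ => m₁ ξ + m₂ ξ where
  meas := h₁.meas.add h₂.meas
  bdd := let ⟨C₁, h₁⟩ := h₁.bdd; let ⟨C₂, h₂⟩ := h₂.bdd
    ⟨C₁ + C₂, fun ξ => (norm_add_le _ _).trans (add_le_add (h₁ ξ) (h₂ ξ))⟩
  conj_eq ξ := by rw [map_add, h₁.conj_eq, h₂.conj_eq]
  even ξ := by simp only [h₁.even, h₂.even]

lemma mul {m₁ m₂ : Space n → ℂ} (h₁ : IsSymbol m₁) (h₂ : IsSymbol m₂) :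
    IsSymbol fun ξ => m₁ ξ * m₂ ξ where
  meas := h₁.meas.mul h₂.meas
  bdd := let ⟨C₁, h₁⟩ := h₁.bdd; let ⟨C₂, h₂⟩ := h₂.bdd
    ⟨C₁ * C₂, fun ξ => (norm_mul_le _ _).trans
      (mul_le_mul (h₁ ξ) (h₂ ξ) (norm_nonneg _) ((norm_nonneg _).trans (h₁ ξ)))⟩
  conj_eq ξ := by rw [map_mul, h₁.conj_eq, h₂.conj_eq]
  even ξ := by simp only [h₁.even, h₂.even]

lemma const (c : ℝ) : IsSymbol fun _ : Space n => (c : ℂ) where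
  meas := measurable_const
  bdd := ⟨_, fun _ => le_rfl⟩
  conj_eq _ := Complex.conj_ofReal c
  even _ := rfl

lemma sub {m₁ m₂ : Space n → ℂ} (h₁ : IsSymbol m₁) (h₂ : IsSymbol m₂) :
    IsSymbol fun ξ => m₁ ξ - m₂ ξ := by
  convert h₁.add ((const (-1)).mul h₂) using 2
  push_cast; ring

end IsSymbol

/-- Multiplication by a bounded function on `L²`. -/
def mult (m : Space n → ℂ) : L2C n →L[ℂ] L2C n :=
  open Classical in
  if h : MemLp m ∞ volume then
    (ContinuousLinearMap.mul ℂ ℂ).holderL volume ∞ 2 2 (h.toLp m) else 0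

lemma coeFn_mult {m : Space n → ℂ} (hm : IsSymbol m) (f : L2C n) :
    mult m f =ᵐ[volume] fun ξ => m ξ * f ξ := by
  rw [mult, dif_pos hm.memLp_top]
  filter_upwards [ContinuousLinearMap.coeFn_holder (r := 2) (ContinuousLinearMap.mul ℂ ℂ)
    (hm.memLp_top.toLp m) f, hm.memLp_top.coeFn_toLp] with ξ h1 h2
  rw [ContinuousLinearMap.holderL_apply_apply, h1, h2]
  rfl

lemma norm_mult_le {m : Space n → ℂ} (hm : IsSymbol m) {C : ℝ} (hC : ∀ ξ, ‖m ξ‖ ≤ C) (f : L2C n) :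
    ‖mult m f‖ ≤ C * ‖f‖ := by
  refine Lp.norm_le_mul_norm_of_ae_le_mul ?_
  filter_upwards [coeFn_mult hm f] with ξ h
  rw [h, norm_mul]
  exact mul_le_mul_of_nonneg_right (hC ξ) (norm_nonneg _)

/-- The Fourier transform on `L²` as a linear isometry equivalence. -/
abbrev fourierEquivL2 (n : ℕ) : L2C n ≃ₗᵢ[ℂ] L2C n := Lp.fourierTransformₗᵢ (Space n) ℂ

/-- The Fourier multiplier with a bounded symbol. -/
def fmult (m : Space n → ℂ) : L2C n →L[ℂ] L2C n :=
  (fourierEquivL2 n).symm.toContinuousLinearEquiv.toContinuousLinearMap ∘L mult m ∘L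
    (fourierEquivL2 n).toContinuousLinearEquiv.toContinuousLinearMap

lemma fmult_apply (m : Space n → ℂ) (f : L2C n) : fmult m f = 𝓕⁻ (mult m (𝓕 f) : L2C n) := rfl

lemma fourier_fmult (m : Space n → ℂ) (f : L2C n) :
    (𝓕 (fmult m f) : L2C n) = mult m (𝓕 f : L2C n) := by
  rw [fmult_apply, FourierTransform.fourier_fourierInv_eq]

lemma fourier_injective_L2 {f g : L2C n} (h : (𝓕 f : L2C n) = 𝓕 g) : f = g :=
  (fourierEquivL2 n).injective h

lemma norm_fmult_le {m : Space n → ℂ} (hm : IsSymbol m) {C : ℝ} (hC : ∀ ξ, ‖m ξ‖ ≤ C)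
    (f : L2C n) : ‖fmult m f‖ ≤ C * ‖f‖ := by
  rw [← Lp.norm_fourier_eq (fmult m f), fourier_fmult, ← Lp.norm_fourier_eq f]
  exact norm_mult_le hm hC _

lemma ae_fourier_fmult {m : Space n → ℂ} (hm : IsSymbol m) (f : L2C n) :
    (𝓕 (fmult m f) : L2C n) =ᵐ[volume] fun ξ => m ξ * (𝓕 f : L2C n) ξ := by
  rw [fourier_fmult]; exact coeFn_mult hm _

lemma fmult_mul {m₁ m₂ : Space n → ℂ} (h₁ : IsSymbol m₁) (h₂ : IsSymbol m₂) (f : L2C n) :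
    fmult (fun ξ => m₁ ξ * m₂ ξ) f = fmult m₁ (fmult m₂ f) := by
  apply fourier_injective_L2
  apply Lp.ext
  filter_upwards [ae_fourier_fmult (h₁.mul h₂) f, ae_fourier_fmult h₁ (fmult m₂ f),
    ae_fourier_fmult h₂ f] with ξ e1 e2 e3
  rw [e1, e2, e3, mul_assoc]

lemma fmult_add {m₁ m₂ : Space n → ℂ} (h₁ : IsSymbol m₁) (h₂ : IsSymbol m₂) (f : L2C n) :
    fmult (fun ξ => m₁ ξ + m₂ ξ) f = fmult m₁ f + fmult m₂ f := by
  apply fourier_injective_L2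
  rw [FourierTransform.fourier_add]
  apply Lp.ext
  filter_upwards [ae_fourier_fmult (h₁.add h₂) f, ae_fourier_fmult h₁ f,
    ae_fourier_fmult h₂ f, Lp.coeFn_add (𝓕 (fmult m₁ f) : L2C n) (𝓕 (fmult m₂ f))]
    with ξ e1 e2 e3 e4
  rw [e1, e4, Pi.add_apply, e2, e3, add_mul]

lemma fmult_const (c : ℂ) (hc : IsSymbol fun _ : Space n => c) (f : L2C n) :
    fmult (fun _ => c) f = c • f := by
  apply fourier_injective_L2
  rw [FourierTransform.fourier_smul]
  apply Lp.ext
  filter_upwards [ae_fourier_fmult hc f, Lp.coeFn_smul c (𝓕 f : L2C n)] with ξ e1 e2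
  rw [e1, e2]; rfl

/-- Complex conjugation on `L²`. -/
def conjL (n : ℕ) : L2C n →L[ℝ] L2C n :=
  (Complex.conjCLE : ℂ →L[ℝ] ℂ).compLpL 2 volume

lemma coeFn_conjL (f : L2C n) : conjL n f =ᵐ[volume] fun x => conj (f x) :=
  ContinuousLinearMap.coeFn_compLpL _ _

/-- Reflection `f ↦ f(-·)` on `L²`. -/
def reflL (n : ℕ) : L2C n → L2C n :=
  Lp.compMeasurePreserving (fun x => -x) (Measure.measurePreserving_neg volume)

lemma coeFn_reflL (f : L2C n) : reflL n f =ᵐ[volume] fun x => f (-x) :=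
  Lp.coeFn_compMeasurePreserving _ _

lemma continuous_reflL : Continuous (reflL n) :=
  (Lp.isometry_compMeasurePreserving (Measure.measurePreserving_neg volume)).continuous

lemma ae_neg {P : Space n → Prop} (h : ∀ᵐ x ∂(volume : Measure (Space n)), P x) :
    ∀ᵐ x ∂(volume : Measure (Space n)), P (-x) :=
  (Measure.measurePreserving_neg volume).quasiMeasurePreserving.tendsto_ae.eventually h

/-- For Schwartz functions this is read off the Fourier integral. Both sides are continuous on `L²`,
so density finishes the proof. -/
lemma fourier_conjL (f : L2C n) : (𝓕 (conjL n f) : L2C n) = reflL n (conjL n (𝓕 f)) := by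
  refine DenseRange.induction_on (p := fun f : L2C n =>
    (𝓕 (conjL n f) : L2C n) = reflL n (conjL n (𝓕 f)))
    (SchwartzMap.denseRange_toLpCLM (p := 2) ENNReal.ofNat_ne_top) f ?_ ?_
  · refine isClosed_eq ?_ ?_
    · exact (fourierEquivL2 n).continuous.comp (conjL n).continuous
    · exact continuous_reflL.comp ((conjL n).continuous.comp (fourierEquivL2 n).continuous)
  · intro g
    have hg : conjL n (g.toLp 2) =
        ((g.postcompCLM (Complex.conjCLE : ℂ →L[ℝ] ℂ) : 𝓢(Space n, ℂ)).toLp 2) := by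
      apply Lp.ext
      filter_upwards [coeFn_conjL (g.toLp 2), g.coeFn_toLp 2 volume,
        (g.postcompCLM (Complex.conjCLE : ℂ →L[ℝ] ℂ) : 𝓢(Space n, ℂ)).coeFn_toLp 2 volume]
        with x e1 e2 e3
      rw [e1, e2, e3]; simp
    show (𝓕 (conjL n (g.toLp 2)) : L2C n) = reflL n (conjL n (𝓕 (g.toLp 2)))
    rw [hg, SchwartzMap.toLp_fourier_eq, SchwartzMap.toLp_fourier_eq]
    apply Lp.ext
    filter_upwards [coeFn_reflL (conjL n ((𝓕 g).toLp 2)), ae_neg (coeFn_conjL ((𝓕 g).toLp 2)),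
      ae_neg ((𝓕 g).coeFn_toLp 2 volume),
      (𝓕 (g.postcompCLM (Complex.conjCLE : ℂ →L[ℝ] ℂ) : 𝓢(Space n, ℂ))).coeFn_toLp 2 volume]
      with ξ e1 e2 e3 e4
    rw [e1, e2, e3, e4, SchwartzMap.fourier_coe, SchwartzMap.fourier_coe, Real.fourier_eq',
      Real.fourier_eq', ← integral_conj]
    refine integral_congr_ae (Eventually.of_forall fun x => ?_)
    simp only [SchwartzMap.postcompCLM_apply, smul_eq_mul, map_mul, ← Complex.exp_conj,
      Complex.conj_ofReal, Complex.conj_I, inner_neg_right]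
    simp

/-- Conjugation becomes conjugation plus reflection on the Fourier side, and a real even symbol is
invariant under both. Hence such multipliers preserve real functions. -/
lemma conjL_fmult {m : Space n → ℂ} (hm : IsSymbol m) (f : L2C n) :
    conjL n (fmult m f) = fmult m (conjL n f) := by
  apply fourier_injective_L2
  rw [fourier_conjL]
  apply Lp.ext
  filter_upwards [coeFn_reflL (conjL n (𝓕 (fmult m f))),
    ae_neg (coeFn_conjL (𝓕 (fmult m f))), ae_neg (ae_fourier_fmult hm f),
    ae_fourier_fmult hm (conjL n f), coeFn_reflL (conjL n (𝓕 f)), ae_neg (coeFn_conjL (𝓕 f))]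
    with ξ e1 e2 e3 e4 e5 e6
  rw [e1, e2, e3, e4, fourier_conjL, e5, e6, map_mul, hm.even, hm.conj_eq]

/-- `toComplex` as a continuous linear map. -/
def toComplexL (n : ℕ) : L2 n →L[ℝ] L2C n := Complex.ofRealCLM.compLpL 2 volume

lemma coeFn_toComplex (f : L2 n) : toComplex f =ᵐ[volume] fun x => (f x : ℂ) :=
  ContinuousLinearMap.coeFn_compLpL _ _

/-- The real part on `L²`. -/
def reL (n : ℕ) : L2C n →L[ℝ] L2 n := Complex.reCLM.compLpL 2 volume

lemma coeFn_reL (f : L2C n) : reL n f =ᵐ[volume] fun x => (f x).re :=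
  ContinuousLinearMap.coeFn_compLpL _ _

@[simp] lemma reL_toComplex (f : L2 n) : reL n (toComplex f) = f := by
  apply Lp.ext
  filter_upwards [coeFn_reL (toComplex f), coeFn_toComplex f] with x e1 e2
  rw [e1, e2, Complex.ofReal_re]

lemma toComplex_injective : Function.Injective (toComplex : L2 n → L2C n) :=
  Function.LeftInverse.injective reL_toComplex

lemma norm_toComplex (f : L2 n) : ‖toComplex f‖ = ‖f‖ := by
  rw [Lp.norm_def, Lp.norm_def]
  congr 1
  refine eLpNorm_congr_norm_ae ?_
  filter_upwards [coeFn_toComplex f] with x e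
  rw [e, Complex.norm_real]

lemma toComplex_add (f g : L2 n) : toComplex (f + g) = toComplex f + toComplex g :=
  (toComplexL n).map_add f g

lemma conjL_toComplex (f : L2 n) : conjL n (toComplex f) = toComplex f := by
  apply Lp.ext
  filter_upwards [coeFn_conjL (toComplex f), coeFn_toComplex f] with x e1 e2
  rw [e1, e2, Complex.conj_ofReal]

lemma toComplex_reL {f : L2C n} (hf : conjL n f = f) : toComplex (reL n f) = f := by
  apply Lp.ext
  filter_upwards [coeFn_conjL f, coeFn_toComplex (reL n f), coeFn_reL f] with x e1 e2 e3
  rw [hf] at e1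
  rw [e2, e3]
  exact (Complex.conj_eq_iff_re.1 e1.symm)

lemma toComplex_reL_add (f : L2C n) : toComplex (reL n f) = (1 / 2 : ℂ) • (f + conjL n f) := by
  apply Lp.ext
  filter_upwards [coeFn_conjL f, coeFn_toComplex (reL n f), coeFn_reL f,
    Lp.coeFn_smul (1 / 2 : ℂ) (f + conjL n f), Lp.coeFn_add f (conjL n f)] with x e1 e2 e3 e4 e5
  rw [e2, e3, e4, Pi.smul_apply, e5, Pi.add_apply, e1, Complex.re_eq_add_conj, smul_eq_mul]
  ring

/-- The Fourier multiplier with a real even bounded symbol, acting on real functions. -/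
def op (m : Space n → ℂ) : L2 n →L[ℝ] L2 n :=
  reL n ∘L (fmult m).restrictScalars ℝ ∘L toComplexL n

lemma op_apply (m : Space n → ℂ) (f : L2 n) : op m f = reL n (fmult m (toComplex f)) := rfl

lemma toComplex_op {m : Space n → ℂ} (hm : IsSymbol m) (f : L2 n) :
    toComplex (op m f) = fmult m (toComplex f) := by
  rw [op_apply, toComplex_reL]
  rw [conjL_fmult hm, conjL_toComplex]

lemma reL_fmult {m : Space n → ℂ} (hm : IsSymbol m) (f : L2C n) :
    reL n (fmult m f) = op m (reL n f) := by
  apply toComplex_injective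
  rw [toComplex_op hm, toComplex_reL_add, toComplex_reL_add, conjL_fmult hm, map_smul, map_add]

lemma norm_op_apply_le {m : Space n → ℂ} (hm : IsSymbol m) {C : ℝ} (hC : ∀ ξ, ‖m ξ‖ ≤ C)
    (f : L2 n) : ‖op m f‖ ≤ C * ‖f‖ := by
  rw [← norm_toComplex, toComplex_op hm, ← norm_toComplex f]
  exact norm_fmult_le hm hC _

lemma norm_op_le {m : Space n → ℂ} (hm : IsSymbol m) {C : ℝ} (hC : ∀ ξ, ‖m ξ‖ ≤ C) :
    ‖op m‖ ≤ C :=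
  ContinuousLinearMap.opNorm_le_bound _ ((norm_nonneg _).trans (hC 0))
    fun f => norm_op_apply_le hm hC f

lemma op_mul {m₁ m₂ : Space n → ℂ} (h₁ : IsSymbol m₁) (h₂ : IsSymbol m₂) (f : L2 n) :
    op (fun ξ => m₁ ξ * m₂ ξ) f = op m₁ (op m₂ f) := by
  apply toComplex_injective
  rw [toComplex_op (h₁.mul h₂), toComplex_op h₁, toComplex_op h₂, fmult_mul h₁ h₂]

lemma op_add {m₁ m₂ : Space n → ℂ} (h₁ : IsSymbol m₁) (h₂ : IsSymbol m₂) (f : L2 n) :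
    op (fun ξ => m₁ ξ + m₂ ξ) f = op m₁ f + op m₂ f := by
  apply toComplex_injective
  rw [toComplex_add, toComplex_op (h₁.add h₂), toComplex_op h₁, toComplex_op h₂,
    fmult_add h₁ h₂]

lemma op_const (c : ℝ) (f : L2 n) : op (fun _ => (c : ℂ)) f = c • f := by
  apply toComplex_injective
  rw [toComplex_op (IsSymbol.const c), fmult_const _ (IsSymbol.const c)]
  exact ((toComplexL n).map_smul c f).symm

lemma op_const_mul {m : Space n → ℂ} (c : ℝ) (hm : IsSymbol m) (f : L2 n) :
    op (fun ξ => (c : ℂ) * m ξ) f = c • op m f := by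
  rw [op_mul (IsSymbol.const c) hm, op_const]

lemma op_sub {m₁ m₂ : Space n → ℂ} (h₁ : IsSymbol m₁) (h₂ : IsSymbol m₂) (f : L2 n) :
    op (fun ξ => m₁ ξ - m₂ ξ) f = op m₁ f - op m₂ f := by
  have : (fun ξ => m₁ ξ - m₂ ξ) = fun ξ => m₁ ξ + ((-1 : ℝ) : ℂ) * m₂ ξ := by
    ext ξ; push_cast; ring
  rw [this, op_add h₁ ((IsSymbol.const _).mul h₂), op_const_mul _ h₂]
  simp [sub_eq_add_neg]

lemma norm_sq_eq_integral (f : L2C n) : ‖f‖ ^ 2 = ∫ ξ, ‖f ξ‖ ^ 2 := by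
  have h := L2.inner_def (𝕜 := ℂ) f f
  rw [inner_self_eq_norm_sq_to_K] at h
  have h2 : ∀ ξ, inner ℂ (f ξ) (f ξ) = ((‖f ξ‖ ^ 2 : ℝ) : ℂ) := fun ξ => by
    rw [inner_self_eq_norm_sq_to_K]; simp
  simp_rw [h2] at h
  rw [integral_complex_ofReal] at h
  exact Complex.ofReal_injective (by simpa using h)

lemma integrable_norm_sq (f : L2C n) : Integrable fun ξ => ‖f ξ‖ ^ 2 :=
  (Lp.memLp f).integrable_norm_pow two_ne_zero

/-- By Plancherel the squared distance is an integral of `|m i - m₀|² |F|²`; uniform boundedness and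
pointwise convergence of the symbols allow dominated convergence. -/
lemma tendsto_op {ι : Type*} {l : Filter ι} [l.IsCountablyGenerated] {m : ι → Space n → ℂ}
    {m₀ : Space n → ℂ} (hm : ∀ i, IsSymbol (m i)) (h₀ : IsSymbol m₀) {C : ℝ}
    (hC : ∀ᶠ i in l, ∀ ξ, ‖m i ξ‖ ≤ C) (hlim : ∀ ξ, Tendsto (fun i => m i ξ) l (𝓝 (m₀ ξ)))
    (f : L2 n) : Tendsto (fun i => op (m i) f) l (𝓝 (op m₀ f)) := by
  obtain ⟨C₀, hC₀⟩ := h₀.bdd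
  set F : L2C n := 𝓕 (toComplex f) with hF
  have key : ∀ i, ‖op (m i) f - op m₀ f‖ ^ 2 = ∫ ξ, ‖(m i ξ - m₀ ξ) * F ξ‖ ^ 2 := by
    intro i
    rw [← op_sub (hm i) h₀, ← norm_toComplex, toComplex_op ((hm i).sub h₀),
      ← Lp.norm_fourier_eq, norm_sq_eq_integral]
    refine integral_congr_ae ?_
    filter_upwards [ae_fourier_fmult ((hm i).sub h₀) (toComplex f)] with ξ e
    rw [e]
  have hlim' : Tendsto (fun i => ‖op (m i) f - op m₀ f‖ ^ 2) l (𝓝 0) := by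
    simp_rw [key]
    have h0 : (0 : ℝ) = ∫ ξ : Space n, (0 : ℝ) := by simp
    rw [h0]
    refine tendsto_integral_filter_of_dominated_convergence
      (fun ξ => (C + C₀) ^ 2 * ‖F ξ‖ ^ 2) ?_ ?_ ?_ ?_
    · refine Eventually.of_forall fun i => ?_
      exact ((((hm i).meas.sub h₀.meas).aestronglyMeasurable.mul
        (Lp.aestronglyMeasurable F)).norm.pow 2)
    · filter_upwards [hC] with i hi
      refine Eventually.of_forall fun ξ => ?_
      rw [norm_pow, norm_norm, norm_mul, mul_pow]
      refine mul_le_mul_of_nonneg_right (pow_le_pow_left₀ (norm_nonneg _) ?_ 2) (by positivity)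
      exact (norm_sub_le _ _).trans (add_le_add (hi ξ) (hC₀ ξ))
    · exact (integrable_norm_sq F).const_mul _
    · refine Eventually.of_forall fun ξ => ?_
      have h1 : Tendsto (fun i => ‖(m i ξ - m₀ ξ) * F ξ‖ ^ 2) l
          (𝓝 (‖(m₀ ξ - m₀ ξ) * F ξ‖ ^ 2)) :=
        ((((hlim ξ).sub_const _).mul_const _).norm).pow 2
      simpa using h1
  rw [tendsto_iff_norm_sub_tendsto_zero]
  have := hlim'.sqrt
  simpa [Real.sqrt_sq (norm_nonneg _)] using this

/-- A family of symbols depending continuously on time gives a strongly continuous family. -/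
lemma isStrongFamily_op {m : ℝ → Space n → ℂ} (hm : ∀ t, IsSymbol (m t))
    (hc : ∀ ξ, Continuous fun t => m t ξ) {b : ℝ → ℝ} (hb : Monotone b)
    (hmb : ∀ t ξ, ‖m t ξ‖ ≤ b |t|) : IsStrongFamily fun t => op (m t) where
  continuous_apply f := by
    rw [continuous_iff_continuousAt]
    intro t₀
    refine tendsto_op hm (hm t₀) (C := b (|t₀| + 1)) ?_ (fun ξ => (hc ξ).tendsto t₀) f
    have hev : ∀ᶠ t in 𝓝 t₀, |t| < |t₀| + 1 :=
      (continuous_abs.tendsto t₀).eventually (gt_mem_nhds (by linarith))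
    filter_upwards [hev] with t ht ξ
    exact (hmb t ξ).trans (hb ht.le)
  bounded T := ⟨b T, fun t ht => norm_op_le (hm t) fun ξ => (hmb t ξ).trans (hb ht)⟩

/-- Difference quotients of the family are again multipliers, whose symbols are bounded by the mean
value inequality, so the previous convergence result applies. -/
lemma hasDerivAt_op {m m' : ℝ → Space n → ℂ} (hm : ∀ t, IsSymbol (m t))
    (hm' : ∀ t, IsSymbol (m' t)) (hd : ∀ ξ t, HasDerivAt (fun t => m t ξ) (m' t ξ) t)
    {b : ℝ → ℝ} (hb : Monotone b) (hmb : ∀ t ξ, ‖m' t ξ‖ ≤ b |t|) (f : L2 n) (t₀ : ℝ) :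
    HasDerivAt (fun t => op (m t) f) (op (m' t₀) f) t₀ := by
  rw [hasDerivAt_iff_tendsto_slope]
  have hs : ∀ t, IsSymbol fun ξ => (((t - t₀)⁻¹ : ℝ) : ℂ) * (m t ξ - m t₀ ξ) := fun t =>
    (IsSymbol.const _).mul ((hm t).sub (hm t₀))
  have hslope : slope (fun t => op (m t) f) t₀ =
      fun t => op (fun ξ => (((t - t₀)⁻¹ : ℝ) : ℂ) * (m t ξ - m t₀ ξ)) f := by
    ext1 t
    rw [op_const_mul _ ((hm t).sub (hm t₀)), op_sub (hm t) (hm t₀), slope_def_module]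
  rw [hslope]
  refine tendsto_op hs (hm' t₀) (C := b (|t₀| + 1)) ?_ (fun ξ => ?_) f
  · have hev : ∀ᶠ t in 𝓝[≠] t₀, |t| < |t₀| + 1 :=
      (continuous_abs.tendsto t₀).eventually (gt_mem_nhds (by linarith)) |>.filter_mono
        nhdsWithin_le_nhds
    filter_upwards [hev, self_mem_nhdsWithin] with t ht htne ξ
    have h1 := (convex_Icc (-(|t₀| + 1)) (|t₀| + 1)).norm_image_sub_le_of_norm_hasDerivWithin_le
      (f := fun t => m t ξ) (C := b (|t₀| + 1)) (x := t₀) (y := t)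
      (fun s _ => (hd ξ s).hasDerivWithinAt) (fun s hs => (hmb s ξ).trans (hb (abs_le.2 hs)))
      (abs_le.1 (by linarith)) (abs_le.1 ht.le)
    rw [norm_mul, Complex.norm_real, norm_inv]
    have h2 : 0 < ‖t - t₀‖ := norm_pos_iff.2 (sub_ne_zero.2 htne)
    rw [inv_mul_le_iff₀ h2, mul_comm]
    exact h1
  · have h1 := hasDerivAt_iff_tendsto_slope.1 (hd ξ t₀)
    refine h1.congr fun t => ?_
    rw [slope_def_module, Complex.real_smul]

/-- Fourier multipliers with real symbols are self-adjoint. -/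
lemma inner_op {m : Space n → ℂ} (hm : IsSymbol m) (f g : L2 n) :
    inner ℝ (op m f) g = inner ℝ f (op m g) := by
  have key : ∀ a b : L2 n, ((inner ℝ a b : ℝ) : ℂ) = inner ℂ (toComplex a) (toComplex b) := by
    intro a b
    rw [L2.inner_def, L2.inner_def, ← integral_complex_ofReal]
    refine integral_congr_ae ?_
    filter_upwards [coeFn_toComplex a, coeFn_toComplex b] with x e1 e2
    rw [e1, e2]; simp
  have h : ((inner ℝ (op m f) g : ℝ) : ℂ) = ((inner ℝ f (op m g) : ℝ) : ℂ) := by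
    rw [key, key, toComplex_op hm, toComplex_op hm, ← Lp.inner_fourier_eq,
      ← Lp.inner_fourier_eq (toComplex f), L2.inner_def, L2.inner_def]
    refine integral_congr_ae ?_
    filter_upwards [ae_fourier_fmult hm (toComplex f), ae_fourier_fmult hm (toComplex g)]
      with ξ e1 e2
    rw [e1, e2]
    simp only [RCLike.inner_apply, map_mul, hm.conj_eq]
    ring
  exact_mod_cast h

/-- Links the guarded operator of the problem's definition to the bounded operator: for a bounded
symbol the guard always holds. -/
lemma op_eq_of_radial {m : ℝ → ℂ} (hm : IsSymbol fun ξ : Space n => m (2 * Real.pi * ‖ξ‖))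
    (f : L2 n) : radialMultiplier m (toComplex f) =
      toComplex (op (fun ξ => m (2 * Real.pi * ‖ξ‖)) f) := by
  have h : MemLp (fun ξ : Space n => m (2 * Real.pi * ‖ξ‖) * (𝓕 (toComplex f) : L2C n) ξ) 2
      volume := (memLp_congr_ae (coeFn_mult hm _)).1 (Lp.memLp _)
  rw [radialMultiplier, dif_pos h, toComplex_op hm, fmult_apply]
  congr 1
  apply Lp.ext
  exact h.coeFn_toLp.trans (coeFn_mult hm _).symm

end DampedWave
end

/-! ### The propagators as operator families, and `H¹` as the range of `(1 + |D|²)^{-1/2}`. -/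

noncomputable section

namespace DampedWave

open Filter Topology Set
open scoped ENNReal SchwartzMap ComplexConjugate

variable {n : ℕ}

/-- The wave number at the frequency `ξ`. -/
def waveNumber (ξ : Space n) : ℝ := 2 * Real.pi * ‖ξ‖

lemma waveNumber_nonneg (ξ : Space n) : 0 ≤ waveNumber ξ := by unfold waveNumber; positivity

lemma norm_le_waveNumber (ξ : Space n) : ‖ξ‖ ≤ waveNumber ξ := by
  unfold waveNumber
  nlinarith [norm_nonneg ξ, Real.pi_gt_three]

lemma measurable_waveNumber : Measurable (waveNumber : Space n → ℝ) := by
  unfold waveNumber; fun_prop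

/-- The symbol of `K₀(t)`. -/
def symK0 (t : ℝ) (ξ : Space n) : ℂ := symbolK0 t (waveNumber ξ)

/-- The symbol of `K₁(t)`. -/
def symK1 (t : ℝ) (ξ : Space n) : ℂ := symbolK1 t (waveNumber ξ)

/-- The symbol `(1 + |ξ|²)^{-1/2}`. -/
def symJ (ξ : Space n) : ℂ := (((1 + ‖ξ‖ ^ 2) ^ (-1 / 2 : ℝ) : ℝ) : ℂ)

/-- The symbol `(1 + |ξ|²)^{1/2}` times that of `K₁(t)`. -/
def symK1Lift (t : ℝ) (ξ : Space n) : ℂ := ((Real.sqrt (1 + ‖ξ‖ ^ 2) : ℝ) : ℂ) * symK1 t ξ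

lemma symJ_eq (ξ : Space n) : symJ ξ = (((Real.sqrt (1 + ‖ξ‖ ^ 2))⁻¹ : ℝ) : ℂ) := by
  rw [symJ, Real.sqrt_eq_rpow, ← Real.rpow_neg (by positivity)]
  norm_num

/-- This factorization lets the Duhamel integral be lifted from `H¹` to `L²`. -/
lemma symK1_eq (t : ℝ) (ξ : Space n) : symK1 t ξ = symJ ξ * symK1Lift t ξ := by
  have h : Real.sqrt (1 + ‖ξ‖ ^ 2) ≠ 0 := by positivity
  rw [symJ_eq, symK1Lift, ← mul_assoc, ← Complex.ofReal_mul, inv_mul_cancel₀ h]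
  simp

lemma norm_symJ_le_one (ξ : Space n) : ‖symJ ξ‖ ≤ 1 := by
  rw [symJ_eq, Complex.norm_real, Real.norm_of_nonneg (by positivity)]
  exact inv_le_one_of_one_le₀ (Real.one_le_sqrt.2 (by nlinarith [norm_nonneg ξ]))

lemma norm_symJ_mul_norm_le (ξ : Space n) : ‖ξ‖ * ‖symJ ξ‖ ≤ 1 := by
  rw [symJ_eq, Complex.norm_real, Real.norm_of_nonneg (by positivity), mul_inv_le_iff₀
    (by positivity), one_mul]
  exact Real.le_sqrt_of_sq_le (by linarith)

lemma isSymbol_symJ : IsSymbol (symJ : Space n → ℂ) where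
  meas := by unfold symJ; fun_prop
  bdd := ⟨1, norm_symJ_le_one⟩
  conj_eq _ := Complex.conj_ofReal _
  even ξ := by simp only [symJ, norm_neg]

lemma exp_abs_le (t : ℝ) : Real.exp |t| ≤ Real.exp (3 * |t|) :=
  Real.exp_le_exp.2 (by linarith [abs_nonneg t])

lemma norm_symK0_le (t : ℝ) (ξ : Space n) : ‖symK0 t ξ‖ ≤ Real.exp (3 * |t|) :=
  (norm_symbolK0_le _ t).trans (exp_abs_le t)

/-- The exponent `3|t|` absorbs the polynomial factor through `1 + 2|t| ≤ exp(2|t|)` and gives one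
monotone bound for all the families. -/
lemma one_add_mul_norm_symK1_le (t : ℝ) (ξ : Space n) :
    (1 + waveNumber ξ) * ‖symK1 t ξ‖ ≤ Real.exp (3 * |t|) := by
  refine (one_add_mul_norm_symbolK1_le (waveNumber_nonneg ξ) t).trans ?_
  have h1 : 1 + 2 * |t| ≤ Real.exp (2 * |t|) := by linarith [Real.add_one_le_exp (2 * |t|)]
  calc (1 + 2 * |t|) * Real.exp |t| ≤ Real.exp (2 * |t|) * Real.exp |t| :=
        mul_le_mul_of_nonneg_right h1 (Real.exp_pos _).le
    _ = Real.exp (3 * |t|) := by rw [← Real.exp_add]; ring_nf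

lemma norm_symK1_le (t : ℝ) (ξ : Space n) : ‖symK1 t ξ‖ ≤ Real.exp (3 * |t|) := by
  nlinarith [one_add_mul_norm_symK1_le t ξ, norm_nonneg (symK1 t ξ), waveNumber_nonneg ξ,
    mul_nonneg (waveNumber_nonneg ξ) (norm_nonneg (symK1 t ξ))]

lemma norm_symK1Lift_le (t : ℝ) (ξ : Space n) : ‖symK1Lift t ξ‖ ≤ Real.exp (3 * |t|) := by
  refine le_trans ?_ (one_add_mul_norm_symK1_le t ξ)
  rw [symK1Lift, norm_mul, Complex.norm_real, Real.norm_of_nonneg (Real.sqrt_nonneg _)]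
  refine mul_le_mul_of_nonneg_right ?_ (norm_nonneg _)
  have := norm_le_waveNumber ξ
  rw [Real.sqrt_le_left (by linarith [waveNumber_nonneg ξ])]
  nlinarith [norm_nonneg ξ]

lemma isSymbol_symK0 (t : ℝ) : IsSymbol (symK0 t : Space n → ℂ) where
  meas := (measurable_symbolK0 t).comp measurable_waveNumber
  bdd := ⟨_, norm_symK0_le t⟩
  conj_eq _ := conj_symbolK0 _ _
  even ξ := by simp only [symK0, waveNumber, norm_neg]

lemma isSymbol_symK1 (t : ℝ) : IsSymbol (symK1 t : Space n → ℂ) where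
  meas := (measurable_symbolK1 t).comp measurable_waveNumber
  bdd := ⟨_, norm_symK1_le t⟩
  conj_eq _ := conj_symbolK1 _ _
  even ξ := by simp only [symK1, waveNumber, norm_neg]

lemma isSymbol_symK1Lift (t : ℝ) : IsSymbol (symK1Lift t : Space n → ℂ) where
  meas := (Complex.measurable_ofReal.comp (by fun_prop)).mul (isSymbol_symK1 t).meas
  bdd := ⟨_, norm_symK1Lift_le t⟩
  conj_eq ξ := by rw [symK1Lift, map_mul, Complex.conj_ofReal, (isSymbol_symK1 t).conj_eq]
  even ξ := by rw [symK1Lift, symK1Lift, (isSymbol_symK1 t).even, norm_neg]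

lemma hasDerivAt_symK1 (ξ : Space n) (t : ℝ) :
    HasDerivAt (fun t => symK1 t ξ) (((-(1 / 2) : ℝ) : ℂ) * symK1 t ξ + symK0 t ξ) t := by
  refine (hasDerivAt_symbolK1 (waveNumber ξ) t).congr_deriv ?_
  rw [symK1, symK0]; push_cast; ring

/-- The symbol of `∂ₜ K₀(t) (1 + |D|²)^{-1/2}`. -/
def symK0JDeriv (t : ℝ) (ξ : Space n) : ℂ :=
  ((-(1 / 2) : ℝ) : ℂ) * symK0 t ξ * symJ ξ -
    ((waveNumber ξ ^ 2 - 1 / 4 : ℝ) : ℂ) * symK1 t ξ * symJ ξ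

lemma hasDerivAt_symK0_mul_symJ (ξ : Space n) (t : ℝ) :
    HasDerivAt (fun t => symK0 t ξ * symJ ξ) (symK0JDeriv t ξ) t := by
  refine ((hasDerivAt_symbolK0 (waveNumber_nonneg ξ) t).mul_const (symJ ξ)).congr_deriv ?_
  rw [symK0JDeriv, symK0, symK1]; push_cast; ring

/-- The factor `r²` is shared out as `(r |K₁|)(r |J|)`: one power is absorbed by `K₁`, the other by
the smoothing symbol, where `2π ≤ 8`. The constant `10` rounds up `1/2 + 8 + 1/4`. -/
lemma norm_symK0JDeriv_le (t : ℝ) (ξ : Space n) :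
    ‖symK0JDeriv t ξ‖ ≤ 10 * Real.exp (3 * |t|) := by
  have hK0 := norm_symK0_le t ξ
  have hK1 := norm_symK1_le t ξ
  have hK1' := one_add_mul_norm_symK1_le t ξ
  have hJ := norm_symJ_le_one ξ
  have hr := waveNumber_nonneg ξ
  have hJ' : waveNumber ξ * ‖symJ ξ‖ ≤ 8 := by
    have := norm_symJ_mul_norm_le ξ
    have h2 : waveNumber ξ * ‖symJ ξ‖ = 2 * Real.pi * (‖ξ‖ * ‖symJ ξ‖) := by
      unfold waveNumber; ring
    rw [h2]
    nlinarith [Real.pi_lt_four, Real.pi_pos, mul_nonneg (norm_nonneg ξ) (norm_nonneg (symJ ξ))]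
  set E := Real.exp (3 * |t|)
  have hE : 0 < E := Real.exp_pos _
  rw [symK0JDeriv]
  refine (norm_sub_le _ _).trans ?_
  rw [norm_mul, norm_mul, norm_mul, norm_mul, Complex.norm_real, Complex.norm_real]
  have h1 : ‖(-(1 / 2) : ℝ)‖ * ‖symK0 t ξ‖ * ‖symJ ξ‖ ≤ 1 / 2 * E := by
    rw [norm_neg, Real.norm_of_nonneg (by norm_num)]
    nlinarith [norm_nonneg (symK0 t ξ), norm_nonneg (symJ ξ),
      mul_le_mul hK0 hJ (norm_nonneg _) hE.le]
  have h2 : ‖waveNumber ξ ^ 2 - 1 / 4‖ * ‖symK1 t ξ‖ * ‖symJ ξ‖ ≤ 8 * E + 1 / 4 * E := by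
    have h3 : ‖waveNumber ξ ^ 2 - 1 / 4‖ ≤ waveNumber ξ ^ 2 + 1 / 4 :=
      (norm_sub_le _ _).trans (by simp)
    have h4 : waveNumber ξ * ‖symK1 t ξ‖ ≤ E := by nlinarith [norm_nonneg (symK1 t ξ)]
    have h5 : (waveNumber ξ * ‖symK1 t ξ‖) * (waveNumber ξ * ‖symJ ξ‖) ≤ E * 8 :=
      mul_le_mul h4 hJ' (by positivity) hE.le
    have h6 : ‖symK1 t ξ‖ * ‖symJ ξ‖ ≤ E * 1 := mul_le_mul hK1 hJ (norm_nonneg _) hE.le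
    calc _ ≤ (waveNumber ξ ^ 2 + 1 / 4) * ‖symK1 t ξ‖ * ‖symJ ξ‖ := by gcongr
      _ = (waveNumber ξ * ‖symK1 t ξ‖) * (waveNumber ξ * ‖symJ ξ‖) +
          1 / 4 * (‖symK1 t ξ‖ * ‖symJ ξ‖) := by ring
      _ ≤ _ := by linarith
  linarith

lemma isSymbol_symK0JDeriv (t : ℝ) : IsSymbol (symK0JDeriv t : Space n → ℂ) where
  meas := by
    have h0 := (isSymbol_symK0 (n := n) t).meas
    have h1 := (isSymbol_symK1 (n := n) t).meas
    have hJ := (isSymbol_symJ (n := n)).meas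
    have hr := measurable_waveNumber (n := n)
    unfold symK0JDeriv
    fun_prop
  bdd := ⟨_, norm_symK0JDeriv_le t⟩
  conj_eq ξ := by
    simp only [symK0JDeriv, map_sub, map_mul, Complex.conj_ofReal, (isSymbol_symK0 t).conj_eq,
      (isSymbol_symK1 t).conj_eq, isSymbol_symJ.conj_eq]
  even ξ := by
    simp only [symK0JDeriv, (isSymbol_symK0 t).even, (isSymbol_symK1 t).even, isSymbol_symJ.even]
    simp only [waveNumber, norm_neg]

lemma monotone_const_mul_exp {c : ℝ} (hc : 0 ≤ c) : Monotone fun s : ℝ => c * Real.exp (3 * s) :=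
  fun a b hab => mul_le_mul_of_nonneg_left (Real.exp_le_exp.2 (by linarith)) hc

lemma monotone_exp_three_mul : Monotone fun s : ℝ => Real.exp (3 * s) :=
  fun _ _ hab => Real.exp_le_exp.2 (by linarith)

lemma continuous_symK1 (ξ : Space n) : Continuous fun t => symK1 t ξ :=
  continuous_iff_continuousAt.2 fun t => (hasDerivAt_symK1 ξ t).continuousAt

lemma continuous_symK0 (ξ : Space n) : Continuous fun t => symK0 t ξ :=
  continuous_iff_continuousAt.2 fun t =>
    (hasDerivAt_symbolK0 (waveNumber_nonneg ξ) t).continuousAt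

lemma isStrongFamily_K0 : IsStrongFamily fun t => op (symK0 t : Space n → ℂ) :=
  isStrongFamily_op isSymbol_symK0 continuous_symK0 monotone_exp_three_mul norm_symK0_le

lemma isStrongFamily_K1 : IsStrongFamily fun t => op (symK1 t : Space n → ℂ) :=
  isStrongFamily_op isSymbol_symK1 continuous_symK1 monotone_exp_three_mul norm_symK1_le

lemma isStrongFamily_K1Lift : IsStrongFamily fun t => op (symK1Lift t : Space n → ℂ) :=
  isStrongFamily_op isSymbol_symK1Lift (fun ξ => (continuous_symK1 ξ).const_mul _)
    monotone_exp_three_mul norm_symK1Lift_le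

lemma isStrongFamily_K0JDeriv : IsStrongFamily fun t => op (symK0JDeriv t : Space n → ℂ) := by
  refine isStrongFamily_op isSymbol_symK0JDeriv (fun ξ => ?_)
    (monotone_const_mul_exp (by norm_num : (0 : ℝ) ≤ 10)) norm_symK0JDeriv_le
  have h0 := continuous_symK0 ξ
  have h1 := continuous_symK1 ξ
  unfold symK0JDeriv
  fun_prop

/-- The symbol of `∂ₜ K₁(t)`. -/
def symK1Deriv (t : ℝ) (ξ : Space n) : ℂ := ((-(1 / 2) : ℝ) : ℂ) * symK1 t ξ + symK0 t ξ

lemma isSymbol_symK1Deriv (t : ℝ) : IsSymbol (symK1Deriv t : Space n → ℂ) :=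
  ((IsSymbol.const _).mul (isSymbol_symK1 t)).add (isSymbol_symK0 t)

lemma op_symK1Deriv (t : ℝ) (f : L2 n) :
    op (symK1Deriv t) f = (-(1 / 2) : ℝ) • op (symK1 t) f + op (symK0 t) f := by
  rw [← op_const_mul _ (isSymbol_symK1 t), ← op_add ((IsSymbol.const _).mul (isSymbol_symK1 t))
    (isSymbol_symK0 t)]
  rfl

lemma norm_symK1Deriv_le (t : ℝ) (ξ : Space n) : ‖symK1Deriv t ξ‖ ≤ 2 * Real.exp (3 * |t|) := by
  refine (norm_add_le _ _).trans ?_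
  rw [norm_mul, Complex.norm_real, norm_neg, Real.norm_of_nonneg (by norm_num)]
  linarith [norm_symK1_le t ξ, norm_symK0_le t ξ, Real.exp_pos (3 * |t|)]

lemma isStrongFamily_K1Deriv : IsStrongFamily fun t => op (symK1Deriv t : Space n → ℂ) :=
  isStrongFamily_op isSymbol_symK1Deriv
    (fun ξ => ((continuous_symK1 ξ).const_mul _).add (continuous_symK0 ξ))
    (monotone_const_mul_exp zero_le_two) norm_symK1Deriv_le

lemma hasDerivAt_opK1 (f : L2 n) (t : ℝ) :
    HasDerivAt (fun t => op (symK1 t) f) (op (symK1Deriv t) f) t :=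
  hasDerivAt_op isSymbol_symK1 isSymbol_symK1Deriv hasDerivAt_symK1
    (monotone_const_mul_exp zero_le_two) norm_symK1Deriv_le f t

lemma hasDerivAt_opK0 (g : L2 n) (t : ℝ) :
    HasDerivAt (fun t => op (symK0 t) (op symJ g)) (op (symK0JDeriv t) g) t := by
  have := hasDerivAt_op (fun t => (isSymbol_symK0 t).mul isSymbol_symJ) isSymbol_symK0JDeriv
    hasDerivAt_symK0_mul_symJ (monotone_const_mul_exp (by norm_num : (0 : ℝ) ≤ 10))
    norm_symK0JDeriv_le g t
  simpa only [op_mul (isSymbol_symK0 _) isSymbol_symJ] using this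

lemma op_symK0_zero (f : L2 n) : op (symK0 0) f = f := by
  have : (symK0 0 : Space n → ℂ) = fun _ => ((1 : ℝ) : ℂ) := by ext; simp [symK0]
  rw [this, op_const, one_smul]

lemma op_symK1_zero : op (symK1 0 : Space n → ℂ) = 0 := by
  have : (symK1 0 : Space n → ℂ) = fun _ => ((0 : ℝ) : ℂ) := by ext; simp [symK1]
  ext1 f
  rw [this, op_const, zero_smul]; rfl

lemma op_symK1_eq (t : ℝ) (f : L2 n) : op (symK1 t) f = op symJ (op (symK1Lift t) f) := by
  rw [← op_mul isSymbol_symJ (isSymbol_symK1Lift t)]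
  congr 2
  ext ξ; exact symK1_eq t ξ

lemma op_symK0_comm (t : ℝ) (f : L2 n) :
    op (symK0 t) (op symJ f) = op symJ (op (symK0 t) f) := by
  rw [← op_mul isSymbol_symJ (isSymbol_symK0 t), ← op_mul (isSymbol_symK0 t) isSymbol_symJ]
  congr 2
  ext ξ; exact mul_comm _ _

lemma symJ_ne_zero (ξ : Space n) : symJ ξ ≠ 0 := by
  rw [symJ_eq, Complex.ofReal_ne_zero]
  positivity

/-- The symbol vanishes nowhere. This makes the lift `g` of an `H¹` function unique and allows the
smoothing operator to be cancelled in equations. -/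
lemma opJ_injective : Function.Injective (op (symJ : Space n → ℂ)) := by
  refine (injective_iff_map_eq_zero _).2 fun f hf => ?_
  have h : fmult symJ (toComplex f) = 0 := by
    rw [← toComplex_op isSymbol_symJ, hf]
    exact (toComplexL n).map_zero
  have h2 : (𝓕 (toComplex f) : L2C n) = 0 := by
    apply Lp.ext
    filter_upwards [ae_fourier_fmult isSymbol_symJ (toComplex f),
      Lp.coeFn_zero ℂ 2 (volume : Measure (Space n))] with ξ e1 e2
    rw [e2, Pi.zero_apply]
    rw [h, show (𝓕 (0 : L2C n) : L2C n) = 0 from (fourierEquivL2 n).map_zero, e2] at e1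
    exact (mul_eq_zero.1 e1.symm).resolve_left (symJ_ne_zero ξ)
  have h3 : toComplex f = 0 := by
    apply fourier_injective_L2
    rw [h2]; exact ((fourierEquivL2 n).map_zero).symm
  have h4 := congrArg (reL n) h3
  rwa [reL_toComplex, map_zero] at h4

lemma opK0_toComplex (t : ℝ) (f : L2 n) : opK0 t (toComplex f) = toComplex (op (symK0 t) f) :=
  op_eq_of_radial (isSymbol_symK0 t) f

lemma opK1_toComplex (t : ℝ) (f : L2 n) : opK1 t (toComplex f) = toComplex (op (symK1 t) f) :=
  op_eq_of_radial (isSymbol_symK1 t) f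

lemma toTemperedDistribution_injective :
    Function.Injective (fun f : L2C n => Lp.toTemperedDistribution f) := by
  have h := Lp.ker_toTemperedDistributionCLM_eq_bot (F := ℂ) (μ := (volume : Measure (Space n)))
    (p := 2)
  exact LinearMap.ker_eq_bot.1 h

lemma besselPotential_neg_one_toTemperedDistribution (G : L2C n) :
    besselPotential (Space n) ℂ (-1) (Lp.toTemperedDistribution G) =
      Lp.toTemperedDistribution (fmult symJ G) := by
  rw [besselPotential, TemperedDistribution.fourierMultiplierCLM_apply,
    Lp.fourier_toTemperedDistribution_eq]
  have hg : (fun x : Space n => (((1 + ‖x‖ ^ 2) ^ ((-1 : ℝ) / 2) : ℝ) : ℂ)).HasTemperateGrowth := by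
    fun_prop
  rw [← Lp.toTemperedDistribution_smul_eq (p := ∞) (q := 2) (r := 2) hg isSymbol_symJ.memLp_top,
    Lp.fourierInv_toTemperedDistribution_eq, fmult_apply]
  congr 2
  apply Lp.ext
  filter_upwards [Lp.coeFn_lpSMul (r := 2) (isSymbol_symJ.memLp_top.toLp symJ) (𝓕 G : L2C n),
    isSymbol_symJ.memLp_top.coeFn_toLp, coeFn_mult isSymbol_symJ (𝓕 G : L2C n)] with ξ e1 e2 e3
  rw [e3]
  refine Eq.trans e1 ?_
  rw [Pi.smul_apply', e2, smul_eq_mul]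

/-- Replaces the distributional description of `H¹` by an identity between `L²` functions. -/
lemma besselPotential_one_eq_iff (f G : L2C n) :
    besselPotential (Space n) ℂ 1 (Lp.toTemperedDistribution f) = Lp.toTemperedDistribution G ↔
      f = fmult symJ G := by
  rw [← besselPotential_neg_apply_eq_iff, besselPotential_neg_one_toTemperedDistribution]
  exact ⟨fun h => (toTemperedDistribution_injective h).symm, fun h => by rw [h]⟩

lemma memH1_iff (f : L2 n) : MemH1 f ↔ ∃ g : L2 n, f = op symJ g := by
  constructor
  · rintro ⟨G, hG⟩
    rw [besselPotential_one_eq_iff] at hG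
    exact ⟨reL n G, by rw [← reL_fmult isSymbol_symJ, ← hG, reL_toComplex]⟩
  · rintro ⟨g, rfl⟩
    exact ⟨toComplex g, by rw [besselPotential_one_eq_iff, toComplex_op isSymbol_symJ]⟩

lemma continuousOnH1_iff (u : ℝ → L2 n) (I : Set ℝ) :
    ContinuousOnH1 u I ↔ ∃ g : ℝ → L2 n, ContinuousOn g I ∧ ∀ t ∈ I, u t = op symJ (g t) := by
  constructor
  · rintro ⟨G, hG, h⟩
    refine ⟨fun t => reL n (G t), (reL n).continuous.comp_continuousOn hG, fun t ht => ?_⟩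
    rw [← reL_fmult isSymbol_symJ, ← (besselPotential_one_eq_iff _ _).1 (h t ht), reL_toComplex]
  · rintro ⟨g, hg, h⟩
    refine ⟨fun t => toComplex (g t), (toComplexL n).continuous.comp_continuousOn hg,
      fun t ht => ?_⟩
    rw [besselPotential_one_eq_iff, h t ht, toComplex_op isSymbol_symJ]

end DampedWave
end

/-! ### The Sobolev embedding by splitting into low and high frequencies. -/

noncomputable section

namespace DampedWave

open Filter Topology Set
open scoped ENNReal SchwartzMap ComplexConjugate Pointwise

variable {n : ℕ}

/-- An `L²` function with integrable Fourier transform is bounded. -/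
lemma ae_norm_le_of_integrable_fourier (f : L2C n) (hf : Integrable (𝓕 f : L2C n)) :
    ∀ᵐ x ∂(volume : Measure (Space n)), ‖f x‖ ≤ ∫ ξ, ‖(𝓕 f : L2C n) ξ‖ := by
  set H : L2C n := 𝓕 f with hH
  -- The inverse Fourier integral of `H`: the sign of the pairing turns the forward transform into
  -- the inverse one.
  set v : Space n → ℂ := VectorFourier.fourierIntegral Real.fourierChar volume
    (-(innerₗ (Space n))) H with hv
  have hLc : Continuous fun p : Space n × Space n => (-(innerₗ (Space n))) p.1 p.2 := by
    simp only [LinearMap.neg_apply, innerₗ_apply_apply]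
    fun_prop
  have hvc : Continuous v := VectorFourier.fourierIntegral_continuous Real.continuous_fourierChar
    hLc hf
  have hvb : ∀ x, ‖v x‖ ≤ ∫ ξ, ‖H ξ‖ := fun x =>
    VectorFourier.norm_fourierIntegral_le_integral_norm _ _ _ _ _
  -- The `L²` inverse transform and the inverse integral agree because they give the same pairing
  -- with every smooth compactly supported function.
  have hae : ∀ᵐ x ∂(volume : Measure (Space n)), f x = v x := by
    refine ae_eq_of_integral_contDiff_smul_eq ?_ hvc.locallyIntegrable ?_
    · exact (Lp.memLp f).locallyIntegrable (by norm_num)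
    · intro g hg hgc
      have hg₁ : HasCompactSupport (Complex.ofRealCLM ∘ g) := hgc.comp_left rfl
      have hg₂ : ContDiff ℝ ((⊤ : ℕ∞) : WithTop ℕ∞) (Complex.ofRealCLM ∘ g) := by fun_prop
      set φ : 𝓢(Space n, ℂ) := hg₁.toSchwartzMap hg₂ with hφ
      have h1 : Lp.toTemperedDistribution f φ = Lp.toTemperedDistribution H (𝓕⁻ φ) := by
        rw [← TemperedDistribution.fourierInv_apply, Lp.fourierInv_toTemperedDistribution_eq, hH,
          FourierTransform.fourierInv_fourier_eq]
      rw [Lp.toTemperedDistribution_apply, Lp.toTemperedDistribution_apply] at h1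
      have h2 := VectorFourier.integral_fourierIntegral_smul_eq_flip (μ := volume) (ν := volume)
        (L := -(innerₗ (Space n))) (f := φ) (g := H) Real.continuous_fourierChar hLc
        φ.integrable hf
      have h3 : (-(innerₗ (Space n))).flip = -(innerₗ (Space n)) := by
        ext x y; simp [real_inner_comm]
      have h4 : ∀ ξ, (𝓕⁻ φ) ξ = VectorFourier.fourierIntegral Real.fourierChar volume
          (-(innerₗ (Space n))) φ ξ := by
        intro ξ
        rw [SchwartzMap.fourierInv_coe, Real.fourierInv_eq]
        simp [VectorFourier.fourierIntegral]
      rw [h3] at h2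
      simp only [h4] at h1
      rw [h2] at h1
      exact h1
  filter_upwards [hae] with x hx
  rw [hx]; exact hvb x

/-- The indicator symbol of the ball of radius `A`. -/
def symLow (A : ℝ) (ξ : Space n) : ℂ := if ‖ξ‖ < A then 1 else 0

lemma isSymbol_symLow (A : ℝ) : IsSymbol (symLow A : Space n → ℂ) where
  meas := Measurable.ite (measurableSet_lt measurable_norm measurable_const)
    measurable_const measurable_const
  bdd := ⟨1, fun ξ => by unfold symLow; split_ifs <;> simp⟩
  conj_eq ξ := by unfold symLow; split_ifs <;> simp
  even ξ := by simp only [symLow, norm_neg]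

/-- The symbol is at most `min(1, 1/|ξ|)`. The homogeneous majorant makes frequency integrals over
balls scale exactly. -/
lemma norm_symJ_le_rpow {s : ℝ} (hs0 : 0 ≤ s) (hs1 : s ≤ 1) {ξ : Space n} (hξ : ξ ≠ 0) :
    ‖symJ ξ‖ ≤ ‖ξ‖ ^ (-s) := by
  have hpos : 0 < ‖ξ‖ := norm_pos_iff.2 hξ
  rcases le_total 1 ‖ξ‖ with h | h
  · have h1 := norm_symJ_mul_norm_le ξ
    calc ‖symJ ξ‖ ≤ ‖ξ‖⁻¹ := by rw [← one_div, le_div_iff₀ hpos]; linarith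
      _ = ‖ξ‖ ^ (-1 : ℝ) := (Real.rpow_neg_one _).symm
      _ ≤ ‖ξ‖ ^ (-s) := Real.rpow_le_rpow_of_exponent_le h (by linarith)
  · exact (norm_symJ_le_one ξ).trans (Real.one_le_rpow_of_pos_of_le_one_of_nonpos hpos h (by linarith))

lemma integrableOn_norm_rpow_ball (hn : 1 ≤ n) {s : ℝ} (hs : 2 * s < n) (A : ℝ) :
    IntegrableOn (fun ξ : Space n => (‖ξ‖ ^ (-s)) ^ 2) (Metric.ball 0 A) := by
  refine integrableOn_ball_of_norm_le_rpow (C := 1) (α := 2 * s) (by simpa using hn)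
    (by simpa using hs) (Eventually.of_forall fun ξ => ?_)
    (by fun_prop : Measurable fun ξ : Space n => (‖ξ‖ ^ (-s)) ^ 2).aestronglyMeasurable
  rw [Real.norm_of_nonneg (by positivity), one_mul, ← Real.rpow_mul_natCast (norm_nonneg _)]
  norm_num
  rw [mul_comm]

lemma setIntegral_norm_rpow_ball (s : ℝ) {A : ℝ} (hA : 0 < A) :
    ∫ ξ in Metric.ball (0 : Space n) A, (‖ξ‖ ^ (-s)) ^ 2 =
      (A ^ ((n : ℝ) / 2 - s)) ^ 2 * ∫ ξ in Metric.ball (0 : Space n) 1, (‖ξ‖ ^ (-s)) ^ 2 := by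
  have h := Measure.setIntegral_comp_smul_of_pos (volume : Measure (Space n))
    (fun ξ : Space n => (‖ξ‖ ^ (-s)) ^ 2) (Metric.ball 0 1) hA
  have h1 : A • Metric.ball (0 : Space n) 1 = Metric.ball 0 A := by
    rw [smul_unitBall hA.ne', Real.norm_of_nonneg hA.le]
  rw [h1] at h
  simp only [norm_smul, Real.norm_of_nonneg hA.le, finrank_euclideanSpace, Fintype.card_fin,
    smul_eq_mul] at h
  have h2 : ∀ ξ : Space n, ((A * ‖ξ‖) ^ (-s)) ^ 2 = (A ^ (-s)) ^ 2 * (‖ξ‖ ^ (-s)) ^ 2 := by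
    intro ξ
    rw [Real.mul_rpow hA.le (norm_nonneg _), mul_pow]
  simp only [h2, integral_const_mul] at h
  have h3 : (A ^ ((n : ℝ) / 2 - s)) ^ 2 = A ^ n * (A ^ (-s)) ^ 2 := by
    rw [← Real.rpow_natCast, ← Real.rpow_natCast, ← Real.rpow_natCast, ← Real.rpow_mul hA.le,
      ← Real.rpow_mul hA.le, ← Real.rpow_add hA]
    congr 1; push_cast; ring
  rw [h3, mul_assoc, h]
  field_simp

lemma norm_eq_sqrt_integral (f : L2C n) : ‖f‖ = Real.sqrt (∫ ξ, ‖f ξ‖ ^ 2) := by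
  rw [← norm_sq_eq_integral, Real.sqrt_sq (norm_nonneg _)]

/-- Below frequency `A` the transform is integrable by Cauchy–Schwarz against `|ξ|^{-s}`, so the
low-frequency part is bounded; scaling the ball gives the power of `A`. -/
lemma fourier_low_bound (hn : 1 ≤ n) {s : ℝ} (hs0 : 0 ≤ s) (hs1 : s ≤ 1) (hs : 2 * s < n)
    {A : ℝ} (hA : 0 < A) (G : L2C n) :
    ∀ᵐ x ∂(volume : Measure (Space n)), ‖fmult (symLow A) (fmult symJ G) x‖ ≤
      Real.sqrt (∫ ξ in Metric.ball (0 : Space n) 1, (‖ξ‖ ^ (-s)) ^ 2) *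
        A ^ ((n : ℝ) / 2 - s) * ‖G‖ := by
  set g : L2C n := 𝓕 G with hg
  set B := Metric.ball (0 : Space n) A with hB
  have hF : (𝓕 (fmult (symLow A) (fmult symJ G)) : L2C n) =ᵐ[volume]
      B.indicator fun ξ => symJ ξ * g ξ := by
    filter_upwards [ae_fourier_fmult (isSymbol_symLow A) (fmult symJ G),
      ae_fourier_fmult isSymbol_symJ G] with ξ e1 e2
    rw [e1, e2, symLow, indicator]
    simp only [hB, mem_ball_zero_iff]
    split_ifs <;> simp [hg]
  have hw : MemLp (fun ξ : Space n => ‖ξ‖ ^ (-s)) (ENNReal.ofReal 2) (volume.restrict B) := by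
    rw [ENNReal.ofReal_ofNat]
    refine (memLp_two_iff_integrable_sq ?_).2 (integrableOn_norm_rpow_ball hn hs A)
    exact (by fun_prop : Measurable fun ξ : Space n => ‖ξ‖ ^ (-s)).aestronglyMeasurable
  have hgn : MemLp (fun ξ : Space n => ‖g ξ‖) (ENNReal.ofReal 2) (volume.restrict B) := by
    rw [ENNReal.ofReal_ofNat]
    exact (Lp.memLp g).norm.restrict B
  have hne : ∀ᵐ ξ ∂(volume.restrict B), ξ ≠ (0 : Space n) := by
    have : Nontrivial (Space n) := by
      have : Nonempty (Fin n) := ⟨⟨0, hn⟩⟩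
      infer_instance
    exact ae_restrict_of_ae (Measure.ae_ne volume 0)
  have hle : ∀ᵐ ξ ∂(volume.restrict B), ‖symJ ξ * g ξ‖ ≤ ‖ξ‖ ^ (-s) * ‖g ξ‖ := by
    filter_upwards [hne] with ξ h0
    rw [norm_mul]
    exact mul_le_mul_of_nonneg_right (norm_symJ_le_rpow hs0 hs1 h0) (norm_nonneg _)
  have hprod : Integrable (fun ξ : Space n => ‖ξ‖ ^ (-s) * ‖g ξ‖) (volume.restrict B) := by
    rw [ENNReal.ofReal_ofNat] at hw hgn
    exact hw.integrable_mul hgn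
  have hIB : IntegrableOn (fun ξ => symJ ξ * g ξ) B :=
    hprod.mono' ((isSymbol_symJ.meas.aestronglyMeasurable.mul
      (Lp.aestronglyMeasurable g)).restrict) hle
  have hint : Integrable (𝓕 (fmult (symLow A) (fmult symJ G)) : L2C n) := by
    rw [integrable_congr hF, integrable_indicator_iff measurableSet_ball]
    exact hIB
  have hbound : ∫ ξ, ‖(𝓕 (fmult (symLow A) (fmult symJ G)) : L2C n) ξ‖ ≤
      Real.sqrt (∫ ξ in Metric.ball (0 : Space n) 1, (‖ξ‖ ^ (-s)) ^ 2) *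
        A ^ ((n : ℝ) / 2 - s) * ‖G‖ := by
    have h1 : ∫ ξ, ‖(𝓕 (fmult (symLow A) (fmult symJ G)) : L2C n) ξ‖ =
        ∫ ξ in B, ‖symJ ξ * g ξ‖ := by
      rw [← integral_indicator measurableSet_ball]
      refine integral_congr_ae ?_
      filter_upwards [hF] with ξ e
      rw [e, norm_indicator_eq_indicator_norm]
    rw [h1]
    refine (integral_mono_ae hIB.norm hprod hle).trans ?_
    refine (integral_mul_le_Lp_mul_Lq_of_nonneg (Real.HolderConjugate.two_two)
      (Eventually.of_forall fun ξ => by positivity) (Eventually.of_forall fun ξ => norm_nonneg _)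
      hw hgn).trans ?_
    simp only [Real.rpow_two]
    rw [← Real.sqrt_eq_rpow, ← Real.sqrt_eq_rpow, setIntegral_norm_rpow_ball s hA,
      Real.sqrt_mul (by positivity), Real.sqrt_sq (by positivity)]
    rw [mul_comm (A ^ _)]
    refine mul_le_mul_of_nonneg_left ?_ (by positivity)
    rw [← Lp.norm_fourier_eq G, ← hg, norm_eq_sqrt_integral]
    exact Real.sqrt_le_sqrt (setIntegral_le_integral (integrable_norm_sq g)
      (Eventually.of_forall fun ξ => by positivity))
  filter_upwards [ae_norm_le_of_integrable_fourier _ hint] with x hx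
  exact hx.trans hbound

lemma lintegral_enorm_sq (f : L2C n) : ∫⁻ x, ‖f x‖ₑ ^ 2 = ENNReal.ofReal (‖f‖ ^ 2) := by
  rw [norm_sq_eq_integral, ofReal_integral_eq_lintegral_ofReal (integrable_norm_sq f)
    (Eventually.of_forall fun x => by positivity)]
  refine lintegral_congr fun x => ?_
  rw [ENNReal.ofReal_pow (norm_nonneg _), ofReal_norm]

lemma lintegral_enorm_sq_fourier (f : L2C n) :
    ∫⁻ x, ‖f x‖ₑ ^ 2 = ∫⁻ ξ, ‖(𝓕 f : L2C n) ξ‖ₑ ^ 2 := by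
  rw [lintegral_enorm_sq, lintegral_enorm_sq, Lp.norm_fourier_eq]

lemma lintegral_Ioc_rpow {a : ℝ} (ha : -1 < a) {b : ℝ} (hb : 0 ≤ b) :
    ∫⁻ t in Ioc 0 b, ENNReal.ofReal (t ^ a) = ENNReal.ofReal (b ^ (a + 1) / (a + 1)) := by
  rw [← ofReal_integral_eq_lintegral_ofReal, ← intervalIntegral.integral_of_le hb,
    integral_rpow (Or.inl ha), Real.zero_rpow (by linarith), sub_zero]
  · exact (intervalIntegrable_iff_integrableOn_Ioc_of_le hb).1
      (intervalIntegral.intervalIntegrable_rpow' ha)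
  · exact (ae_restrict_iff' measurableSet_Ioc).2
      (Eventually.of_forall fun t ht => Real.rpow_nonneg ht.1.le _)

/-- The distribution function of a function in the range of `(1 + |D|²)^{-1/2}` is controlled by
the high frequencies. -/
lemma measure_norm_gt_le (hn : 1 ≤ n) {q K : ℝ} (hq : 2 < q)
    (hs1 : (n : ℝ) * (1 / 2 - 1 / q) ≤ 1) (hK0 : 0 < K)
    (hK : Real.sqrt (∫ ξ in Metric.ball (0 : Space n) 1,
      (‖ξ‖ ^ (-((n : ℝ) * (1 / 2 - 1 / q)))) ^ 2) ≤ K)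
    {G : L2C n} (hG : ‖G‖ ≤ 1) {t : ℝ} (ht : 0 < t) :
    volume {x | t < ‖fmult symJ G x‖} ≤ ENNReal.ofReal (4 * (t ^ 2)⁻¹) *
      ∫⁻ ξ, {ξ : Space n | t ≤ 2 * K * ‖ξ‖ ^ ((n : ℝ) / q)}.indicator
        (fun ξ => ‖symJ ξ * (𝓕 G : L2C n) ξ‖ₑ ^ 2) ξ := by
  have hn0 : (0 : ℝ) < n := by exact_mod_cast hn
  have hq0 : 0 < q := by linarith
  set s := (n : ℝ) * (1 / 2 - 1 / q) with hs
  have hs0 : 0 ≤ s := by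
    have : 1 / q ≤ 1 / 2 := one_div_le_one_div_of_le two_pos hq.le
    rw [hs]; nlinarith
  have hsn : 2 * s < n := by
    have : 0 < 1 / q := by positivity
    rw [hs]; nlinarith
  have hns : (n : ℝ) / 2 - s = n / q := by rw [hs]; ring
  -- The threshold at which the bound of the low-frequency part equals `t/2`. Where `|f| > t`, the
  -- high-frequency part then exceeds `t/2`, and Chebyshev with Plancherel bounds the measure.
  set A := (t / (2 * K)) ^ (q / n) with hA
  have hA0 : 0 < A := by positivity
  have hAt : K * A ^ ((n : ℝ) / q) = t / 2 := by
    rw [hA, ← Real.rpow_mul (by positivity), div_mul_div_cancel₀ (by positivity),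
      div_self (by positivity), Real.rpow_one]
    field_simp
  set f := fmult symJ G with hf
  set lo := fmult (symLow A) f with hlo
  have hlow : ∀ᵐ x ∂(volume : Measure (Space n)), ‖lo x‖ ≤ t / 2 := by
    filter_upwards [fourier_low_bound hn hs0 hs1 hsn hA0 G] with x hx
    refine hx.trans ?_
    rw [hns, ← hAt]
    calc _ ≤ K * A ^ ((n : ℝ) / q) * 1 := by gcongr
      _ = _ := mul_one _
  have h1 : volume {x | t < ‖f x‖} ≤
      volume {x | ENNReal.ofReal ((t / 2) ^ 2) ≤ ‖(f - lo) x‖ₑ ^ 2} := by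
    refine measure_mono_ae ?_
    filter_upwards [hlow, Lp.coeFn_sub f lo] with x hx e hxt
    have hxt' : t < ‖f x‖ := hxt
    show ENNReal.ofReal ((t / 2) ^ 2) ≤ ‖(f - lo) x‖ₑ ^ 2
    rw [e, Pi.sub_apply, ENNReal.ofReal_pow (by positivity), ← ofReal_norm]
    gcongr
    have := norm_sub_norm_le (f x) (lo x)
    linarith
  have h2 := mul_meas_ge_le_lintegral₀ (μ := (volume : Measure (Space n)))
    (f := fun x => ‖(f - lo) x‖ₑ ^ 2) ((Lp.aestronglyMeasurable (f - lo)).enorm.pow_const 2)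
    (ENNReal.ofReal ((t / 2) ^ 2))
  have h3 : ∫⁻ x, ‖(f - lo) x‖ₑ ^ 2 = ∫⁻ ξ, {ξ : Space n | t ≤ 2 * K * ‖ξ‖ ^ ((n : ℝ) / q)}.indicator
        (fun ξ => ‖symJ ξ * (𝓕 G : L2C n) ξ‖ₑ ^ 2) ξ := by
    rw [lintegral_enorm_sq_fourier]
    have h4 : (𝓕 (f - lo) : L2C n) = 𝓕 f - 𝓕 lo := (fourierEquivL2 n).map_sub f lo
    rw [h4]
    refine lintegral_congr_ae ?_
    filter_upwards [Lp.coeFn_sub (𝓕 f : L2C n) (𝓕 lo), ae_fourier_fmult (isSymbol_symLow A) f,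
      ae_fourier_fmult isSymbol_symJ G] with ξ e1 e2 e3
    rw [e1, Pi.sub_apply, hlo, e2, hf, e3, symLow, indicator]
    simp only [mem_ofPred_eq]
    have hiff : ‖ξ‖ < A ↔ ¬ t ≤ 2 * K * ‖ξ‖ ^ ((n : ℝ) / q) := by
      have h5 : t = 2 * K * A ^ ((n : ℝ) / q) := by linarith
      rw [not_le, h5, mul_lt_mul_iff_right₀ (by positivity),
        Real.rpow_lt_rpow_iff (norm_nonneg _) hA0.le (by positivity)]
    by_cases hc : t ≤ 2 * K * ‖ξ‖ ^ ((n : ℝ) / q)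
    · rw [if_neg (fun h => hiff.1 h hc), if_pos hc, zero_mul, sub_zero]
    · rw [if_pos (hiff.2 hc), if_neg hc]; simp
  rw [← h3]
  refine h1.trans ?_
  have h6 : ENNReal.ofReal (4 * (t ^ 2)⁻¹) * ENNReal.ofReal ((t / 2) ^ 2) = 1 := by
    rw [← ENNReal.ofReal_mul (by positivity)]
    rw [show 4 * (t ^ 2)⁻¹ * (t / 2) ^ 2 = 1 by field_simp; norm_num, ENNReal.ofReal_one]
  calc _ = ENNReal.ofReal (4 * (t ^ 2)⁻¹) * (ENNReal.ofReal ((t / 2) ^ 2) *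
        volume {x | ENNReal.ofReal ((t / 2) ^ 2) ≤ ‖(f - lo) x‖ₑ ^ 2}) := by
        rw [← mul_assoc, h6, one_mul]
    _ ≤ _ := by gcongr

lemma lintegral_Ioi_indicator_rpow {q b : ℝ} (hq : 2 < q) (hb : 0 ≤ b) :
    ∫⁻ t in Ioi (0 : ℝ), (Iic b).indicator (fun t => ENNReal.ofReal (4 * t ^ (q - 3))) t =
      ENNReal.ofReal (4 * (b ^ (q - 2) / (q - 2))) := by
  rw [lintegral_indicator measurableSet_Iic, Measure.restrict_restrict measurableSet_Iic,
    inter_comm, Ioi_inter_Iic]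
  have := lintegral_Ioc_rpow (a := q - 3) (by linarith) hb
  simp only [ENNReal.ofReal_mul (show (0 : ℝ) ≤ 4 by norm_num)]
  rw [lintegral_const_mul' _ _ ENNReal.ofReal_ne_top, this]
  congr 2
  rw [show q - 3 + 1 = q - 2 by ring]

/-- The exponents match: `(n/q)(q - 2) = 2s`, which is compensated by `|J|² ≤ |ξ|^{-2s}`, with `s =
n(1/2 - 1/q)`. -/
lemma rpow_mul_norm_symJ_sq_le (hn : 1 ≤ n) {q K : ℝ} (hq : 2 < q)
    (hs1 : (n : ℝ) * (1 / 2 - 1 / q) ≤ 1) (hK0 : 0 < K) {ξ : Space n} (hξ : ξ ≠ 0) :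
    4 * ((2 * K * ‖ξ‖ ^ ((n : ℝ) / q)) ^ (q - 2) / (q - 2)) * ‖symJ ξ‖ ^ 2 ≤
      4 * ((2 * K) ^ (q - 2) / (q - 2)) := by
  have hn0 : (0 : ℝ) < n := by exact_mod_cast hn
  have hq0 : 0 < q := by linarith
  have hs0 : 0 ≤ (n : ℝ) * (1 / 2 - 1 / q) := by
    have : 1 / q ≤ 1 / 2 := one_div_le_one_div_of_le two_pos hq.le
    nlinarith
  have hpos : 0 < ‖ξ‖ := norm_pos_iff.2 hξ
  have h4 := pow_le_pow_left₀ (norm_nonneg _) (norm_symJ_le_rpow hs0 hs1 hξ) 2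
  set s := (n : ℝ) * (1 / 2 - 1 / q) with hs
  have h3 : (2 * K * ‖ξ‖ ^ ((n : ℝ) / q)) ^ (q - 2) = (2 * K) ^ (q - 2) * (‖ξ‖ ^ s) ^ 2 := by
    rw [Real.mul_rpow (by positivity) (by positivity), ← Real.rpow_mul hpos.le,
      ← Real.rpow_mul_natCast hpos.le]
    congr 2
    rw [hs]; push_cast; field_simp
  have h5 : (‖ξ‖ ^ s) ^ 2 * (‖ξ‖ ^ (-s)) ^ 2 = 1 := by
    rw [← mul_pow, ← Real.rpow_add hpos, add_neg_cancel, Real.rpow_zero, one_pow]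
  have h6 : 0 < q - 2 := by linarith
  rw [h3]
  calc _ ≤ 4 * ((2 * K) ^ (q - 2) * (‖ξ‖ ^ s) ^ 2 / (q - 2)) * (‖ξ‖ ^ (-s)) ^ 2 := by gcongr
    _ = 4 * ((2 * K) ^ (q - 2) / (q - 2)) * ((‖ξ‖ ^ s) ^ 2 * (‖ξ‖ ^ (-s)) ^ 2) := by ring
    _ = _ := by rw [h5, mul_one]

/-- The Sobolev embedding of `H¹` into `L^q` on the unit ball. -/
lemma sobolev_lintegral (hn : 1 ≤ n) {q : ℝ} (hq : 2 < q)
    (hs1 : (n : ℝ) * (1 / 2 - 1 / q) ≤ 1) :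
    ∃ C : ℝ, ∀ G : L2C n, ‖G‖ ≤ 1 →
      ∫⁻ x, ENNReal.ofReal (‖fmult symJ G x‖ ^ q) ≤ ENNReal.ofReal C := by
  have hn0 : (0 : ℝ) < n := by exact_mod_cast hn
  have hq0 : 0 < q := by linarith
  set s := (n : ℝ) * (1 / 2 - 1 / q) with hs
  have hs0 : 0 ≤ s := by
    have : 1 / q ≤ 1 / 2 := one_div_le_one_div_of_le two_pos hq.le
    rw [hs]; nlinarith
  -- The summand `1` serves only to make `K` positive.
  set K := Real.sqrt (∫ ξ in Metric.ball (0 : Space n) 1, (‖ξ‖ ^ (-s)) ^ 2) + 1 with hK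
  have hK0 : 0 < K := by positivity
  refine ⟨q * (4 * ((2 * K) ^ (q - 2) / (q - 2))), fun G hG => ?_⟩
  set h : L2C n := 𝓕 G with hh
  rw [lintegral_rpow_eq_lintegral_meas_lt_mul volume (Eventually.of_forall fun x => norm_nonneg _)
    (Lp.aestronglyMeasurable _).norm.aemeasurable hq0, ENNReal.ofReal_mul hq0.le]
  gcongr
  -- After the layer-cake formula, the bound on the distribution function turns the `L^q` integral
  -- into a double integral over level and frequency. Tonelli allows the level `t` to be integrated
  -- first, and `q > 2` makes `t^{q-3}` integrable at zero.
  set Ψ : ℝ → Space n → ℝ≥0∞ := fun t ξ =>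
    {p : ℝ × Space n | p.1 ≤ 2 * K * ‖p.2‖ ^ ((n : ℝ) / q)}.indicator
      (fun p => ENNReal.ofReal (4 * p.1 ^ (q - 3)) * ‖symJ p.2 * h p.2‖ₑ ^ 2) (t, ξ) with hΨ
  have hmeas : Measurable (Function.uncurry Ψ) := by
    have hJ := (isSymbol_symJ (n := n)).meas
    have hh' := (Lp.stronglyMeasurable h).measurable
    refine Measurable.indicator ?_ (measurableSet_le (by fun_prop) (by fun_prop))
    fun_prop
  have hstep : ∀ t ∈ Ioi (0 : ℝ), volume {x | t < ‖fmult symJ G x‖} * ENNReal.ofReal (t ^ (q - 1))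
      ≤ ∫⁻ ξ, Ψ t ξ := by
    intro t ht
    have ht0 : 0 < t := ht
    refine (mul_le_mul_left (measure_norm_gt_le hn hq hs1 hK0 (by rw [hK]; linarith) hG ht0) _).trans ?_
    rw [mul_right_comm, ← ENNReal.ofReal_mul (by positivity)]
    have h1 : 4 * (t ^ 2)⁻¹ * t ^ (q - 1) = 4 * t ^ (q - 3) := by
      rw [show q - 3 = (q - 1) - (2 : ℕ) by push_cast; ring, Real.rpow_sub_natCast ht0.ne']
      field_simp
    rw [h1, ← lintegral_const_mul']
    · refine lintegral_mono fun ξ => ?_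
      simp only [hΨ, indicator, mem_ofPred_eq]
      split_ifs
      · exact le_rfl
      · simp
    · exact ENNReal.ofReal_ne_top
  have hinner : ∀ ξ : Space n, ξ ≠ 0 → ∫⁻ t in Ioi (0 : ℝ), Ψ t ξ ≤
      ENNReal.ofReal (4 * ((2 * K) ^ (q - 2) / (q - 2))) * ‖h ξ‖ₑ ^ 2 := by
    intro ξ hξ
    set b := 2 * K * ‖ξ‖ ^ ((n : ℝ) / q) with hb
    have hb0 : 0 ≤ b := by positivity
    have h1 : ∀ t, Ψ t ξ = (Iic b).indicator (fun t => ENNReal.ofReal (4 * t ^ (q - 3))) t *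
        ‖symJ ξ * h ξ‖ₑ ^ 2 := by
      intro t
      simp only [hΨ, indicator, mem_ofPred_eq, mem_Iic, hb]
      split_ifs <;> simp
    simp only [h1]
    rw [lintegral_mul_const' _ _ (ENNReal.pow_ne_top enorm_ne_top),
      lintegral_Ioi_indicator_rpow hq hb0, enorm_mul, mul_pow, ← mul_assoc]
    gcongr
    rw [← ofReal_norm, ← ENNReal.ofReal_pow (norm_nonneg _),
      ← ENNReal.ofReal_mul' (by positivity)]
    exact ENNReal.ofReal_le_ofReal (rpow_mul_norm_symJ_sq_le hn hq hs1 hK0 hξ)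
  have hne : ∀ᵐ ξ ∂(volume : Measure (Space n)), ξ ≠ 0 := by
    have : Nontrivial (Space n) := by
      have : Nonempty (Fin n) := ⟨⟨0, hn⟩⟩
      infer_instance
    exact Measure.ae_ne volume 0
  calc _ ≤ ∫⁻ t in Ioi (0 : ℝ), ∫⁻ ξ, Ψ t ξ := setLIntegral_mono' measurableSet_Ioi hstep
    _ = ∫⁻ ξ, ∫⁻ t in Ioi (0 : ℝ), Ψ t ξ := lintegral_lintegral_swap hmeas.aemeasurable
    _ ≤ ∫⁻ ξ, ENNReal.ofReal (4 * ((2 * K) ^ (q - 2) / (q - 2))) * ‖h ξ‖ₑ ^ 2 := by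
        refine lintegral_mono_ae ?_
        filter_upwards [hne] with ξ hξ
        exact hinner ξ hξ
    _ = ENNReal.ofReal (4 * ((2 * K) ^ (q - 2) / (q - 2))) * ENNReal.ofReal (‖h‖ ^ 2) := by
        rw [lintegral_const_mul' _ _ ENNReal.ofReal_ne_top, lintegral_enorm_sq]
    _ ≤ ENNReal.ofReal (4 * ((2 * K) ^ (q - 2) / (q - 2))) * 1 := by
        gcongr
        rw [← ENNReal.ofReal_one]
        refine ENNReal.ofReal_le_ofReal ?_
        rw [hh, Lp.norm_fourier_eq]
        exact pow_le_one₀ (norm_nonneg _) hG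
    _ = _ := mul_one _

/-- The Sobolev embedding `H¹ ⊂ L^q`. -/
lemma sobolev_embedding (hn : 1 ≤ n) {q : ℝ} (hq : 2 < q)
    (hs1 : (n : ℝ) * (1 / 2 - 1 / q) ≤ 1) :
    ∃ C : ℝ, 0 ≤ C ∧ ∀ g : L2 n,
      eLpNorm (op symJ g) (ENNReal.ofReal q) volume ≤ ENNReal.ofReal (C * ‖g‖) := by
  obtain ⟨C, hC⟩ := sobolev_lintegral hn hq hs1
  have hq0 : 0 < q := by linarith
  have hne0 : ENNReal.ofReal q ≠ 0 := by simpa using hq0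
  have hunit : ∀ g : L2 n, ‖g‖ ≤ 1 →
      eLpNorm (op symJ g) (ENNReal.ofReal q) volume ≤ ENNReal.ofReal ((max C 0) ^ (1 / q)) := by
    intro g hg
    rw [eLpNorm_eq_lintegral_rpow_enorm_toReal hne0 ENNReal.ofReal_ne_top,
      ENNReal.toReal_ofReal hq0.le, ← ENNReal.ofReal_rpow_of_nonneg (le_max_right _ _) (by positivity)]
    refine ENNReal.rpow_le_rpow ?_ (by positivity)
    refine le_trans ?_ ((hC (toComplex g) (by rwa [norm_toComplex])).trans
      (ENNReal.ofReal_le_ofReal (le_max_left C 0)))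
    refine lintegral_mono_ae ?_
    rw [← toComplex_op isSymbol_symJ]
    filter_upwards [coeFn_toComplex (op symJ g)] with x e
    rw [e, Complex.norm_real, ← ENNReal.ofReal_rpow_of_nonneg (norm_nonneg _) hq0.le, ofReal_norm]
  refine ⟨(max C 0) ^ (1 / q), by positivity, fun g => ?_⟩
  rcases eq_or_ne g 0 with rfl | hg
  · rw [map_zero, eLpNorm_congr_ae (Lp.coeFn_zero _ _ _)]
    simp
  have hg0 : ‖g‖ ≠ 0 := norm_ne_zero_iff.2 hg
  have h1 := hunit (‖g‖⁻¹ • g) (by rw [norm_smul, norm_inv, norm_norm, inv_mul_cancel₀ hg0])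
  have h2 : op symJ g =ᵐ[volume] ‖g‖ • (op symJ (‖g‖⁻¹ • g) : Space n → ℝ) := by
    have h3 : op symJ g = ‖g‖ • op symJ (‖g‖⁻¹ • g) := by
      rw [← map_smul, smul_smul, mul_inv_cancel₀ hg0, one_smul]
    conv_lhs => rw [h3]
    exact Lp.coeFn_smul _ _
  rw [eLpNorm_congr_ae h2, eLpNorm_const_smul, mul_comm _ ‖g‖, ENNReal.ofReal_mul (norm_nonneg _),
    enorm_norm, ofReal_norm]
  gcongr

end DampedWave
end

/-! ### The nonlinearity, and local and maximal mild solutions. -/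

noncomputable section

namespace DampedWave

open Filter Topology Set
open scoped ENNReal

variable {n : ℕ}

/-- Convexity of the power: its graph lies above the tangent at `x`, which is Bernoulli's inequality
with increment `y/x - 1`. -/
lemma rpow_sub_rpow_le {p x y : ℝ} (hp : 1 ≤ p) (hx : 0 ≤ x) (hy : 0 ≤ y) :
    x ^ p - y ^ p ≤ p * x ^ (p - 1) * (x - y) := by
  rcases hx.eq_or_lt with rfl | hx
  · rcases hp.eq_or_lt with rfl | hp
    · simp
    · rw [Real.zero_rpow (by linarith), Real.zero_rpow (by linarith)]
      simp [Real.rpow_nonneg hy]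
  · have h := one_add_mul_self_le_rpow_one_add (s := y / x - 1)
      (by have : 0 ≤ y / x := by positivity
          linarith) hp
    rw [add_sub_cancel, Real.div_rpow hy hx.le, le_div_iff₀ (by positivity)] at h
    have h2 : x ^ p = x ^ (p - 1) * x := by
      rw [← Real.rpow_add_one hx.ne', sub_add_cancel]
    have h3 : (1 + p * (y / x - 1)) * x ^ p = x ^ p + p * x ^ (p - 1) * (y - x) := by
      rw [add_mul, one_mul, add_right_inj, h2]
      field_simp
    rw [h3] at h
    linarith

lemma abs_rpow_abs_sub_le {p : ℝ} (hp : 1 ≤ p) (a b : ℝ) :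
    ‖|a| ^ p - |b| ^ p‖ ≤ p * (‖a‖ ^ (p - 1) * ‖a - b‖) + p * (‖b‖ ^ (p - 1) * ‖a - b‖) := by
  simp only [Real.norm_eq_abs]
  have h1 := rpow_sub_rpow_le hp (abs_nonneg a) (abs_nonneg b)
  have h2 := rpow_sub_rpow_le hp (abs_nonneg b) (abs_nonneg a)
  have h3 : |a| - |b| ≤ |a - b| := abs_sub_abs_le_abs_sub a b
  have h4 : |b| - |a| ≤ |a - b| := by rw [abs_sub_comm]; exact abs_sub_abs_le_abs_sub b a
  have ha : 0 ≤ p * |a| ^ (p - 1) := by positivity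
  have hb : 0 ≤ p * |b| ^ (p - 1) := by positivity
  have hab := abs_nonneg (a - b)
  rw [abs_le]
  constructor <;>
    nlinarith [mul_le_mul_of_nonneg_left h3 ha, mul_le_mul_of_nonneg_left h4 hb,
      mul_nonneg ha hab, mul_nonneg hb hab]

/-- The relation `(p-1)/(2p) + 1/(2p) = 1/2` behind estimating `|a|^{p-1} |d|` in `L²` by `L^{2p}`
norms. -/
lemma holderTriple_rpow {p : ℝ} (hp : 1 < p) :
    ENNReal.HolderTriple (ENNReal.ofReal (2 * p / (p - 1))) (ENNReal.ofReal (2 * p)) 2 := by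
  have h1 : 0 < p - 1 := by linarith
  have h : Real.HolderTriple (2 * p / (p - 1)) (2 * p) 2 :=
    ⟨by field_simp; ring, by positivity, by positivity⟩
  simpa using h.ennrealOfReal

lemma eLpNorm_rpow_mul_le {p : ℝ} (hp : 1 < p) {a d : Space n → ℝ}
    (ha : AEStronglyMeasurable a volume) (hd : AEStronglyMeasurable d volume) :
    eLpNorm (fun x => ‖a x‖ ^ (p - 1) * ‖d x‖) 2 volume ≤
      eLpNorm a (ENNReal.ofReal (2 * p)) volume ^ (p - 1) *
        eLpNorm d (ENNReal.ofReal (2 * p)) volume := by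
  have := holderTriple_rpow hp
  have h1 : 0 < p - 1 := by linarith
  have h := eLpNorm_smul_le_mul_eLpNorm (p := ENNReal.ofReal (2 * p / (p - 1)))
    (q := ENNReal.ofReal (2 * p)) (r := 2) hd.norm
    (ha.norm.aemeasurable.pow_const (p - 1)).aestronglyMeasurable
  rw [eLpNorm_norm_rpow a h1, eLpNorm_norm, ← ENNReal.ofReal_mul (by positivity),
    div_mul_cancel₀ _ h1.ne'] at h
  exact h

lemma eLpNorm_abs_rpow_sub_le {p : ℝ} (hp : 1 < p) {a b : Space n → ℝ}
    (ha : AEStronglyMeasurable a volume) (hb : AEStronglyMeasurable b volume) :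
    eLpNorm (fun x => |a x| ^ p - |b x| ^ p) 2 volume ≤
      ENNReal.ofReal p * (eLpNorm a (ENNReal.ofReal (2 * p)) volume ^ (p - 1) *
        eLpNorm (fun x => a x - b x) (ENNReal.ofReal (2 * p)) volume) +
      ENNReal.ofReal p * (eLpNorm b (ENNReal.ofReal (2 * p)) volume ^ (p - 1) *
        eLpNorm (fun x => a x - b x) (ENNReal.ofReal (2 * p)) volume) := by
  have hp0 : 0 ≤ p := by linarith
  set Fa : Space n → ℝ := fun x => ‖a x‖ ^ (p - 1) * ‖a x - b x‖
  set Fb : Space n → ℝ := fun x => ‖b x‖ ^ (p - 1) * ‖a x - b x‖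
  have hFa : AEStronglyMeasurable Fa volume :=
    (ha.norm.aemeasurable.pow_const (p - 1)).aestronglyMeasurable.mul (ha.sub hb).norm
  have hFb : AEStronglyMeasurable Fb volume :=
    (hb.norm.aemeasurable.pow_const (p - 1)).aestronglyMeasurable.mul (ha.sub hb).norm
  calc _ ≤ eLpNorm (p • Fa + p • Fb) 2 volume := by
        refine eLpNorm_mono_real fun x => ?_
        exact abs_rpow_abs_sub_le hp.le (a x) (b x)
    _ ≤ eLpNorm (p • Fa) 2 volume + eLpNorm (p • Fb) 2 volume :=
        eLpNorm_add_le (hFa.const_smul p) (hFb.const_smul p) one_le_two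
    _ ≤ _ := by
        rw [eLpNorm_const_smul, eLpNorm_const_smul, Real.enorm_eq_ofReal hp0]
        gcongr
        · exact eLpNorm_rpow_mul_le hp ha (ha.sub hb)
        · exact eLpNorm_rpow_mul_le hp hb (ha.sub hb)

/-- The exponents for which `|·|^p` maps `H¹` to `L²`. -/
def IsAdmissible (n : ℕ) (p : ℝ) : Prop :=
  1 ≤ n ∧ 1 < p ∧ (n : ℝ) * (1 / 2 - 1 / (2 * p)) ≤ 1

/-- The Sobolev condition amounts to `n(p - 1) ≤ 2p`, which is automatic for `n ≤ 2` and equivalent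
to `p ≤ n/(n-2)` for `n ≥ 3`. -/
lemma isAdmissible_of_le {p : ℝ} (hn : 1 ≤ n) (hp1 : 1 < p)
    (hp : 3 ≤ n → p ≤ (n : ℝ) / ((n : ℝ) - 2)) : IsAdmissible n p := by
  refine ⟨hn, hp1, ?_⟩
  have hp0 : 0 < p := by linarith
  have key : (n : ℝ) * (p - 1) ≤ 2 * p := by
    rcases lt_or_ge n 3 with h | h
    · have : (n : ℝ) ≤ 2 := by exact_mod_cast (by omega : n ≤ 2)
      nlinarith
    · have h3 : (3 : ℝ) ≤ n := by exact_mod_cast h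
      have := hp h
      rw [le_div_iff₀ (by linarith)] at this
      linarith
  have : (n : ℝ) * (1 / 2 - 1 / (2 * p)) = n * (p - 1) / (2 * p) := by field_simp
  rw [this, div_le_one (by positivity)]
  exact key

lemma memLp_two_abs_rpow {p : ℝ} (hp : 0 < p) {f : Space n → ℝ}
    (hf : AEStronglyMeasurable f volume)
    (h : eLpNorm f (ENNReal.ofReal (2 * p)) volume ≠ ⊤) :
    MemLp (fun x : Space n => |f x| ^ p) 2 volume := by
  refine ⟨(hf.norm.aemeasurable.pow_const p).aestronglyMeasurable, ?_⟩
  have h1 := eLpNorm_norm_rpow (μ := (volume : Measure (Space n))) (p := 2) f hp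
  have h2 : (2 : ℝ≥0∞) * ENNReal.ofReal p = ENNReal.ofReal (2 * p) := by
    rw [ENNReal.ofReal_mul two_pos.le, ENNReal.ofReal_ofNat]
  rw [h2] at h1
  exact h1.trans_lt (ENNReal.rpow_lt_top_of_nonneg hp.le h)

lemma memLp_abs_rpow {p : ℝ} (h : IsAdmissible n p) (g : L2 n) :
    MemLp (fun x : Space n => |op symJ g x| ^ p) 2 volume := by
  obtain ⟨C, -, hC⟩ := sobolev_embedding h.1 (q := 2 * p) (by linarith [h.2.1]) h.2.2
  exact memLp_two_abs_rpow (by linarith [h.2.1]) (Lp.aestronglyMeasurable _)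
    (ne_top_of_le_ne_top ENNReal.ofReal_ne_top (hC g))

lemma coeFn_absPow {p : ℝ} {f : L2 n} (hf : MemLp (fun x : Space n => |f x| ^ p) 2 volume) :
    absPow p f =ᵐ[volume] fun x => |f x| ^ p := by
  rw [absPow, dif_pos hf]; exact hf.coeFn_toLp

/-- The nonlinearity in terms of `(1 + |D|²)^{1/2} u`. -/
def nonlin (p : ℝ) (g : L2 n) : L2 n := absPow p (op symJ g)

/-- The pointwise difference of the powers is estimated by Hölder in `L^{2p}`, and each `L^{2p}`
norm by Sobolev. The difference enters linearly since the lift is linear. -/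
lemma lipschitzOnBounded_nonlin {p : ℝ} (h : IsAdmissible n p) :
    LipschitzOnBounded (nonlin p : L2 n → L2 n) := by
  obtain ⟨C, hC0, hC⟩ := sobolev_embedding h.1 (q := 2 * p) (by linarith [h.2.1]) h.2.2
  have hp0 : 0 < p := by linarith [h.2.1]
  have hp1 : 0 < p - 1 := by linarith [h.2.1]
  intro M
  set M' := max M 0 with hM'
  have hM0 : 0 ≤ M' := le_max_right _ _
  refine ⟨2 * p * ((C * M') ^ (p - 1) * C), by positivity, fun f g hf hg => ?_⟩
  have hbd : ∀ f : L2 n, ‖f‖ ≤ M → eLpNorm (op symJ f) (ENNReal.ofReal (2 * p)) volume ^ (p - 1) ≤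
      ENNReal.ofReal ((C * M') ^ (p - 1)) := by
    intro f hf
    rw [← ENNReal.ofReal_rpow_of_nonneg (by positivity) hp1.le]
    refine ENNReal.rpow_le_rpow ((hC f).trans (ENNReal.ofReal_le_ofReal ?_)) hp1.le
    exact mul_le_mul_of_nonneg_left (hf.trans (le_max_left _ _)) hC0
  have hd : eLpNorm (fun x => op symJ f x - op symJ g x) (ENNReal.ofReal (2 * p)) volume ≤
      ENNReal.ofReal (C * ‖f - g‖) := by
    refine le_trans (le_of_eq ?_) (hC (f - g))
    rw [map_sub]
    exact eLpNorm_congr_ae (Lp.coeFn_sub _ _).symm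
  rw [Lp.norm_def]
  refine ENNReal.toReal_le_of_le_ofReal (by positivity) ?_
  have hae : (nonlin p f - nonlin p g : L2 n) =ᵐ[volume]
      fun x => |op symJ f x| ^ p - |op symJ g x| ^ p := by
    filter_upwards [Lp.coeFn_sub (nonlin p f) (nonlin p g), coeFn_absPow (memLp_abs_rpow h f),
      coeFn_absPow (memLp_abs_rpow h g)] with x e1 e2 e3
    rw [e1, Pi.sub_apply, nonlin, nonlin, e2, e3]
  rw [eLpNorm_congr_ae hae]
  refine (eLpNorm_abs_rpow_sub_le h.2.1 (Lp.aestronglyMeasurable _)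
    (Lp.aestronglyMeasurable _)).trans ?_
  calc _ ≤ ENNReal.ofReal p * (ENNReal.ofReal ((C * M') ^ (p - 1)) * ENNReal.ofReal (C * ‖f - g‖)) +
        ENNReal.ofReal p * (ENNReal.ofReal ((C * M') ^ (p - 1)) * ENNReal.ofReal (C * ‖f - g‖)) := by
        gcongr
        · exact hbd f hf
        · exact hbd g hg
    _ = _ := by
        rw [← ENNReal.ofReal_mul (by positivity), ← ENNReal.ofReal_mul (by positivity),
          ← ENNReal.ofReal_add (by positivity) (by positivity)]
        congr 1; ring

section MildSolution

variable {γ p : ℝ} {u₀ u₁ : L2 n}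

/-- The solution of the linear problem, as a real function. -/
def linearPart (u₀ u₁ : L2 n) (t : ℝ) : L2 n :=
  op (symK0 t) u₀ + op (symK1 t) ((1 / 2 : ℝ) • u₀ + u₁)

lemma toComplex_linearPart (u₀ u₁ : L2 n) (t : ℝ) :
    toComplex (linearPart u₀ u₁ t) = linearSolution u₀ u₁ t := by
  rw [linearPart, toComplex_add, linearSolution, opK0_toComplex, opK1_toComplex]

/-- The memory term `∫₀ᵗ (t - s)^{-γ} |u(s)|^p ds`. -/
def memoryTerm (γ p : ℝ) (u : ℝ → L2 n) : ℝ → L2 n :=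
  fracIntegral ((1 - γ) - 1) fun s => absPow p (u s)

lemma toComplex_smul (c : ℝ) (f : L2 n) : toComplex (c • f) = c • toComplex f :=
  (toComplexL n).map_smul c f

/-- Exposes the factor `Γ(1 - γ)⁻¹`, which cancels against the one in front of the Duhamel integral
and leaves the plain memory term. -/
lemma opK1_riemannLiouville (s τ : ℝ) (u : ℝ → L2 n) :
    opK1 s (toComplex (riemannLiouville (1 - γ) (fun s => absPow p (u s)) τ)) =
      (Real.Gamma (1 - γ))⁻¹ • toComplex (op (symK1 s) (memoryTerm γ p u τ)) := by
  rw [opK1_toComplex, riemannLiouville, map_smul, toComplex_smul]; rfl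

lemma duhamel_toComplex (hγ : γ < 1) {u : ℝ → L2 n} {t : ℝ}
    (hi : IntervalIntegrable (fun τ => op (symK1 (t - τ)) (memoryTerm γ p u τ)) volume 0 t) :
    (Real.Gamma (1 - γ)) • ∫ τ in (0 : ℝ)..t, opK1 (t - τ)
        (toComplex (riemannLiouville (1 - γ) (fun s => absPow p (u s)) τ)) =
      toComplex (duhamel (fun t => op (symK1 t)) (memoryTerm γ p u) t) := by
  have hΓ : Real.Gamma (1 - γ) ≠ 0 := (Real.Gamma_pos_of_pos (by linarith)).ne'
  simp only [opK1_riemannLiouville]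
  rw [intervalIntegral.integral_smul, smul_smul, mul_inv_cancel₀ hΓ, one_smul]
  exact (toComplexL n).intervalIntegral_comp_comm hi

lemma continuousOn_memoryTerm (hγ : γ < 1) (h : IsAdmissible n p) {g : ℝ → L2 n} {T : ℝ}
    (hg : ContinuousOn g (Icc 0 T)) {u : ℝ → L2 n} (hu : ∀ t ∈ Icc 0 T, u t = op symJ (g t)) :
    ContinuousOn (memoryTerm γ p u) (Icc 0 T) := by
  refine continuousOn_fracIntegral (by linarith) ?_
  refine ((lipschitzOnBounded_nonlin h).continuous.comp_continuousOn hg).congr fun t ht => ?_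
  rw [hu t ht]; rfl

lemma IsMildSolution.memory_form (hγ : γ < 1) (h : IsAdmissible n p) {T : EReal} {u : ℝ → L2 n}
    (hu : IsMildSolution γ p u₀ u₁ T u) : ∃ g : ℝ → L2 n, ContinuousOn g (timeInterval T) ∧
      (∀ t ∈ timeInterval T, u t = op symJ (g t)) ∧
      ∀ t ∈ timeInterval T, u t = linearPart u₀ u₁ t +
        duhamel (fun t => op (symK1 t)) (memoryTerm γ p u) t := by
  obtain ⟨g, hg, hgu⟩ := (continuousOnH1_iff u _).1 hu.continuousOn_H1
  refine ⟨g, hg, hgu, fun t ht => ?_⟩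
  have hsub : Icc 0 t ⊆ timeInterval T := fun s hs =>
    ⟨hs.1, (EReal.coe_le_coe_iff.2 hs.2).trans_lt ht.2⟩
  apply toComplex_injective
  rw [hu.integral_equation t ht, toComplex_add, toComplex_linearPart, duhamel_toComplex hγ]
  exact isStrongFamily_K1.intervalIntegrable ⟨ht.1, le_rfl⟩
    (continuousOn_memoryTerm hγ h (hg.mono hsub) fun s hs => hgu s (hsub hs))

/-- Pulls the smoothing operator out of the integral, so that the equation in `H¹` becomes one in
`L²` with a bounded kernel. -/
lemma duhamel_K1_eq {F : ℝ → L2 n} {T t : ℝ} (ht : t ∈ Icc 0 T) (hF : ContinuousOn F (Icc 0 T)) :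
    duhamel (fun t => op (symK1 t)) F t = op symJ (duhamel (fun t => op (symK1Lift t)) F t) := by
  rw [duhamel, duhamel, ← ContinuousLinearMap.intervalIntegral_comp_comm _
    (isStrongFamily_K1Lift.intervalIntegrable ht hF)]
  simp only [op_symK1_eq]

/-- Two mild solutions with the same data agree on their common interval of existence. -/
theorem IsMildSolution.eq_of_mem (hγ : γ < 1) (h : IsAdmissible n p) {T₁ T₂ : EReal}
    {u v : ℝ → L2 n} (hu : IsMildSolution γ p u₀ u₁ T₁ u) (hv : IsMildSolution γ p u₀ u₁ T₂ v)
    {t : ℝ} (ht₁ : t ∈ timeInterval T₁) (ht₂ : t ∈ timeInterval T₂) : u t = v t := by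
  obtain ⟨g₁, hg₁, hgu, hu'⟩ := hu.memory_form hγ h
  obtain ⟨g₂, hg₂, hgv, hv'⟩ := hv.memory_form hγ h
  have hsub₁ : Icc 0 t ⊆ timeInterval T₁ := fun s hs =>
    ⟨hs.1, (EReal.coe_le_coe_iff.2 hs.2).trans_lt ht₁.2⟩
  have hsub₂ : Icc 0 t ⊆ timeInterval T₂ := fun s hs =>
    ⟨hs.1, (EReal.coe_le_coe_iff.2 hs.2).trans_lt ht₂.2⟩
  have hFu := continuousOn_memoryTerm hγ h (hg₁.mono hsub₁) fun s hs => hgu s (hsub₁ hs)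
  have hFv := continuousOn_memoryTerm hγ h (hg₂.mono hsub₂) fun s hs => hgv s (hsub₂ hs)
  have hN : ∀ {w g : ℝ → L2 n}, (∀ s ∈ Icc 0 t, w s = op symJ (g s)) → ∀ s ∈ Icc 0 t,
      memoryTerm γ p w s = fracIntegral ((1 - γ) - 1) (fun s => nonlin p (g s)) s := by
    intro w g hwg s hs
    refine fracIntegral_congr hs.1 fun r hr => ?_
    rw [hwg r ⟨hr.1, hr.2.trans hs.2⟩]; rfl
  have key := volterra_unique (T := t) isStrongFamily_K1Lift (lipschitzOnBounded_nonlin h)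
    (β := (1 - γ) - 1) (by linarith) (hg₁.mono hsub₁) (hg₂.mono hsub₂) (fun s hs => by
      -- The equations for `u` and `v` are the lifted equations after smoothing; injectivity removes
      -- it.
      apply opJ_injective
      have hs' : Icc 0 s ⊆ Icc 0 t := Icc_subset_Icc_right hs.2
      rw [map_sub, map_sub, ← hgu s (hsub₁ hs), ← hgv s (hsub₂ hs), hu' s (hsub₁ hs),
        hv' s (hsub₂ hs), add_sub_add_left_eq_sub, duhamel_K1_eq hs hFu, duhamel_K1_eq hs hFv,
        duhamel_congr hs.1 fun r hr => hN (fun r hr => hgu r (hsub₁ hr)) r (hs' hr),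
        duhamel_congr hs.1 fun r hr => hN (fun r hr => hgv r (hsub₂ hr)) r (hs' hr)])
  rw [hgu t ht₁, hgv t ht₂, key (right_mem_Icc.2 ht₁.1)]

/-- Local existence of mild solutions. -/
theorem exists_isMildSolution (hγ : γ < 1) (h : IsAdmissible n p) (hu₀ : MemH1 u₀) :
    ∃ (T : EReal) (u : ℝ → L2 n), IsMildSolution γ p u₀ u₁ T u := by
  obtain ⟨g₀, hg₀⟩ := (memH1_iff u₀).1 hu₀
  set v := (1 / 2 : ℝ) • u₀ + u₁ with hv
  -- The linear part with the smoothing operator removed, where `u₀` is replaced by its lift `g₀`.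
  have hw : Continuous fun t => op (symK0 t) g₀ + op (symK1Lift t) v :=
    (isStrongFamily_K0.continuous_apply g₀).add (isStrongFamily_K1Lift.continuous_apply v)
  obtain ⟨T, hT, g, hg, hgeq⟩ := volterra_exists isStrongFamily_K1Lift
    (lipschitzOnBounded_nonlin h) (β := (1 - γ) - 1) (by linarith) hw
  set u : ℝ → L2 n := fun t => op symJ (g t) with hu
  have hsub : timeInterval (T : EReal) ⊆ Icc 0 T := fun t ht =>
    ⟨ht.1, (EReal.coe_lt_coe_iff.1 ht.2).le⟩
  have hF : ContinuousOn (memoryTerm γ p u) (Icc 0 T) :=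
    continuousOn_memoryTerm hγ h hg.continuousOn fun _ _ => rfl
  have hlin : ∀ t, op symJ (op (symK0 t) g₀ + op (symK1Lift t) v) = linearPart u₀ u₁ t := by
    intro t
    rw [map_add, ← op_symK0_comm, ← op_symK1_eq, ← hg₀]; rfl
  have heq : ∀ t ∈ Icc 0 T, u t = linearPart u₀ u₁ t +
      duhamel (fun t => op (symK1 t)) (memoryTerm γ p u) t := by
    intro t ht
    rw [duhamel_K1_eq ht hF, ← hlin, ← map_add]
    exact congrArg (op symJ) (hgeq t ht)
  refine ⟨T, u, ?_, ?_, ?_, ?_, ?_, ?_, ?_⟩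
  · exact_mod_cast hT
  · exact (continuousOnH1_iff u _).2 ⟨g, hg.continuousOn, fun _ _ => rfl⟩
  · have hFc := continuous_clamp hT.le hF
    set V : ℝ → L2 n := duhamel (fun t => op (symK1Deriv t)) (clamp T (memoryTerm γ p u)) with hV
    have hVc : Continuous V := isStrongFamily_K1Deriv.continuous_duhamel hFc
    -- Differentiability of `K₀(t) u₀` in `L²` uses `u₀ ∈ H¹`; the Duhamel term is the primitive of
    -- `V`, built from the clamped source so as to be continuous on the whole line.
    have hd : ∀ t, HasDerivAt (fun t => op (symK0 t) u₀ + op (symK1 t) v + ∫ s in (0 : ℝ)..t, V s)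
        (op (symK0JDeriv t) g₀ + op (symK1Deriv t) v + V t) t := by
      intro t
      refine ((?_ : HasDerivAt _ _ _).add (hasDerivAt_opK1 v t)).add
        (hVc.integral_hasStrictDerivAt 0 t).hasDerivAt
      rw [hg₀]; exact hasDerivAt_opK0 g₀ t
    have hC1 : ContDiff ℝ 1 fun t => op (symK0 t) u₀ + op (symK1 t) v +
        ∫ s in (0 : ℝ)..t, V s := by
      rw [contDiff_one_iff_deriv]
      refine ⟨fun t => (hd t).differentiableAt, ?_⟩
      rw [show deriv _ = fun t => op (symK0JDeriv t) g₀ + op (symK1Deriv t) v + V t from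
        funext fun t => (hd t).deriv]
      exact ((isStrongFamily_K0JDeriv.continuous_apply g₀).add
        (isStrongFamily_K1Deriv.continuous_apply v)).add hVc
    refine hC1.contDiffOn.congr fun t ht => ?_
    rw [heq t (hsub ht), linearPart, ← hv, ← duhamel_eq_integral isStrongFamily_K1Deriv
      hasDerivAt_opK1 op_symK1_zero hFc ht.1]
    congr 1
    refine duhamel_congr ht.1 fun s hs => (clamp_eq ⟨hs.1, hs.2.trans (hsub ht).2⟩).symm
  · exact fun t _ => memLp_abs_rpow h (g t)
  · intro t _
    exact intervalIntegrable_fracIntegrand (by linarith) t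
      ((lipschitzOnBounded_nonlin h).continuous.comp hg).continuousOn
  · intro t ht
    simp only [opK1_riemannLiouville]
    have hi := isStrongFamily_K1.intervalIntegrable (hsub ht) hF
    have hi' : IntervalIntegrable (fun τ => toComplexL n
        (op (symK1 (t - τ)) (memoryTerm γ p u τ))) volume 0 t :=
      ⟨(toComplexL n).integrable_comp hi.1, (toComplexL n).integrable_comp hi.2⟩
    exact ⟨hi'.1.smul (Real.Gamma (1 - γ))⁻¹, hi'.2.smul (Real.Gamma (1 - γ))⁻¹⟩
  · intro t ht
    rw [duhamel_toComplex hγ (isStrongFamily_K1.intervalIntegrable (hsub ht) hF),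
      heq t (hsub ht), toComplex_add, toComplex_linearPart]

lemma timeInterval_mono {T T' : EReal} (h : T' ≤ T) : timeInterval T' ⊆ timeInterval T :=
  fun _ ht => ⟨ht.1, ht.2.trans_le h⟩

/-- A shorter half-open interval is relatively open in a longer one, so continuity and
differentiability can be checked on the shorter one. -/
lemma timeInterval_mem_nhdsWithin {T T' : EReal} {t : ℝ} (ht : t ∈ timeInterval T') :
    timeInterval T' ∈ 𝓝[timeInterval T] t := by
  have h1 : {s : ℝ | (s : EReal) < T'} ∈ 𝓝 t :=
    (isOpen_Iio.preimage continuous_coe_real_ereal).mem_nhds ht.2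
  filter_upwards [mem_nhdsWithin_of_mem_nhds h1, self_mem_nhdsWithin] with s hs hs'
  exact ⟨hs'.1, hs⟩

/-- Every condition at time `t` involves the function on `[0, t]` or through a local property within
the interval. -/
lemma IsMildSolution.congr {T : EReal} {u v : ℝ → L2 n} (hv : IsMildSolution γ p u₀ u₁ T v)
    (huv : EqOn u v (timeInterval T)) : IsMildSolution γ p u₀ u₁ T u := by
  have hsub : ∀ {t}, t ∈ timeInterval T → Icc 0 t ⊆ timeInterval T := fun ht s hs =>
    ⟨hs.1, (EReal.coe_le_coe_iff.2 hs.2).trans_lt ht.2⟩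
  have hRL : ∀ t ∈ timeInterval T, riemannLiouville (1 - γ) (fun s => absPow p (u s)) t =
      riemannLiouville (1 - γ) (fun s => absPow p (v s)) t := by
    intro t ht
    unfold riemannLiouville
    congr 1
    refine intervalIntegral.integral_congr fun s hs => ?_
    rw [uIcc_of_le ht.1] at hs
    simp only [huv (hsub ht hs)]
  have hs' : ∀ {t s}, t ∈ timeInterval T → s ∈ uIoc 0 t → s ∈ timeInterval T := by
    intro t s ht hs
    rw [uIoc_of_le ht.1] at hs
    exact hsub ht ⟨hs.1.le, hs.2⟩
  refine ⟨hv.pos, ?_, hv.contDiffOn_L2.congr huv, ?_, ?_, ?_, ?_⟩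
  · obtain ⟨G, hG, h⟩ := hv.continuousOn_H1
    exact ⟨G, hG, fun t ht => by rw [huv ht]; exact h t ht⟩
  · intro t ht; rw [huv ht]; exact hv.memLp_absPow t ht
  · intro t ht
    refine (hv.integrable_memory t ht).congr fun s hs => ?_
    simp only [huv (hs' ht hs)]
  · intro t ht
    refine (hv.integrable_duhamel t ht).congr fun s hs => ?_
    simp only [hRL s (hs' ht hs)]
  · intro t ht
    rw [huv ht, hv.integral_equation t ht]
    congr 2
    refine intervalIntegral.integral_congr fun s hs => ?_
    rw [uIcc_of_le ht.1] at hs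
    simp only [hRL s (hsub ht hs)]

/-- Existence of the maximal mild solution. -/
theorem exists_isMaximalMildSolution (hγ : γ < 1) (h : IsAdmissible n p) (hu₀ : MemH1 u₀) :
    ∃ (T : EReal) (u : ℝ → L2 n), IsMaximalMildSolution γ p u₀ u₁ T u := by
  classical
  set S : Set EReal := {T | ∃ v : ℝ → L2 n, IsMildSolution γ p u₀ u₁ T v} with hS
  -- At each time some mild solution alive there is chosen; by uniqueness the value does not depend
  -- on the choice.
  set u : ℝ → L2 n := fun t =>
    if ht : ∃ (T : EReal) (v : ℝ → L2 n), IsMildSolution γ p u₀ u₁ T v ∧ t ∈ timeInterval T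
    then ht.choose_spec.choose t else 0 with hu
  have huv : ∀ {T : EReal} {v : ℝ → L2 n}, IsMildSolution γ p u₀ u₁ T v →
      EqOn u v (timeInterval T) := by
    intro T v hv t ht
    have hex : ∃ (T : EReal) (v : ℝ → L2 n), IsMildSolution γ p u₀ u₁ T v ∧ t ∈ timeInterval T :=
      ⟨T, v, hv, ht⟩
    simp only [hu, dif_pos hex]
    obtain ⟨h1, h2⟩ := hex.choose_spec.choose_spec
    exact h1.eq_of_mem hγ h hv h2 ht
  have hmild : ∀ T ∈ S, IsMildSolution γ p u₀ u₁ T u := fun T ⟨v, hv⟩ => hv.congr (huv hv)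
  have hcover : ∀ t ∈ timeInterval (sSup S), ∃ T ∈ S, t ∈ timeInterval T := by
    intro t ht
    obtain ⟨T, hTS, hT⟩ := lt_sSup_iff.1 ht.2
    exact ⟨T, hTS, ht.1, hT⟩
  refine ⟨sSup S, u, ⟨?_, ?_, ?_, ?_, ?_, ?_, ?_⟩, fun T v hv => ⟨le_sSup ⟨v, hv⟩, (huv hv).symm⟩⟩
  · obtain ⟨T, v, hv⟩ := exists_isMildSolution (u₁ := u₁) hγ h hu₀
    exact hv.pos.trans_le (le_sSup ⟨v, hv⟩)
  · rw [continuousOnH1_iff]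
    have hg : ∀ t ∈ timeInterval (sSup S), ∃ g : L2 n, u t = op symJ g := by
      intro t ht
      obtain ⟨T, hTS, hT⟩ := hcover t ht
      obtain ⟨g, -, hg⟩ := (continuousOnH1_iff u _).1 (hmild T hTS).continuousOn_H1
      exact ⟨g t, hg t hT⟩
    -- The lifts are chosen pointwise, but injectivity forces them to agree with the continuous lift
    -- on each shorter interval.
    choose! g hg using hg
    refine ⟨g, fun t ht => ?_, hg⟩
    obtain ⟨T, hTS, hT⟩ := hcover t ht
    obtain ⟨g', hg'c, hg'⟩ := (continuousOnH1_iff u _).1 (hmild T hTS).continuousOn_H1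
    have heq : EqOn g g' (timeInterval T) := fun s hs => opJ_injective (by
      rw [← hg s (timeInterval_mono (le_sSup hTS) hs), hg' s hs])
    exact ((hg'c.congr heq) t hT).mono_of_mem_nhdsWithin (timeInterval_mem_nhdsWithin hT)
  · intro t ht
    obtain ⟨T, hTS, hT⟩ := hcover t ht
    exact ((hmild T hTS).contDiffOn_L2 t hT).mono_of_mem_nhdsWithin
      (timeInterval_mem_nhdsWithin hT)
  all_goals
    intro t ht
    obtain ⟨T, hTS, hT⟩ := hcover t ht
  · exact (hmild T hTS).memLp_absPow t hT
  · exact (hmild T hTS).integrable_memory t hT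
  · exact (hmild T hTS).integrable_duhamel t hT
  · exact (hmild T hTS).integral_equation t hT

end MildSolution

end DampedWave
end

/-! ### The weak form of the equation against product test functions. -/

noncomputable section

namespace DampedWave

open Filter Topology Set
open scoped ENNReal

variable {n : ℕ}

/-- `Φ ∈ H²(ℝⁿ)` with `ΔΦ = L`, in the form `Φ = (1 + |D|²)⁻¹ (Φ - (2π)⁻² L)`. -/
def HasLaplacian (Φ L : L2 n) : Prop :=
  Φ = op symJ (op symJ (Φ - ((4 * Real.pi ^ 2)⁻¹ : ℝ) • L))

section TestFunction

variable {Φ L : L2 n}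

/-- From `(1 + |ξ|²) J² = 1` one gets `r² J² = 4π² (1 - J²)`, which removes the unbounded factor
when the operator is applied to `H²` functions. -/
lemma symK0JDeriv_mul_symJ (t : ℝ) (ξ : Space n) :
    symK0JDeriv t ξ * symJ ξ = (((-(1 / 2) : ℝ) : ℂ) * symK0 t ξ +
      ((1 / 4 + 4 * Real.pi ^ 2 : ℝ) : ℂ) * symK1 t ξ) * (symJ ξ * symJ ξ) -
      ((4 * Real.pi ^ 2 : ℝ) : ℂ) * symK1 t ξ := by
  have h : ((1 + ‖ξ‖ ^ 2 : ℝ) : ℂ) * (symJ ξ * symJ ξ) = 1 := by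
    rw [symJ_eq, ← Complex.ofReal_mul, ← Complex.ofReal_mul, ← mul_inv,
      Real.mul_self_sqrt (by positivity), mul_inv_cancel₀ (by positivity), Complex.ofReal_one]
  rw [symK0JDeriv, waveNumber]
  push_cast at h ⊢
  linear_combination (-(4 * (Real.pi : ℂ) ^ 2 * symK1 t ξ)) * h

lemma op_symK0JDeriv_opJ (h : HasLaplacian Φ L) (t : ℝ) :
    op (symK0JDeriv t) (op symJ (Φ - ((4 * Real.pi ^ 2)⁻¹ : ℝ) • L)) =
      (-(1 / 2) : ℝ) • op (symK0 t) Φ + (1 / 4 : ℝ) • op (symK1 t) Φ + op (symK1 t) L := by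
  set g : L2 n := Φ - ((4 * Real.pi ^ 2)⁻¹ : ℝ) • L with hg
  have hΦ : Φ = op symJ (op symJ g) := h
  have hpi : (4 * Real.pi ^ 2 : ℝ) ≠ 0 := by positivity
  have h0 := isSymbol_symK0 (n := n) t
  have h1 := isSymbol_symK1 (n := n) t
  have hJ := isSymbol_symJ (n := n)
  have ha := (IsSymbol.const (n := n) (-(1 / 2))).mul h0
  have hb := (IsSymbol.const (n := n) (1 / 4 + 4 * Real.pi ^ 2)).mul h1
  have hc := (IsSymbol.const (n := n) (4 * Real.pi ^ 2)).mul h1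
  rw [← op_mul (isSymbol_symK0JDeriv t) hJ, funext (symK0JDeriv_mul_symJ t),
    op_sub ((ha.add hb).mul (hJ.mul hJ)) hc, op_mul (ha.add hb) (hJ.mul hJ), op_mul hJ hJ, ← hΦ,
    op_add ha hb, op_const_mul _ h0, op_const_mul _ h1, op_const_mul _ h1, hg, map_sub, map_smul,
    smul_sub, smul_smul, mul_inv_cancel₀ hpi]
  module

lemma HasLaplacian.hasDerivAt_opK0 (h : HasLaplacian Φ L) (t : ℝ) :
    HasDerivAt (fun t => op (symK0 t) Φ)
      ((-(1 / 2) : ℝ) • op (symK0 t) Φ + (1 / 4 : ℝ) • op (symK1 t) Φ + op (symK1 t) L) t := by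
  have := DampedWave.hasDerivAt_opK0 (op symJ (Φ - ((4 * Real.pi ^ 2)⁻¹ : ℝ) • L)) t
  rwa [op_symK0JDeriv_opJ h, ← show Φ = _ from h] at this

lemma hasDerivAt_opK1' (f : L2 n) (t : ℝ) : HasDerivAt (fun t => op (symK1 t) f)
    ((-(1 / 2) : ℝ) • op (symK1 t) f + op (symK0 t) f) t := by
  rw [← op_symK1Deriv]; exact hasDerivAt_opK1 f t

variable {ψ ψ' ψ'' : ℝ → ℝ} {T : ℝ}

/-- The adjoint damped wave operator applied to the test function `ψ(t) Φ`. -/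
def adjointTest (Φ L : L2 n) (ψ ψ' ψ'' : ℝ → ℝ) (t : ℝ) : L2 n := (ψ'' t - ψ' t) • Φ - ψ t • L

/-- With `w(t) = K₁(t - τ)Φ`, the integrand is the derivative of `ψ' w - ψ w' - ψ w`. This vanishes
at `T`, and at `τ` it equals `-ψ(τ)Φ` because `w = 0` and `w' = Φ` there. -/
lemma integral_opK1_adjointTest (h : HasLaplacian Φ L) (hψ : ∀ t, HasDerivAt ψ (ψ' t) t)
    (hψ' : ∀ t, HasDerivAt ψ' (ψ'' t) t) (hψ'' : Continuous ψ'') (hT : ψ T = 0) (hT' : ψ' T = 0)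
    (τ : ℝ) : ∫ t in τ..T, op (symK1 (t - τ)) (adjointTest Φ L ψ ψ' ψ'' t) = ψ τ • Φ := by
  have hc : Continuous ψ := continuous_iff_continuousAt.2 fun t => (hψ t).continuousAt
  have hc' : Continuous ψ' := continuous_iff_continuousAt.2 fun t => (hψ' t).continuousAt
  set G : ℝ → L2 n := fun t =>
    (ψ' t - (1 / 2) * ψ t) • op (symK1 (t - τ)) Φ - ψ t • op (symK0 (t - τ)) Φ
  have hG : ∀ t, HasDerivAt G (op (symK1 (t - τ)) (adjointTest Φ L ψ ψ' ψ'' t)) t := by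
    intro t
    have e1 := (hasDerivAt_opK1' Φ (t - τ)).comp_sub_const t τ
    have e0 := (h.hasDerivAt_opK0 (t - τ)).comp_sub_const t τ
    refine ((((hψ' t).sub ((hψ t).const_mul (1 / 2))).smul e1).sub ((hψ t).smul e0)).congr_deriv ?_
    simp only [adjointTest, map_sub, map_smul, Pi.sub_apply]
    module
  have hcont : Continuous fun t => op (symK1 (t - τ)) (adjointTest Φ L ψ ψ' ψ'' t) :=
    isStrongFamily_K1.continuous_comp (by fun_prop) (by unfold adjointTest; fun_prop)
  rw [intervalIntegral.integral_eq_sub_of_hasDerivAt (fun t _ => hG t)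
    (hcont.intervalIntegrable _ _)]
  simp only [G, hT, hT', sub_self, op_symK1_zero, op_symK0_zero]
  simp

/-- The same primitive with `w(t) = K₀(t)Φ`, for which `w(0) = Φ` and `w'(0) = -Φ/2`. -/
lemma integral_opK0_adjointTest (h : HasLaplacian Φ L) (hψ : ∀ t, HasDerivAt ψ (ψ' t) t)
    (hψ' : ∀ t, HasDerivAt ψ' (ψ'' t) t) (hψ'' : Continuous ψ'') (hT : ψ T = 0) (hT' : ψ' T = 0) :
    ∫ t in (0 : ℝ)..T, op (symK0 t) (adjointTest Φ L ψ ψ' ψ'' t) =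
      ((1 / 2) * ψ 0 - ψ' 0) • Φ := by
  have hc : Continuous ψ := continuous_iff_continuousAt.2 fun t => (hψ t).continuousAt
  have hc' : Continuous ψ' := continuous_iff_continuousAt.2 fun t => (hψ' t).continuousAt
  set H : ℝ → L2 n := fun t => (ψ' t - (1 / 2) * ψ t) • op (symK0 t) Φ -
    ψ t • ((1 / 4 : ℝ) • op (symK1 t) Φ + op (symK1 t) L)
  have hH : ∀ t, HasDerivAt H (op (symK0 t) (adjointTest Φ L ψ ψ' ψ'' t)) t := by
    intro t
    have e1 := hasDerivAt_opK1' Φ t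
    have e2 := hasDerivAt_opK1' L t
    have e0 := h.hasDerivAt_opK0 t
    refine ((((hψ' t).sub ((hψ t).const_mul (1 / 2))).smul e0).sub
      ((hψ t).smul ((e1.const_smul (1 / 4 : ℝ)).add e2))).congr_deriv ?_
    simp only [adjointTest, map_sub, map_smul, Pi.sub_apply, Pi.add_apply, Pi.smul_apply]
    module
  have hcont : Continuous fun t => op (symK0 t) (adjointTest Φ L ψ ψ' ψ'' t) :=
    isStrongFamily_K0.continuous_comp (by fun_prop) (by unfold adjointTest; fun_prop)
  rw [intervalIntegral.integral_eq_sub_of_hasDerivAt (fun t _ => hH t)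
    (hcont.intervalIntegrable _ _)]
  simp only [H, hT, hT', op_symK1_zero, op_symK0_zero]
  simp
  module

/-- The weak form of the damped wave equation with source `F`, for test functions `ψ(t) Φ(x)`. -/
theorem integral_inner_adjointTest (h : HasLaplacian Φ L) (hψ : ∀ t, HasDerivAt ψ (ψ' t) t)
    (hψ' : ∀ t, HasDerivAt ψ' (ψ'' t) t) (hψ'' : Continuous ψ'') (hT0 : 0 ≤ T) (hT : ψ T = 0)
    (hT' : ψ' T = 0) {u F : ℝ → L2 n} {u₀ u₁ : L2 n} (hF : ContinuousOn F (Icc 0 T))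
    (hu : ∀ t ∈ Icc 0 T, u t = linearPart u₀ u₁ t + duhamel (fun t => op (symK1 t)) F t) :
    ∫ t in (0 : ℝ)..T, inner ℝ (u t) (adjointTest Φ L ψ ψ' ψ'' t) =
      (ψ 0 - ψ' 0) * inner ℝ u₀ Φ + ψ 0 * inner ℝ u₁ Φ +
        ∫ τ in (0 : ℝ)..T, ψ τ * inner ℝ (F τ) Φ := by
  have hc : Continuous ψ := continuous_iff_continuousAt.2 fun t => (hψ t).continuousAt
  have hc' : Continuous ψ' := continuous_iff_continuousAt.2 fun t => (hψ' t).continuousAt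
  set Q := adjointTest Φ L ψ ψ' ψ'' with hQ
  have hQc : Continuous Q := by rw [hQ]; unfold adjointTest; fun_prop
  set F' := clamp T F
  have hF'c : Continuous F' := continuous_clamp hT0 hF
  set v : L2 n := (1 / 2 : ℝ) • u₀ + u₁ with hv
  have h0c : Continuous fun t => op (symK0 t) (Q t) :=
    isStrongFamily_K0.continuous_comp continuous_id hQc
  have h1c : Continuous fun t => op (symK1 t) (Q t) :=
    isStrongFamily_K1.continuous_comp continuous_id hQc
  have hDc : Continuous (duhamel (fun t => op (symK1 t : Space n → ℂ)) F') :=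
    isStrongFamily_K1.continuous_duhamel hF'c
  have e1 : ∫ t in (0 : ℝ)..T, inner ℝ (u t) (Q t) = ∫ t in (0 : ℝ)..T,
      (inner ℝ u₀ (op (symK0 t) (Q t)) + inner ℝ v (op (symK1 t) (Q t)) +
        inner ℝ (duhamel (fun t => op (symK1 t)) F' t) (Q t)) := by
    refine intervalIntegral.integral_congr fun t ht => ?_
    rw [uIcc_of_le hT0] at ht
    rw [hu t ht, linearPart, inner_add_left, inner_add_left, inner_op (isSymbol_symK0 t),
      inner_op (isSymbol_symK1 t), duhamel_congr (F₁ := F) (F₂ := F') ht.1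
      fun s hs => (clamp_eq ⟨hs.1, hs.2.trans ht.2⟩).symm]
  have e2 : ∫ t in (0 : ℝ)..T, inner ℝ u₀ (op (symK0 t) (Q t)) =
      inner ℝ u₀ (((1 / 2) * ψ 0 - ψ' 0) • Φ) := by
    rw [← integral_opK0_adjointTest h hψ hψ' hψ'' hT hT']
    exact (innerSL ℝ u₀).intervalIntegral_comp_comm (h0c.intervalIntegrable _ _)
  have e3 : ∫ t in (0 : ℝ)..T, inner ℝ v (op (symK1 t) (Q t)) = inner ℝ v (ψ 0 • Φ) := by
    rw [← integral_opK1_adjointTest h hψ hψ' hψ'' hT hT' 0]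
    simp only [sub_zero]
    exact (innerSL ℝ v).intervalIntegral_comp_comm (h1c.intervalIntegrable _ _)
  have e4 : ∫ t in (0 : ℝ)..T, inner ℝ (duhamel (fun t => op (symK1 t)) F' t) (Q t) =
      ∫ τ in (0 : ℝ)..T, ψ τ * inner ℝ (F τ) Φ := by
    have e5 : ∀ t, inner ℝ (duhamel (fun t => op (symK1 t)) F' t) (Q t) =
        ∫ τ in (0 : ℝ)..t, inner ℝ (F' τ) (op (symK1 (t - τ)) (Q t)) := by
      intro t
      have hci : Continuous fun τ => op (symK1 (t - τ)) (F' τ) :=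
        isStrongFamily_K1.continuous_comp (by fun_prop) hF'c
      rw [real_inner_comm]
      have := (innerSL ℝ (Q t)).intervalIntegral_comp_comm (hci.intervalIntegrable (μ := volume) 0 t)
      simp only [innerSL_apply_apply] at this
      rw [duhamel, ← this]
      refine intervalIntegral.integral_congr fun τ _ => ?_
      rw [real_inner_comm, inner_op (isSymbol_symK1 _)]
    simp only [e5]
    -- Self-adjointness has moved `K₁` onto the test function. After the exchange the inner integral
    -- over `t` is evaluated by the preceding identity as `ψ(τ)Φ`.
    rw [integral_triangle_swap (φ := fun t τ => inner ℝ (F' τ) (op (symK1 (t - τ)) (Q t))) ?_ hT0]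
    · refine intervalIntegral.integral_congr fun τ hτ => ?_
      rw [uIcc_of_le hT0] at hτ
      have hci : Continuous fun t => op (symK1 (t - τ)) (Q t) :=
        isStrongFamily_K1.continuous_comp (by fun_prop) hQc
      have := (innerSL ℝ (F' τ)).intervalIntegral_comp_comm (hci.intervalIntegrable (μ := volume) τ T)
      simp only [innerSL_apply_apply] at this
      rw [this, hQ, integral_opK1_adjointTest h hψ hψ' hψ'' hT hT', inner_smul_right,
        show F' τ = F τ from clamp_eq hτ]
    · exact (hF'c.comp continuous_snd).inner
        (isStrongFamily_K1.continuous_comp (by fun_prop) (hQc.comp continuous_fst))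
  -- The coefficient of `u₀` collects `ψ(0)/2 - ψ'(0)` from `K₀` and `ψ(0)/2` from `K₁`.
  rw [e1, intervalIntegral.integral_add, intervalIntegral.integral_add, e2, e3, e4, hv,
    inner_smul_right, inner_smul_right, inner_add_left, inner_smul_left]
  · simp only [conj_trivial]; ring
  · exact (continuous_const.inner h0c).intervalIntegrable _ _
  · exact (continuous_const.inner h1c).intervalIntegrable _ _
  · exact ((continuous_const.inner h0c).add (continuous_const.inner h1c)).intervalIntegrable _ _
  · exact (hDc.inner hQc).intervalIntegrable _ _

end TestFunction

end DampedWave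
end

/-! ### Smooth spatial cut-offs. -/

noncomputable section

namespace DampedWave

open Filter Topology Set Laplacian
open scoped ENNReal SchwartzMap ContDiff

variable {n : ℕ}

section SmoothTestFunctions

lemma laplacian_eq_sum_fderiv (f : Space n → ℝ) (x : Space n) :
    (Δ f) x = ∑ i, fderiv ℝ (fderiv ℝ f) x (stdOrthonormalBasis ℝ (Space n) i)
      (stdOrthonormalBasis ℝ (Space n) i) := by
  rw [InnerProductSpace.laplacian_eq_iteratedFDeriv_stdOrthonormalBasis]
  simp [iteratedFDeriv_two_apply]

lemma laplacian_comp_smul (f : Space n → ℝ) (c : ℝ) (x : Space n) :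
    (Δ fun x => f (c • x)) x = c ^ 2 * (Δ f) (c • x) := by
  have h : fderiv ℝ (fun x => f (c • x)) = fun x => c • fderiv ℝ f (c • x) :=
    funext fun x => fderiv_comp_smul c
  rw [laplacian_eq_sum_fderiv, laplacian_eq_sum_fderiv, h, Finset.mul_sum]
  refine Finset.sum_congr rfl fun i _ => ?_
  have h1 := congrFun (fderiv_const_smul_field (𝕜 := ℝ) (f := fun x => fderiv ℝ f (c • x)) c) x
  rw [Pi.smul_apply, fderiv_comp_smul (f := fderiv ℝ f)] at h1
  rw [show (fun x => c • fderiv ℝ f (c • x)) = c • fun x => fderiv ℝ f (c • x) from rfl, h1]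
  simp only [smul_smul, smul_apply, smul_eq_mul, sq]

/-- Two derivatives cost only two powers, so `χ^k` factors out and the Laplacian degenerates
together with the cut-off. -/
lemma fderiv_fderiv_pow {χ : Space n → ℝ} (hχ : ContDiff ℝ ∞ χ) (k : ℕ) (x e : Space n) :
    fderiv ℝ (fderiv ℝ fun x => χ x ^ (k + 2)) x e e =
      χ x ^ k * ((k + 2) * (k + 1) * (fderiv ℝ χ x e) ^ 2 +
        (k + 2) * χ x * fderiv ℝ (fderiv ℝ χ) x e e) := by
  have hd : Differentiable ℝ χ := hχ.differentiable (by simp)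
  have hd2 : Differentiable ℝ (fderiv ℝ χ) :=
    (hχ.fderiv_right (m := ∞) (by simp)).differentiable (by simp)
  have h1 : ∀ j : ℕ, ∀ y, HasFDerivAt (fun x => χ x ^ (j + 1))
      (((j + 1 : ℝ) * χ y ^ j) • fderiv ℝ χ y) y := by
    intro j y
    have := (hd y).hasFDerivAt.pow (j + 1)
    simpa using this
  have h2 : fderiv ℝ (fun x => χ x ^ (k + 2)) =
      fun y => ((k + 2 : ℝ) * χ y ^ (k + 1)) • fderiv ℝ χ y := by
    ext1 y
    rw [(h1 (k + 1) y).fderiv]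
    push_cast
    ring_nf
  have h3 := (((h1 k x).const_mul (k + 2 : ℝ)).smul (hd2 x).hasFDerivAt)
  rw [h2]
  rw [show (fun y => ((k + 2 : ℝ) * χ y ^ (k + 1)) • fderiv ℝ χ y) =
    (fun y => (k + 2 : ℝ) * χ y ^ (k + 1)) • fderiv ℝ χ from rfl, h3.fderiv]
  simp only [add_apply, smul_apply,
    ContinuousLinearMap.smulRight_apply, smul_eq_mul]
  ring

/-- A smooth cut-off `φ` whose Laplacian is bounded by a multiple of `φ^{1/p}`. -/
structure IsCutoff (p : ℝ) (φ : Space n → ℝ) : Prop where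
  contDiff : ContDiff ℝ ∞ φ
  nonneg : ∀ x, 0 ≤ φ x
  le_one : ∀ x, φ x ≤ 1
  eq_one : ∀ x, ‖x‖ ≤ 1 → φ x = 1
  eq_zero : ∀ x, 2 ≤ ‖x‖ → φ x = 0
  laplacian_eq_zero : ∀ x, ‖x‖ < 1 → (Δ φ) x = 0
  laplacian_le : ∃ C, 0 ≤ C ∧ ∀ x, |(Δ φ) x| ≤ C * φ x ^ (1 / p)

/-- A high power `χ^{k+2}` of a bump works: its Laplacian is `O(χ^k)`, and `χ^k ≤ (χ^{k+2})^{1/p}`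
as soon as `k ≥ (k+2)/p`, that is `k ≥ 2/(p-1)`. -/
lemma exists_isCutoff (n : ℕ) {p : ℝ} (hp : 1 < p) : ∃ φ : Space n → ℝ, IsCutoff p φ := by
  obtain ⟨k, hk⟩ := exists_nat_ge (2 / (p - 1))
  let B : ContDiffBump (0 : Space n) := ⟨1, 2, one_pos, one_lt_two⟩
  set χ : Space n → ℝ := fun x => B x with hχ
  have hs : ContDiff ℝ ∞ χ := B.contDiff
  have h0 : ∀ x, 0 ≤ χ x := fun x => B.nonneg
  have h1 : ∀ x, χ x ≤ 1 := fun x => B.le_one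
  have hone : ∀ x, ‖x‖ ≤ 1 → χ x = 1 := fun x hx =>
    B.one_of_mem_closedBall (by simpa [B] using hx)
  have hzero : ∀ x, 2 ≤ ‖x‖ → χ x = 0 := fun x hx => B.zero_of_le_dist (by simpa [B] using hx)
  have hcs : HasCompactSupport χ := B.hasCompactSupport
  set e := stdOrthonormalBasis ℝ (Space n)
  set g : Space n → ℝ := fun x => ∑ i, ((k + 2) * (k + 1) * (fderiv ℝ χ x (e i)) ^ 2 +
        (k + 2) * χ x * fderiv ℝ (fderiv ℝ χ) x (e i) (e i)) with hg
  have hlap : ∀ x, (Δ fun x => χ x ^ (k + 2)) x = χ x ^ k * g x := by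
    intro x
    rw [laplacian_eq_sum_fderiv, hg, Finset.mul_sum]
    exact Finset.sum_congr rfl fun i _ => fderiv_fderiv_pow hs k x (e i)
  have hs' : ContDiff ℝ ∞ (fderiv ℝ χ) := hs.fderiv_right (by simp)
  have hs'' : Continuous (fderiv ℝ (fderiv ℝ χ)) := hs'.continuous_fderiv (by simp)
  have hgc : Continuous g := by
    have := hs'.continuous
    have := hs.continuous
    fun_prop
  obtain ⟨C, hC⟩ := (isCompact_closedBall (0 : Space n) 2).exists_bound_of_continuousOn
    hgc.continuousOn
  refine ⟨fun x => χ x ^ (k + 2), hs.pow _, fun x => pow_nonneg (h0 x) _,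
    fun x => pow_le_one₀ (h0 x) (h1 x), fun x hx => by simp [hone x hx],
    fun x hx => by simp [hzero x hx], fun x hx => ?_, max C 0, le_max_right _ _, fun x => ?_⟩
  · have : (fun x => χ x ^ (k + 2)) =ᶠ[𝓝 x] fun _ => 1 := by
      filter_upwards [(isOpen_lt continuous_norm continuous_const).mem_nhds hx] with y hy
      rw [hone y (le_of_lt hy), one_pow]
    rw [(InnerProductSpace.laplacian_congr_nhds this).eq_of_nhds]
    simp
  · have hk0 : k ≠ 0 := by
      rintro rfl
      have : 0 < 2 / (p - 1) := div_pos two_pos (by linarith)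
      simp at hk; linarith
    rw [hlap]
    rcases le_or_gt 2 ‖x‖ with hx | hx
    · simp only [hzero x hx, zero_pow hk0, zero_mul, abs_zero]
      positivity
    · rw [abs_mul, abs_of_nonneg (pow_nonneg (h0 x) k), mul_comm]
      refine mul_le_mul ((hC x (by simpa using hx.le)).trans (le_max_left _ _)) ?_
        (pow_nonneg (h0 x) k) (le_max_right _ _)
      rw [← Real.rpow_natCast, ← Real.rpow_natCast, ← Real.rpow_mul (h0 x)]
      refine Real.rpow_le_rpow_of_exponent_ge_of_imp (h0 x) (h1 x) ?_ ?_
      · rw [div_le_iff₀ (by linarith)] at hk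
        rw [mul_one_div, div_le_iff₀ (by linarith)]
        push_cast; linarith
      · exact fun _ h => absurd (by exact_mod_cast h) hk0

/-- A smooth compactly supported function and its Laplacian, as elements of `L²`. -/
lemma exists_hasLaplacian {φ : Space n → ℝ} (hφ : ContDiff ℝ ∞ φ) (hc : HasCompactSupport φ) :
    ∃ Φ L : L2 n, Φ =ᵐ[volume] φ ∧ L =ᵐ[volume] (Δ φ) ∧ HasLaplacian Φ L := by
  have hc' : HasCompactSupport fun x => (φ x : ℂ) := hc.comp_left Complex.ofReal_zero
  have hφ' : ContDiff ℝ ∞ fun x => (φ x : ℂ) := Complex.ofRealCLM.contDiff.comp hφ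
  set f : 𝓢(Space n, ℂ) := hc'.toSchwartzMap hφ' with hf
  have hpi : (4 * Real.pi ^ 2 : ℝ) ≠ 0 := by positivity
  refine ⟨reL n (f.toLp 2), reL n ((Δ f).toLp 2), ?_, ?_, ?_⟩
  · filter_upwards [coeFn_reL (f.toLp 2), f.coeFn_toLp 2 volume] with x e1 e2
    rw [e1, e2]; rfl
  · filter_upwards [coeFn_reL ((Δ f).toLp 2), (Δ f).coeFn_toLp 2 volume] with x e1 e2
    rw [e1, e2, SchwartzMap.laplacian_apply]
    have h2 : ContDiffAt ℝ 2 φ x := hφ.contDiffAt.of_le (by norm_cast)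
    have h := h2.laplacian_CLM_comp_left (l := Complex.ofRealCLM)
    have h' : (Δ (f : Space n → ℂ)) x = ((Δ φ) x : ℂ) := h
    rw [h', Complex.ofReal_re]
  · have hJ := isSymbol_symJ (n := n)
    have hlap : ∀ ξ, (𝓕 (Δ f) : 𝓢(Space n, ℂ)) ξ =
        -(2 * Real.pi) ^ 2 * ‖ξ‖ ^ 2 * (𝓕 f : 𝓢(Space n, ℂ)) ξ := by
      intro ξ
      rw [SchwartzMap.laplacian_eq_fourierMultiplierCLM, SchwartzMap.fourierMultiplierCLM_apply,
        FourierTransform.fourier_smul, FourierTransform.fourier_fourierInv_eq,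
        smul_apply, SchwartzMap.smulLeftCLM_apply_apply (by fun_prop)]
      simp
      ring
    set F : L2C n := f.toLp 2 volume with hF
    set F' : L2C n := (Δ f).toLp 2 volume with hF'
    -- On the Fourier side the Laplacian is `-4π²|ξ|²`, so the identity reduces to `(1 + |ξ|²) J² =
    -- 1`.
    have key : fmult symJ (fmult symJ (F -
        ((4 * Real.pi ^ 2)⁻¹ : ℝ) • F' : L2C n)) = F := by
      apply fourier_injective_L2
      have e0 : (𝓕 (F - ((4 * Real.pi ^ 2)⁻¹ : ℝ) • F' : L2C n) : L2C n) =
          (𝓕 f).toLp 2 volume - ((4 * Real.pi ^ 2)⁻¹ : ℝ) • (𝓕 (Δ f)).toLp 2 volume := by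
        have hs : ∀ (r : ℝ) (G : L2C n), r • G = (r : ℂ) • G := fun r G =>
          (algebraMap_smul ℂ r G).symm
        rw [← SchwartzMap.toLp_fourier_eq, ← SchwartzMap.toLp_fourier_eq, ← hF, ← hF', hs, hs]
        exact ((fourierEquivL2 n).map_sub _ _).trans
          (congrArg _ ((fourierEquivL2 n).map_smul _ _))
      apply Lp.ext
      have h1 := ae_fourier_fmult hJ (fmult symJ (F -
        ((4 * Real.pi ^ 2)⁻¹ : ℝ) • F' : L2C n))
      have h2 := ae_fourier_fmult hJ (F -
        ((4 * Real.pi ^ 2)⁻¹ : ℝ) • F' : L2C n)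
      rw [e0] at h2
      rw [hF, SchwartzMap.toLp_fourier_eq]
      filter_upwards [h1, h2, Lp.coeFn_sub ((𝓕 f).toLp 2 volume)
        (((4 * Real.pi ^ 2)⁻¹ : ℝ) • (𝓕 (Δ f)).toLp 2 volume : L2C n),
        Lp.coeFn_smul ((4 * Real.pi ^ 2)⁻¹ : ℝ) ((𝓕 (Δ f)).toLp 2 volume : L2C n),
        (𝓕 f).coeFn_toLp 2 volume, (𝓕 (Δ f)).coeFn_toLp 2 volume] with ξ e1 e2 e3 e4 e5 e6
      rw [e1, e2, e3, Pi.sub_apply, e4, Pi.smul_apply, e5, e6, hlap, Complex.real_smul]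
      have h : ((1 + ‖ξ‖ ^ 2 : ℝ) : ℂ) * (symJ ξ * symJ ξ) = 1 := by
        rw [symJ_eq, ← Complex.ofReal_mul, ← Complex.ofReal_mul, ← mul_inv,
          Real.mul_self_sqrt (by positivity), mul_inv_cancel₀ (by positivity), Complex.ofReal_one]
      have hpi' : (Real.pi : ℂ) ≠ 0 := by exact_mod_cast Real.pi_ne_zero
      push_cast at h ⊢
      field_simp
      linear_combination 4 * (𝓕 f : 𝓢(Space n, ℂ)) ξ * h
    rw [HasLaplacian, ← map_smul, ← map_sub, ← reL_fmult hJ, ← reL_fmult hJ, key]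

end SmoothTestFunctions

end DampedWave
end

/-! ### Spatial Hölder estimates and cut-offs at scale `R`. -/

noncomputable section

namespace DampedWave

open Filter Topology Set Laplacian
open scoped ENNReal ContDiff

variable {n : ℕ}

section SpatialEstimates

lemma inner_eq_integral (f g : L2 n) : inner ℝ f g = ∫ x, f x * g x := by
  rw [L2.inner_def]
  refine integral_congr_ae (Eventually.of_forall fun x => ?_)
  simp only [RCLike.inner_apply, conj_trivial]
  ring

lemma integrable_mul_L2 (f g : L2 n) : Integrable (fun x => f x * g x) volume :=
  (Lp.memLp f).integrable_mul (Lp.memLp g)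

lemma inner_nonneg_of_ae {f g : L2 n} (hf : ∀ᵐ x, 0 ≤ f x) (hg : ∀ᵐ x, 0 ≤ g x) :
    0 ≤ inner ℝ f g := by
  rw [inner_eq_integral]
  refine integral_nonneg_of_ae ?_
  filter_upwards [hf, hg] with x h1 h2 using mul_nonneg h1 h2

lemma absPow_nonneg {p : ℝ} {f : L2 n} (hf : MemLp (fun x : Space n => |f x| ^ p) 2 volume) :
    ∀ᵐ x, 0 ≤ absPow p f x := by
  filter_upwards [coeFn_absPow hf] with x h
  rw [h]; positivity

lemma holderConjugate_inv {p : ℝ} (hp : 1 < p) : p.HolderConjugate (1 - 1 / p)⁻¹ := by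
  rw [Real.holderConjugate_iff]
  refine ⟨hp, ?_⟩
  rw [inv_inv]; ring

/-- Hölder with exponent `p` applied to `|f| Ψ^{1/p}` and the indicator of the ball carrying `W`. It
serves both for the cut-off and for its Laplacian. -/
lemma abs_inner_le_rpow {p : ℝ} (hp : 1 < p) {f : L2 n}
    (hf : MemLp (fun x : Space n => |f x| ^ p) 2 volume) {W Ψ : L2 n} {C r : ℝ}
    (hΨ : ∀ᵐ x, 0 ≤ Ψ x) (hW : ∀ᵐ x, |W x| ≤ C * Ψ x ^ (1 / p))
    (hr : ∀ᵐ x, r ≤ ‖x‖ → W x = 0) (hC : 0 ≤ C) :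
    |inner ℝ f W| ≤ C * (inner ℝ (absPow p f) Ψ) ^ (1 / p) *
      (volume.real (Metric.ball (0 : Space n) r)) ^ (1 - 1 / p) := by
  have hp0 : 0 < p := by linarith
  have hpq := holderConjugate_inv hp
  set q := (1 - 1 / p)⁻¹ with hq
  have hq0 : 0 < q := hpq.symm.pos
  set F : Space n → ℝ := fun x => |f x| * Ψ x ^ (1 / p) with hF
  set G : Space n → ℝ := (Metric.ball (0 : Space n) r).indicator fun _ => (1 : ℝ) with hG
  have hF0 : 0 ≤ᵐ[volume] F := by
    filter_upwards [hΨ] with x h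
    have : 0 ≤ Ψ x ^ (1 / p) := Real.rpow_nonneg h _
    simp only [hF, Pi.zero_apply]; positivity
  have hG0 : 0 ≤ᵐ[volume] G := Eventually.of_forall fun x =>
    indicator_nonneg (fun _ _ => zero_le_one) x
  have hFp : (fun x => F x ^ p) =ᵐ[volume] fun x => absPow p f x * Ψ x := by
    filter_upwards [hΨ, coeFn_absPow hf] with x h1 h2
    rw [h2, hF, Real.mul_rpow (abs_nonneg _) (Real.rpow_nonneg h1 _), ← Real.rpow_mul h1,
      one_div_mul_cancel hp0.ne', Real.rpow_one]
  have hFm : AEStronglyMeasurable F volume :=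
    (Lp.aestronglyMeasurable f).norm.mul
      ((Lp.aestronglyMeasurable Ψ).aemeasurable.pow_const (1 / p)).aestronglyMeasurable
  have hFL : MemLp F (ENNReal.ofReal p) volume := by
    rw [← integrable_norm_rpow_iff hFm (by simpa using hp0) ENNReal.ofReal_ne_top,
      ENNReal.toReal_ofReal hp0.le]
    refine (integrable_mul_L2 (absPow p f) Ψ).congr ?_
    filter_upwards [hFp, hF0] with x h1 h2
    rw [Real.norm_of_nonneg h2, h1]
  have hball : volume (Metric.ball (0 : Space n) r) ≠ ⊤ := measure_ball_lt_top.ne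
  have hGL : MemLp G (ENNReal.ofReal q) volume :=
    memLp_indicator_const _ measurableSet_ball 1 (Or.inr hball)
  have hGq : ∫ x, G x ^ q = volume.real (Metric.ball (0 : Space n) r) := by
    have : (fun x => G x ^ q) = G := by
      ext x
      by_cases hx : x ∈ Metric.ball (0 : Space n) r
      · simp [hG, indicator_of_mem hx]
      · simp [hG, indicator_of_notMem hx, Real.zero_rpow hq0.ne']
    rw [this, hG, integral_indicator_const _ measurableSet_ball, smul_eq_mul, mul_one]
  have key := integral_mul_le_Lp_mul_Lq_of_nonneg hpq hF0 hG0 hFL hGL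
  rw [hGq, integral_congr_ae hFp, ← inner_eq_integral, hq, one_div (1 - 1 / p)⁻¹, inv_inv] at key
  have hFG : Integrable (fun x => F x * G x) volume := by
    have : ENNReal.HolderConjugate (ENNReal.ofReal p) (ENNReal.ofReal q) := hpq.ennrealOfReal
    exact hFL.integrable_mul hGL
  calc |inner ℝ f W| ≤ ∫ x, |f x * W x| := by
        rw [inner_eq_integral]; exact abs_integral_le_integral_abs
    _ ≤ ∫ x, C * (F x * G x) := by
        refine integral_mono_ae (integrable_mul_L2 f W).abs (hFG.const_mul C) ?_
        filter_upwards [hW, hr, hΨ] with x h1 h2 h3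
        by_cases hx : x ∈ Metric.ball (0 : Space n) r
        · simp only [hG, indicator_of_mem hx, hF, mul_one, abs_mul]
          nlinarith [mul_le_mul_of_nonneg_left h1 (abs_nonneg (f x))]
        · have : W x = 0 := h2 (by simpa using hx)
          simp only [hG, indicator_of_notMem hx, this, mul_zero, abs_zero, le_refl]
    _ = C * ∫ x, F x * G x := integral_const_mul _ _
    _ ≤ _ := by
        rw [mul_assoc]
        exact mul_le_mul_of_nonneg_left key hC

variable {p : ℝ} {φ : Space n → ℝ}

lemma IsCutoff.hasCompactSupport (hφ : IsCutoff p φ) : HasCompactSupport φ := by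
  refine HasCompactSupport.intro (isCompact_closedBall (0 : Space n) 2) fun x hx => ?_
  exact hφ.eq_zero x (by simp at hx; exact hx.le)

lemma norm_inv_smul {R : ℝ} (hR : 0 < R) (x : Space n) : ‖R⁻¹ • x‖ = ‖x‖ / R := by
  rw [norm_smul, Real.norm_of_nonneg (inv_nonneg.2 hR.le)]; ring

/-- The cut-off at scale `R`, its Laplacian, and its part outside the ball of radius `R`. -/
structure IsScaledCutoff (p : ℝ) (φ : Space n → ℝ) (C R : ℝ) (Φ L Ψ : L2 n) : Prop where
  hasLaplacian : HasLaplacian Φ L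
  coe_eq : Φ =ᵐ[volume] fun x => φ (R⁻¹ • x)
  outer_eq : Ψ =ᵐ[volume] fun x => {x : Space n | R ≤ ‖x‖}.indicator (fun x => φ (R⁻¹ • x)) x
  laplacian_le : ∀ᵐ x, |L x| ≤ C * (R ^ 2)⁻¹ * Ψ x ^ (1 / p)

/-- Scaling contributes the factor `R⁻²`. The Laplacian vanishes for `|x| < R`, where the cut-off is
constant, so the outer part alone dominates it. -/
lemma IsCutoff.exists_scaled (hφ : IsCutoff p φ) (hp : 1 < p) : ∃ C, 0 ≤ C ∧ ∀ R, 0 < R →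
    ∃ Φ L Ψ : L2 n, IsScaledCutoff p φ C R Φ L Ψ := by
  obtain ⟨C, hC0, hC⟩ := hφ.laplacian_le
  refine ⟨C, hC0, fun R hR => ?_⟩
  have hs : ContDiff ℝ ∞ fun x : Space n => φ (R⁻¹ • x) :=
    hφ.contDiff.comp (contDiff_const_smul R⁻¹)
  have hc : HasCompactSupport fun x : Space n => φ (R⁻¹ • x) :=
    hφ.hasCompactSupport.comp_smul (inv_ne_zero hR.ne')
  obtain ⟨Φ, L, hΦ, hL, hlap⟩ := exists_hasLaplacian hs hc
  have hmeas : MeasurableSet {x : Space n | R ≤ ‖x‖} := measurableSet_le measurable_const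
    measurable_norm
  have hmem := ((memLp_congr_ae hΦ).1 (Lp.memLp Φ)).indicator hmeas
  refine ⟨Φ, L, hmem.toLp _, hlap, hΦ, hmem.coeFn_toLp, ?_⟩
  filter_upwards [hL, hmem.coeFn_toLp] with x e1 e2
  rw [e1, e2, laplacian_comp_smul, abs_mul, abs_of_nonneg (by positivity), inv_pow]
  by_cases hx : R ≤ ‖x‖
  · rw [indicator_of_mem (by exact hx)]
    calc _ ≤ (R ^ 2)⁻¹ * (C * φ (R⁻¹ • x) ^ (1 / p)) :=
          mul_le_mul_of_nonneg_left (hC _) (by positivity)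
      _ = _ := by ring
  · rw [hφ.laplacian_eq_zero _ (by rw [norm_inv_smul hR, div_lt_one hR]; exact not_le.1 hx),
      indicator_of_notMem (by exact hx), Real.zero_rpow (by positivity)]
    simp

namespace IsScaledCutoff

variable {C R : ℝ} {Φ L Ψ : L2 n}

lemma nonneg (h : IsScaledCutoff p φ C R Φ L Ψ) (hφ : IsCutoff p φ) : ∀ᵐ x, 0 ≤ Φ x := by
  filter_upwards [h.coe_eq] with x e
  rw [e]; exact hφ.nonneg _

lemma outer_nonneg (h : IsScaledCutoff p φ C R Φ L Ψ) (hφ : IsCutoff p φ) : ∀ᵐ x, 0 ≤ Ψ x := by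
  filter_upwards [h.outer_eq] with x e
  rw [e]; exact indicator_nonneg (fun _ _ => hφ.nonneg _) _

lemma eq_zero (h : IsScaledCutoff p φ C R Φ L Ψ) (hφ : IsCutoff p φ) (hR : 0 < R) :
    ∀ᵐ x, 2 * R ≤ ‖x‖ → Φ x = 0 := by
  filter_upwards [h.coe_eq] with x e hx
  rw [e]; exact hφ.eq_zero _ (by rwa [norm_inv_smul hR, le_div_iff₀ hR])

lemma laplacian_eq_zero (h : IsScaledCutoff p φ C R Φ L Ψ) (hφ : IsCutoff p φ) (hp : 1 < p)
    (hR : 0 < R) : ∀ᵐ x, 2 * R ≤ ‖x‖ → L x = 0 := by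
  filter_upwards [h.outer_eq, h.laplacian_le] with x e1 e2 hx
  have h0 : φ (R⁻¹ • x) = 0 := hφ.eq_zero _ (by rwa [norm_inv_smul hR, le_div_iff₀ hR])
  have : {x : Space n | R ≤ ‖x‖}.indicator (fun x => φ (R⁻¹ • x)) x = 0 :=
    indicator_apply_eq_zero.2 fun _ => h0
  rw [e1, this, Real.zero_rpow (by positivity), mul_zero] at e2
  exact abs_nonpos_iff.1 e2

lemma le_rpow (h : IsScaledCutoff p φ C R Φ L Ψ) (hφ : IsCutoff p φ) (hp : 1 < p) :
    ∀ᵐ x, |Φ x| ≤ 1 * Φ x ^ (1 / p) := by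
  filter_upwards [h.coe_eq] with x e
  rw [e, one_mul, abs_of_nonneg (hφ.nonneg _)]
  conv_lhs => rw [← Real.rpow_one (φ (R⁻¹ • x))]
  refine Real.rpow_le_rpow_of_exponent_ge_of_imp (hφ.nonneg _) (hφ.le_one _) ?_ ?_
  · rw [div_le_one (by linarith)]; exact hp.le
  · intro _ h
    exact absurd h (by positivity)

/-- The outer part at scale `R` and the cut-off at scale `r` do not overlap when `2r ≤ R`, and the
cut-off at scale `R` is one where the smaller one lives. Thus outer mass is at most total mass minus
inner mass. -/
lemma add_le {r : ℝ} {Φ' L' Ψ' : L2 n} (h : IsScaledCutoff p φ C R Φ L Ψ)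
    (h' : IsScaledCutoff p φ C r Φ' L' Ψ') (hφ : IsCutoff p φ) (hr : 0 < r) (hrR : 2 * r ≤ R) :
    ∀ᵐ x, Ψ x + Φ' x ≤ Φ x := by
  have hR : 0 < R := by linarith
  filter_upwards [h.coe_eq, h.outer_eq, h'.coe_eq] with x e1 e2 e3
  rw [e1, e2, e3]
  by_cases hx : R ≤ ‖x‖
  · rw [indicator_of_mem (by exact hx), hφ.eq_zero (r⁻¹ • x)
      (by rw [norm_inv_smul hr, le_div_iff₀ hr]; linarith), add_zero]
  · rw [indicator_of_notMem (by exact hx), zero_add, hφ.eq_one (R⁻¹ • x)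
      (by rw [norm_inv_smul hR, div_le_one hR]; exact (not_le.1 hx).le)]
    exact hφ.le_one _

end IsScaledCutoff

lemma volume_real_ball (n : ℕ) {R : ℝ} (hR : 0 < R) :
    volume.real (Metric.ball (0 : Space n) (2 * R)) =
      2 ^ n * volume.real (Metric.ball (0 : Space n) 1) * R ^ n := by
  rw [measureReal_def, Measure.addHaar_ball_of_pos _ _ (by positivity), measureReal_def,
    ENNReal.toReal_mul, ENNReal.toReal_ofReal (by positivity), finrank_euclideanSpace_fin]
  ring

/-- The mean of a function against the cut-off at scale `R` tends to its integral. -/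
lemma tendsto_integral_cutoff (hφ : IsCutoff p φ) {f : Space n → ℝ} (hf : Integrable f volume) :
    Tendsto (fun R : ℝ => ∫ x, f x * φ (R⁻¹ • x)) atTop (𝓝 (∫ x, f x)) := by
  refine tendsto_integral_filter_of_dominated_convergence (fun x => ‖f x‖)
    (Eventually.of_forall fun R => ?_) (Eventually.of_forall fun R => ?_) hf.norm ?_
  · exact hf.aestronglyMeasurable.mul
      (hφ.contDiff.continuous.comp (continuous_const_smul _)).aestronglyMeasurable
  · refine Eventually.of_forall fun x => ?_
    rw [norm_mul, Real.norm_of_nonneg (hφ.nonneg _)]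
    exact mul_le_of_le_one_right (norm_nonneg _) (hφ.le_one _)
  · refine Eventually.of_forall fun x => tendsto_const_nhds.congr' ?_
    filter_upwards [eventually_ge_atTop ‖x‖, eventually_gt_atTop 0] with R hR hR0
    rw [hφ.eq_one _ (by rw [norm_inv_smul hR0, div_le_one hR0]; exact hR), mul_one]

end SpatialEstimates

end DampedWave
end

/-! ### Estimates in time and the basic inequality for global solutions. -/

noncomputable section

namespace DampedWave

open Filter Topology Set
open scoped ENNReal

variable {n : ℕ}

section TimeEstimates

lemma integral_rpow_le {p T : ℝ} (hp : 1 < p) (hT : 0 ≤ T) {h : ℝ → ℝ}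
    (hc : ContinuousOn h (Icc 0 T)) (h0 : ∀ t ∈ Icc 0 T, 0 ≤ h t) :
    ∫ t in (0 : ℝ)..T, h t ^ (1 / p) ≤ (∫ t in (0 : ℝ)..T, h t) ^ (1 / p) * T ^ (1 - 1 / p) := by
  have hp0 : 0 < p := by linarith
  have hpq := holderConjugate_inv hp
  set q := (1 - 1 / p)⁻¹ with hq
  set μ := (volume : Measure ℝ).restrict (Ioc 0 T) with hμ
  have hF0 : 0 ≤ᵐ[μ] fun t => h t ^ (1 / p) := by
    refine (ae_restrict_iff' measurableSet_Ioc).2 (Eventually.of_forall fun t ht => ?_)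
    exact Real.rpow_nonneg (h0 t (Ioc_subset_Icc_self ht)) _
  have hFp : (fun t => (h t ^ (1 / p)) ^ p) =ᵐ[μ] h := by
    refine (ae_restrict_iff' measurableSet_Ioc).2 (Eventually.of_forall fun t ht => ?_)
    simp only
    rw [← Real.rpow_mul (h0 t (Ioc_subset_Icc_self ht)), one_div_mul_cancel hp0.ne', Real.rpow_one]
  have hint : Integrable h μ := (hc.integrableOn_Icc).mono_set Ioc_subset_Icc_self
  have hFm : AEStronglyMeasurable (fun t => h t ^ (1 / p)) μ :=
    (hint.aestronglyMeasurable.aemeasurable.pow_const (1 / p)).aestronglyMeasurable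
  have hFL : MemLp (fun t => h t ^ (1 / p)) (ENNReal.ofReal p) μ := by
    rw [← integrable_norm_rpow_iff hFm (by simpa using hp0) ENNReal.ofReal_ne_top,
      ENNReal.toReal_ofReal hp0.le]
    refine hint.congr ?_
    filter_upwards [hFp, hF0] with x h1 h2
    rw [Real.norm_of_nonneg h2, h1]
  have key := integral_mul_le_Lp_mul_Lq_of_nonneg hpq hF0
    (Eventually.of_forall fun _ => zero_le_one : 0 ≤ᵐ[μ] fun _ => (1 : ℝ)) hFL
    (memLp_const (1 : ℝ))
  simp only [mul_one, Real.one_rpow] at key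
  rw [integral_congr_ae hFp, hq, one_div (1 - 1 / p)⁻¹, inv_inv, integral_const, smul_eq_mul,
    mul_one, measureReal_restrict_apply MeasurableSet.univ, univ_inter, Real.volume_real_Ioc,
    sub_zero, max_eq_left hT] at key
  rw [intervalIntegral.integral_of_le hT, intervalIntegral.integral_of_le hT]
  exact key

lemma one_sub_div_mem {T t : ℝ} (hT : 0 < T) (ht : t ∈ Icc 0 T) : 1 - t / T ∈ Icc (0 : ℝ) 1 :=
  ⟨sub_nonneg.2 ((div_le_one hT).2 ht.2), sub_le_self _ (div_nonneg ht.1 hT.le)⟩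

/-- The weight lies in `[0, 1]`, so `m/p ≤ k` allows its power `k` to be absorbed in the `1/p`-th
power of its power `m`; then Hölder in time applies. -/
lemma integral_cutoff_mul_rpow_le {p T : ℝ} (hp : 1 < p) (hT : 0 < T) {k m : ℕ}
    (hk : (m : ℝ) / p ≤ k) (hk0 : k ≠ 0) {h : ℝ → ℝ} (hc : ContinuousOn h (Icc 0 T))
    (h0 : ∀ t ∈ Icc 0 T, 0 ≤ h t) :
    ∫ t in (0 : ℝ)..T, (1 - t / T) ^ k * h t ^ (1 / p) ≤
      (∫ t in (0 : ℝ)..T, (1 - t / T) ^ m * h t) ^ (1 / p) * T ^ (1 - 1 / p) := by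
  have hp0 : 0 < p := by linarith
  have hη : Continuous fun t : ℝ => 1 - t / T := by fun_prop
  have hpc : ContinuousOn (fun t => h t ^ (1 / p)) (Icc 0 T) :=
    hc.rpow_const fun _ _ => Or.inr (by positivity)
  have hmc : ContinuousOn (fun t => (1 - t / T) ^ m * h t) (Icc 0 T) :=
    (hη.pow m).continuousOn.mul hc
  have hm0 : ∀ t ∈ Icc 0 T, 0 ≤ (1 - t / T) ^ m * h t := fun t ht =>
    mul_nonneg (pow_nonneg (one_sub_div_mem hT ht).1 _) (h0 t ht)
  refine le_trans ?_ (integral_rpow_le hp hT.le hmc hm0)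
  refine intervalIntegral.integral_mono_on hT.le
    (ContinuousOn.intervalIntegrable_of_Icc hT.le ((hη.pow k).continuousOn.mul hpc))
    (ContinuousOn.intervalIntegrable_of_Icc hT.le
      (hmc.rpow_const fun _ _ => Or.inr (by positivity))) fun t ht => ?_
  obtain ⟨h1, h2⟩ := one_sub_div_mem hT ht
  rw [Real.mul_rpow (pow_nonneg h1 _) (h0 t ht)]
  refine mul_le_mul_of_nonneg_right ?_ (Real.rpow_nonneg (h0 t ht) _)
  rw [← Real.rpow_natCast, ← Real.rpow_natCast, ← Real.rpow_mul h1]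
  refine Real.rpow_le_rpow_of_exponent_ge_of_imp h1 h2 (by rwa [mul_one_div]) ?_
  exact fun _ h => absurd (by exact_mod_cast h) hk0

lemma integral_one_sub_div_pow {T : ℝ} (hT : 0 < T) (k : ℕ) (s : ℝ) :
    ∫ t in s..T, (1 - t / T) ^ k = T / (k + 1) * (1 - s / T) ^ (k + 1) := by
  have hd : ∀ t ∈ uIcc s T, HasDerivAt (fun t => -(T / (k + 1)) * (1 - t / T) ^ (k + 1))
      ((1 - t / T) ^ k) t := by
    intro t _
    have h1 : HasDerivAt (fun t : ℝ => 1 - t / T) (-(1 / T)) t :=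
      ((hasDerivAt_id t).div_const T).const_sub 1
    refine ((h1.pow (k + 1)).const_mul (-(T / (k + 1)))).congr_deriv ?_
    have : (k + 1 : ℝ) ≠ 0 := by positivity
    push_cast
    field_simp
  rw [intervalIntegral.integral_eq_sub_of_hasDerivAt hd
    (Continuous.intervalIntegrable (by fun_prop) _ _), div_self hT.ne']
  simp

/-- The memory term bounds the integral of its density from below. -/
lemma le_integral_memory {γ T : ℝ} (hγ0 : 0 < γ) (hγ1 : γ < 1) (hT : 0 < T) (k : ℕ) {b : ℝ → ℝ}
    (hb : ContinuousOn b (Icc 0 T)) (hb0 : ∀ t ∈ Icc 0 T, 0 ≤ b t) :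
    T ^ (1 - γ) / (k + 1) * ∫ t in (0 : ℝ)..T, (1 - t / T) ^ (k + 1) * b t ≤
      ∫ τ in (0 : ℝ)..T, (1 - τ / T) ^ k * fracIntegral ((1 - γ) - 1) b τ := by
  have hβ : -1 < (1 - γ) - 1 := by linarith
  have hη : Continuous fun t : ℝ => (1 - t / T) ^ k := by fun_prop
  set b' := clamp T b with hb'
  have hbc : Continuous b' := continuous_clamp hT.le hb
  have hbb : ∀ t ∈ Icc 0 T, b' t = b t := fun t ht => clamp_eq ht
  have hprim : Continuous fun τ => ∫ s in (0 : ℝ)..τ, b' s :=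
    intervalIntegral.continuous_primitive (fun a c => hbc.intervalIntegrable a c) 0
  -- The memory kernel is at least `T^{-γ}`, since `τ - s ≤ T` and the exponent is negative.
  have h1 : ∀ τ ∈ Icc 0 T, T ^ (-γ) * ∫ s in (0 : ℝ)..τ, b' s ≤
      fracIntegral ((1 - γ) - 1) b τ := by
    intro τ hτ
    rw [← intervalIntegral.integral_const_mul, fracIntegral]
    have hbτ : ContinuousOn b (uIcc 0 τ) := by
      rw [uIcc_of_le hτ.1]; exact hb.mono (Icc_subset_Icc_right hτ.2)
    -- Only the open interval is used: at `s = τ` the power `0^{-γ}` is zero by convention and the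
    -- comparison may fail.
    refine intervalIntegral.integral_mono_on_of_le_Ioo hτ.1
      ((hbc.const_mul _).intervalIntegrable _ _)
      (intervalIntegrable_fracIntegrand hβ τ hbτ) fun s hs => ?_
    have hs' : s ∈ Icc 0 T := ⟨hs.1.le, hs.2.le.trans hτ.2⟩
    rw [hbb s hs', smul_eq_mul]
    refine mul_le_mul_of_nonneg_right ?_ (hb0 s hs')
    rw [show (1 - γ) - 1 = -γ by ring]
    exact Real.rpow_le_rpow_of_nonpos (by linarith [hs.2]) (by linarith [hs.1, hτ.2]) (by linarith)
  -- Exchanging the integrals and integrating the weight from `s` to `T` raises its exponent by one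
  -- and produces the factor `T/(k+1)`.
  have h2 : ∫ τ in (0 : ℝ)..T, (1 - τ / T) ^ k * (T ^ (-γ) * ∫ s in (0 : ℝ)..τ, b' s) =
      T ^ (1 - γ) / (k + 1) * ∫ t in (0 : ℝ)..T, (1 - t / T) ^ (k + 1) * b t := by
    have e1 : ∀ τ, (1 - τ / T) ^ k * (T ^ (-γ) * ∫ s in (0 : ℝ)..τ, b' s) =
        T ^ (-γ) * ∫ s in (0 : ℝ)..τ, (1 - τ / T) ^ k * b' s := by
      intro τ; rw [intervalIntegral.integral_const_mul]; ring
    simp only [e1]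
    rw [intervalIntegral.integral_const_mul, integral_triangle_swap
      (φ := fun τ s => (1 - τ / T) ^ k * b' s)
      ((hη.comp continuous_fst).mul (hbc.comp continuous_snd)) hT.le]
    have e2 : ∫ s in (0 : ℝ)..T, ∫ τ in s..T, (1 - τ / T) ^ k * b' s =
        ∫ s in (0 : ℝ)..T, T / (k + 1) * ((1 - s / T) ^ (k + 1) * b s) := by
      refine intervalIntegral.integral_congr fun s hs => ?_
      rw [uIcc_of_le hT.le] at hs
      rw [intervalIntegral.integral_mul_const, integral_one_sub_div_pow hT, hbb s hs]
      ring
    rw [e2, intervalIntegral.integral_const_mul, sub_eq_neg_add 1 γ, Real.rpow_add hT,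
      Real.rpow_one]
    ring
  rw [← h2]
  have hfc : ContinuousOn (fracIntegral ((1 - γ) - 1) b) (Icc 0 T) := continuousOn_fracIntegral hβ hb
  refine intervalIntegral.integral_mono_on hT.le
    ((hη.mul (hprim.const_mul _)).intervalIntegrable _ _)
    (ContinuousOn.intervalIntegrable_of_Icc hT.le (hη.continuousOn.mul hfc)) fun τ hτ => ?_
  exact mul_le_mul_of_nonneg_left (h1 τ hτ) (pow_nonneg (one_sub_div_mem hT hτ).1 _)

end TimeEstimates

section GlobalSolution

variable {γ p : ℝ} {u₀ u₁ : L2 n} {u : ℝ → L2 n}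

/-- A global solution of the integral equation, in the form used for nonexistence. -/
structure IsGlobalSolution (γ p : ℝ) (u₀ u₁ : L2 n) (u : ℝ → L2 n) : Prop where
  continuousOn : ContinuousOn u (Ici 0)
  continuousOn_absPow : ContinuousOn (fun t => absPow p (u t)) (Ici 0)
  memLp : ∀ t, 0 ≤ t → MemLp (fun x : Space n => |u t x| ^ p) 2 volume
  eq : ∀ t, 0 ≤ t → u t = linearPart u₀ u₁ t +
    duhamel (fun t => op (symK1 t)) (memoryTerm γ p u) t

lemma IsMildSolution.isGlobalSolution (hγ : γ < 1) (h : IsAdmissible n p)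
    (hu : IsMildSolution γ p u₀ u₁ ⊤ u) : IsGlobalSolution γ p u₀ u₁ u := by
  have hI : timeInterval ⊤ = Ici 0 := by
    ext t; exact ⟨fun h => h.1, fun h => ⟨h, EReal.coe_lt_top t⟩⟩
  obtain ⟨g, hg, hgu, heq⟩ := hu.memory_form hγ h
  have hmem := hu.memLp_absPow
  rw [hI] at hg hgu heq hmem
  refine ⟨?_, ?_, hmem, heq⟩
  · exact ((op symJ).continuous.comp_continuousOn hg).congr hgu
  · refine ((lipschitzOnBounded_nonlin h).continuous.comp_continuousOn hg).congr fun t ht => ?_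
    rw [hgu t ht]; rfl

namespace IsGlobalSolution

variable {φ : Space n → ℝ} {C R T : ℝ} {Φ L Ψ : L2 n}

/-- `∫₀ᵀ (1 - t/T)^k ⟨|u(t)|^p, Ψ⟩ dt`. -/
def weightedMass (p : ℝ) (u : ℝ → L2 n) (k : ℕ) (T : ℝ) (Ψ : L2 n) : ℝ :=
  ∫ t in (0 : ℝ)..T, (1 - t / T) ^ k * inner ℝ (absPow p (u t)) Ψ

lemma continuousOn_inner (h : IsGlobalSolution γ p u₀ u₁ u) (Ψ : L2 n) :
    ContinuousOn (fun t => inner ℝ (absPow p (u t)) Ψ) (Ici 0) :=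
  h.continuousOn_absPow.inner continuousOn_const

lemma inner_memoryTerm (hγ1 : γ < 1) (h : IsGlobalSolution γ p u₀ u₁ u) (Φ : L2 n) {τ : ℝ}
    (hτ : 0 ≤ τ) : inner ℝ (memoryTerm γ p u τ) Φ =
      fracIntegral ((1 - γ) - 1) (fun s => inner ℝ (absPow p (u s)) Φ) τ := by
  have hc : ContinuousOn (fun s => absPow p (u s)) (uIcc 0 τ) := by
    rw [uIcc_of_le hτ]; exact h.continuousOn_absPow.mono fun s hs => hs.1
  have hi := intervalIntegrable_fracIntegrand (β := (1 - γ) - 1) (by linarith) τ hc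
  have key := (innerSL ℝ Φ).intervalIntegral_comp_comm hi
  simp only [innerSL_apply_apply, inner_smul_right] at key
  rw [real_inner_comm, memoryTerm, fracIntegral, ← key, fracIntegral]
  refine intervalIntegral.integral_congr fun s _ => ?_
  simp only [smul_eq_mul]
  rw [real_inner_comm]

/-- The basic estimate of the test function method. -/
theorem weightedMass_le (hγ0 : 0 < γ) (hγ1 : γ < 1) (hp : 1 < p)
    (h : IsGlobalSolution γ p u₀ u₁ u) (hφ : IsCutoff p φ) (hC : 0 ≤ C)
    (hs : IsScaledCutoff p φ C R Φ L Ψ) (hR : 0 < R) {m : ℕ} (hm : ((m + 3 : ℕ) : ℝ) / p ≤ m)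
    (hT : 1 ≤ T) :
    T ^ (1 - γ) / (m + 3) * weightedMass p u (m + 3) T Φ +
        ((1 + (m + 2) / T) * inner ℝ u₀ Φ + inner ℝ u₁ Φ) ≤
      (volume.real (Metric.ball (0 : Space n) (2 * R)) * T) ^ (1 - 1 / p) *
        ((m + 2) ^ 2 / T * weightedMass p u (m + 3) T Φ ^ (1 / p) +
          C * (R ^ 2)⁻¹ * weightedMass p u (m + 3) T Ψ ^ (1 / p)) := by
  have hT0 : 0 < T := by linarith
  have hp0 : 0 < p := by linarith
  have hq0 : 0 ≤ 1 - 1 / p := by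
    rw [sub_nonneg, div_le_one hp0]; exact hp.le
  have hm0 : m ≠ 0 := by
    rintro rfl
    have : (0 : ℝ) < ((0 + 3 : ℕ) : ℝ) / p := by positivity
    simp only [Nat.cast_zero] at hm
    linarith
  have hsub : Icc 0 T ⊆ Ici (0 : ℝ) := fun t ht => ht.1
  set V := volume.real (Metric.ball (0 : Space n) (2 * R)) with hV
  have hV0 : 0 ≤ V := measureReal_nonneg
  set b : ℝ → ℝ := fun t => inner ℝ (absPow p (u t)) Φ with hb
  set e : ℝ → ℝ := fun t => inner ℝ (absPow p (u t)) Ψ with he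
  have hbc : ContinuousOn b (Icc 0 T) := (h.continuousOn_inner Φ).mono hsub
  have hec : ContinuousOn e (Icc 0 T) := (h.continuousOn_inner Ψ).mono hsub
  have hb0 : ∀ t ∈ Icc 0 T, 0 ≤ b t := fun t ht =>
    inner_nonneg_of_ae (absPow_nonneg (h.memLp t ht.1)) (hs.nonneg hφ)
  have he0 : ∀ t ∈ Icc 0 T, 0 ≤ e t := fun t ht =>
    inner_nonneg_of_ae (absPow_nonneg (h.memLp t ht.1)) (hs.outer_nonneg hφ)
  -- Exponent `m + 2` makes `ψ` and `ψ'` vanish at `T`. The memory raises it to `m + 3`, while `ψ''`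
  -- lowers it to `m`; `hm` says that this loss is still absorbed by the Hölder exponent.
  set ψ : ℝ → ℝ := fun t => (1 - t / T) ^ (m + 2) with hψ
  set ψ' : ℝ → ℝ := fun t => -((m + 2) / T) * (1 - t / T) ^ (m + 1) with hψ'
  set ψ'' : ℝ → ℝ := fun t => (m + 2) * (m + 1) / T ^ 2 * (1 - t / T) ^ m with hψ''
  have hη : ∀ t, HasDerivAt (fun t : ℝ => 1 - t / T) (-(1 / T)) t := fun t =>
    ((hasDerivAt_id t).div_const T).const_sub 1
  have hd1 : ∀ t, HasDerivAt ψ (ψ' t) t := fun t => by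
    refine ((hη t).pow (m + 2)).congr_deriv ?_
    simp only [hψ', Nat.add_succ_sub_one]
    push_cast; ring
  have hd2 : ∀ t, HasDerivAt ψ' (ψ'' t) t := fun t => by
    refine (((hη t).pow (m + 1)).const_mul (-((m + 2) / T))).congr_deriv ?_
    simp only [hψ'', Nat.add_sub_cancel]
    push_cast; field_simp
  have hψ''c : Continuous ψ'' := by rw [hψ'']; fun_prop
  have hψT : ψ T = 0 := by simp [hψ, hT0.ne']
  have hψT' : ψ' T = 0 := by simp [hψ', hT0.ne']
  have hmem : ContinuousOn (memoryTerm γ p u) (Icc 0 T) :=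
    continuousOn_fracIntegral (by linarith) (h.continuousOn_absPow.mono hsub)
  have weak := integral_inner_adjointTest hs.hasLaplacian hd1 hd2 hψ''c hT0.le hψT hψT' hmem
    (u₀ := u₀) (u₁ := u₁) fun t ht => h.eq t ht.1
  have hψ0 : ψ 0 = 1 := by simp [hψ]
  have hψ0' : ψ' 0 = -((m + 2) / T) := by simp [hψ']
  have hlow : T ^ (1 - γ) / (m + 3) * weightedMass p u (m + 3) T Φ ≤
      ∫ τ in (0 : ℝ)..T, ψ τ * inner ℝ (memoryTerm γ p u τ) Φ := by
    have := le_integral_memory hγ0 hγ1 hT0 (m + 2) hbc hb0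
    rw [intervalIntegral.integral_congr (g := fun τ => (1 - τ / T) ^ (m + 2) *
      fracIntegral ((1 - γ) - 1) b τ)]
    · refine le_trans (le_of_eq ?_) this
      rw [weightedMass, show ((m + 2 : ℕ) : ℝ) + 1 = m + 3 by push_cast; ring]
    · intro τ hτ
      rw [uIcc_of_le hT0.le] at hτ
      simp only [hψ]
      rw [inner_memoryTerm hγ1 h Φ hτ.1]
  have hbp : ContinuousOn (fun t => b t ^ (1 / p)) (Icc 0 T) :=
    hbc.rpow_const fun _ _ => Or.inr (by positivity)
  have hep : ContinuousOn (fun t => e t ^ (1 / p)) (Icc 0 T) :=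
    hec.rpow_const fun _ _ => Or.inr (by positivity)
  have hηc : Continuous fun t : ℝ => 1 - t / T := by fun_prop
  have hQc : ContinuousOn (fun t => inner ℝ (u t) (adjointTest Φ L ψ ψ' ψ'' t)) (Icc 0 T) := by
    have : Continuous (adjointTest Φ L ψ ψ' ψ'') := by
      simp only [hψ, hψ', hψ'']; unfold adjointTest; fun_prop
    exact (h.continuousOn.mono hsub).inner this.continuousOn
  have hupc1 : ContinuousOn (fun t => (1 - t / T) ^ m * b t ^ (1 / p)) (Icc 0 T) :=
    (hηc.pow m).continuousOn.mul hbp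
  have hupc2 : ContinuousOn (fun t => (1 - t / T) ^ (m + 2) * e t ^ (1 / p)) (Icc 0 T) :=
    (hηc.pow (m + 2)).continuousOn.mul hep
  have hup : ∫ t in (0 : ℝ)..T, inner ℝ (u t) (adjointTest Φ L ψ ψ' ψ'' t) ≤
      V ^ (1 - 1 / p) * ((m + 2) ^ 2 / T * ∫ t in (0 : ℝ)..T, (1 - t / T) ^ m * b t ^ (1 / p)) +
      V ^ (1 - 1 / p) * (C * (R ^ 2)⁻¹ *
        ∫ t in (0 : ℝ)..T, (1 - t / T) ^ (m + 2) * e t ^ (1 / p)) := by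
    have hi1 := ContinuousOn.intervalIntegrable_of_Icc (μ := volume) hT0.le hupc1
    have hi2 := ContinuousOn.intervalIntegrable_of_Icc (μ := volume) hT0.le hupc2
    rw [← intervalIntegral.integral_const_mul, ← intervalIntegral.integral_const_mul,
      ← intervalIntegral.integral_const_mul, ← intervalIntegral.integral_const_mul,
      ← intervalIntegral.integral_add ((hi1.const_mul _).const_mul _)
        ((hi2.const_mul _).const_mul _)]
    refine intervalIntegral.integral_mono_on hT0.le
      (ContinuousOn.intervalIntegrable_of_Icc hT0.le hQc)
      (((hi1.const_mul _).const_mul _).add ((hi2.const_mul _).const_mul _)) fun t ht => ?_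
    obtain ⟨h1, h2⟩ := one_sub_div_mem hT0 ht
    have hbt := abs_inner_le_rpow hp (h.memLp t ht.1) (hs.nonneg hφ) (hs.le_rpow hφ hp)
      (hs.eq_zero hφ hR) zero_le_one
    have het := abs_inner_le_rpow hp (h.memLp t ht.1) (hs.outer_nonneg hφ) hs.laplacian_le
      (hs.laplacian_eq_zero hφ hp hR) (by positivity)
    rw [one_mul] at hbt
    -- Here `T ≥ 1` is used to replace `T⁻²` by `T⁻¹`, and `(m+2)² = (m+2)(m+1) + (m+2)` adds the
    -- two contributions.
    have hcoef : |ψ'' t - ψ' t| ≤ (m + 2) ^ 2 / T * (1 - t / T) ^ m := by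
      have a1 : 0 ≤ ψ'' t - ψ' t := by
        simp only [hψ', hψ'']
        have : 0 ≤ (m + 2) * (m + 1) / T ^ 2 * (1 - t / T) ^ m +
          (m + 2) / T * (1 - t / T) ^ (m + 1) := by positivity
        linarith
      rw [abs_of_nonneg a1]
      simp only [hψ', hψ'']
      have a2 : (m + 2 : ℝ) * (m + 1) / T ^ 2 ≤ (m + 2) * (m + 1) / T := by
        refine div_le_div_of_nonneg_left (by positivity) hT0 ?_
        nlinarith
      have a3 : (1 - t / T) ^ (m + 1) ≤ (1 - t / T) ^ m := pow_le_pow_of_le_one h1 h2 (by omega)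
      have a4 : (m + 2 : ℝ) * (m + 1) / T ^ 2 * (1 - t / T) ^ m ≤
          (m + 2) * (m + 1) / T * (1 - t / T) ^ m :=
        mul_le_mul_of_nonneg_right a2 (pow_nonneg h1 _)
      have a5 : (m + 2 : ℝ) / T * (1 - t / T) ^ (m + 1) ≤ (m + 2) / T * (1 - t / T) ^ m :=
        mul_le_mul_of_nonneg_left a3 (by positivity)
      have a6 : ((m : ℝ) + 2) ^ 2 / T * (1 - t / T) ^ m =
          (m + 2) * (m + 1) / T * (1 - t / T) ^ m + (m + 2) / T * (1 - t / T) ^ m := by ring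
      rw [a6]; linarith
    have hψt : 0 ≤ ψ t := pow_nonneg h1 _
    rw [adjointTest, inner_sub_right, inner_smul_right, inner_smul_right]
    calc (ψ'' t - ψ' t) * inner ℝ (u t) Φ - ψ t * inner ℝ (u t) L
        ≤ |ψ'' t - ψ' t| * |inner ℝ (u t) Φ| + ψ t * |inner ℝ (u t) L| := by
          have b1 := le_abs_self ((ψ'' t - ψ' t) * inner ℝ (u t) Φ)
          rw [abs_mul] at b1
          have b2 := mul_le_mul_of_nonneg_left (neg_abs_le (inner ℝ (u t) L)) hψt
          linarith
      _ ≤ (m + 2) ^ 2 / T * (1 - t / T) ^ m * (b t ^ (1 / p) * V ^ (1 - 1 / p)) +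
          (1 - t / T) ^ (m + 2) * (C * (R ^ 2)⁻¹ * e t ^ (1 / p) * V ^ (1 - 1 / p)) := by
          refine add_le_add (mul_le_mul hcoef hbt (abs_nonneg _) (by positivity)) ?_
          exact mul_le_mul_of_nonneg_left het hψt
      _ = _ := by ring
  have hX := integral_cutoff_mul_rpow_le hp hT0 hm hm0 hbc hb0
  have hXt := integral_cutoff_mul_rpow_le hp hT0 (k := m + 2) (m := m + 3)
    (hm.trans (by push_cast; linarith)) (by omega) hec he0
  rw [weak, hψ0, hψ0'] at hup
  rw [Real.mul_rpow hV0 hT0.le]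
  have hVq : 0 ≤ V ^ (1 - 1 / p) := Real.rpow_nonneg hV0 _
  have f1 := mul_le_mul_of_nonneg_left (mul_le_mul_of_nonneg_left hX
    (by positivity : 0 ≤ ((m : ℝ) + 2) ^ 2 / T)) hVq
  have f2 := mul_le_mul_of_nonneg_left (mul_le_mul_of_nonneg_left hXt
    (by positivity : 0 ≤ C * (R ^ 2)⁻¹)) hVq
  have f3 : V ^ (1 - 1 / p) * T ^ (1 - 1 / p) *
      ((m + 2) ^ 2 / T * weightedMass p u (m + 3) T Φ ^ (1 / p) +
          C * (R ^ 2)⁻¹ * weightedMass p u (m + 3) T Ψ ^ (1 / p)) =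
      V ^ (1 - 1 / p) * ((m + 2) ^ 2 / T *
        (weightedMass p u (m + 3) T Φ ^ (1 / p) * T ^ (1 - 1 / p))) +
      V ^ (1 - 1 / p) * (C * (R ^ 2)⁻¹ *
        (weightedMass p u (m + 3) T Ψ ^ (1 / p) * T ^ (1 - 1 / p))) := by ring
  rw [f3]
  simp only [weightedMass] at hlow ⊢
  simp only [hb, he] at hup f1 f2
  linarith

end IsGlobalSolution

end GlobalSolution

end DampedWave
end

/-! ### A scaling argument forcing the total mass to vanish. -/

noncomputable section

namespace DampedWave

open Filter Topology Set
open scoped ENNReal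

variable {n : ℕ}

section Vanishing

/-- `∫₀ᵀ (1 - t/T)^k f(t) dt`. -/
def weightedIntegral (k : ℕ) (T : ℝ) (f : ℝ → ℝ) : ℝ := ∫ t in (0 : ℝ)..T, (1 - t / T) ^ k * f t

variable {k : ℕ} {S T : ℝ} {f g : ℝ → ℝ}

lemma intervalIntegrable_weighted (hT : 0 ≤ T) (hf : ContinuousOn f (Ici 0)) :
    IntervalIntegrable (fun t => (1 - t / T) ^ k * f t) volume 0 T := by
  refine ContinuousOn.intervalIntegrable_of_Icc hT (ContinuousOn.mul ?_
    (hf.mono Icc_subset_Ici_self))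
  exact Continuous.continuousOn (by fun_prop)

lemma weightedIntegral_nonneg (hT : 0 < T) (hf0 : ∀ t, 0 ≤ t → 0 ≤ f t) :
    0 ≤ weightedIntegral k T f :=
  intervalIntegral.integral_nonneg hT.le fun t ht =>
    mul_nonneg (pow_nonneg (one_sub_div_mem hT ht).1 _) (hf0 t ht.1)

lemma weightedIntegral_le_integral (hT : 0 < T) (hf : ContinuousOn f (Ici 0))
    (hf0 : ∀ t, 0 ≤ t → 0 ≤ f t) : weightedIntegral k T f ≤ ∫ t in (0 : ℝ)..T, f t := by
  refine intervalIntegral.integral_mono_on hT.le (intervalIntegrable_weighted hT.le hf)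
    (ContinuousOn.intervalIntegrable_of_Icc hT.le (hf.mono Icc_subset_Ici_self)) fun t ht => ?_
  obtain ⟨h1, h2⟩ := one_sub_div_mem hT ht
  exact mul_le_of_le_one_left (hf0 t ht.1) (pow_le_one₀ h1 h2)

/-- On `[0, S]` the weight is at least its value at `S`, which tends to one as `T → ∞`; this
recovers unweighted integrals from weighted ones. -/
lemma mul_integral_le_weightedIntegral (hS : 0 ≤ S) (hST : S ≤ T) (hT : 0 < T)
    (hf : ContinuousOn f (Ici 0)) (hf0 : ∀ t, 0 ≤ t → 0 ≤ f t) :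
    (1 - S / T) ^ k * ∫ t in (0 : ℝ)..S, f t ≤ weightedIntegral k T f := by
  have hi := intervalIntegrable_weighted (k := k) hT.le hf
  have h0 : 0 ≤ᵐ[volume.restrict (Ioc 0 T)] fun t => (1 - t / T) ^ k * f t :=
    (ae_restrict_iff' measurableSet_Ioc).2 (Eventually.of_forall fun t ht =>
      mul_nonneg (pow_nonneg (one_sub_div_mem hT (Ioc_subset_Icc_self ht)).1 _) (hf0 t ht.1.le))
  refine le_trans ?_ (intervalIntegral.integral_mono_interval le_rfl hS hST h0 hi)
  rw [← intervalIntegral.integral_const_mul]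
  refine intervalIntegral.integral_mono_on hS
    ((ContinuousOn.intervalIntegrable_of_Icc hS (hf.mono Icc_subset_Ici_self)).const_mul _)
    (hi.mono_set (by rw [uIcc_of_le hS, uIcc_of_le hT.le]; exact Icc_subset_Icc_right hST))
    fun t ht => ?_
  refine mul_le_mul_of_nonneg_right (pow_le_pow_left₀ ?_ ?_ k) (hf0 t ht.1)
  · exact (one_sub_div_mem hT ⟨hS, hST⟩).1
  · have := div_le_div_of_nonneg_right ht.2 hT.le
    linarith

lemma weightedIntegral_add_le {h : ℝ → ℝ} (hT : 0 < T) (hf : ContinuousOn f (Ici 0))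
    (hg : ContinuousOn g (Ici 0)) (hh : ContinuousOn h (Ici 0))
    (hfg : ∀ t, 0 ≤ t → f t + g t ≤ h t) :
    weightedIntegral k T f + weightedIntegral k T g ≤ weightedIntegral k T h := by
  have hif := intervalIntegrable_weighted (k := k) hT.le hf
  have hig := intervalIntegrable_weighted (k := k) hT.le hg
  rw [weightedIntegral, weightedIntegral, ← intervalIntegral.integral_add hif hig]
  refine intervalIntegral.integral_mono_on hT.le (hif.add hig)
    (intervalIntegrable_weighted hT.le hh) fun t ht => ?_
  rw [← mul_add]
  exact mul_le_mul_of_nonneg_left (hfg t ht.1) (pow_nonneg (one_sub_div_mem hT ht).1 _)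

lemma le_rpow_of_le_mul_rpow {p X K : ℝ} (hp : 1 < p) (hX : 0 ≤ X) (hK : 0 ≤ K)
    (h : X ≤ K * X ^ (1 / p)) : X ≤ K ^ (1 - 1 / p)⁻¹ := by
  have hq : 0 < 1 - 1 / p := by
    rw [sub_pos, div_lt_one (by linarith)]; exact hp
  rcases hX.eq_or_lt with rfl | hX
  · positivity
  · have h1 : X ^ (1 - 1 / p) ≤ K := by
      rw [Real.rpow_sub hX, Real.rpow_one, div_le_iff₀ (by positivity)]
      exact h
    calc X = (X ^ (1 - 1 / p)) ^ (1 - 1 / p)⁻¹ := by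
          rw [← Real.rpow_mul hX.le, mul_inv_cancel₀ hq.ne', Real.rpow_one]
      _ ≤ _ := Real.rpow_le_rpow (by positivity) h1 (by positivity)

/-- A nonnegative quantity, given through its truncations `b R`, vanishes if its weighted integrals
obey a nonlinear estimate with a small constant, up to a contribution `e R` of large radii. -/
theorem eq_zero_of_weightedIntegral_le {p K : ℝ} (hp : 1 < p) (hK : 0 ≤ K) {b e : ℝ → ℝ → ℝ}
    {β : ℝ → ℝ} (hβ0 : ∀ B, 1 ≤ B → 0 ≤ β B) (hβ : Tendsto β atTop (𝓝 0))
    (hb : ∀ R, 0 < R → ContinuousOn (b R) (Ici 0)) (he : ∀ R, 0 < R → ContinuousOn (e R) (Ici 0))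
    (hb0 : ∀ R, 0 < R → ∀ t, 0 ≤ t → 0 ≤ b R t) (he0 : ∀ R, 0 < R → ∀ t, 0 ≤ t → 0 ≤ e R t)
    (hadd : ∀ r R, 0 < r → 2 * r ≤ R → ∀ t, 0 ≤ t → e R t + b r t ≤ b R t)
    (hkey : ∀ B, 1 ≤ B → ∀ᶠ R in atTop, weightedIntegral k ((B * R) ^ 2) (b R) ≤
      K * β B * (weightedIntegral k ((B * R) ^ 2) (b R) ^ (1 / p) +
        B ^ 2 * weightedIntegral k ((B * R) ^ 2) (e R) ^ (1 / p))) {r : ℝ} (hr : 0 < r) :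
    b r 0 = 0 := by
  have hp0 : 0 < p := by linarith
  have hip : 0 < 1 / p := by positivity
  -- All masses over bounded ranges of space and time; the supremum plays the role of the total
  -- space-time mass.
  set 𝒜 : Set ℝ := {a | ∃ r S, 0 < r ∧ 0 ≤ S ∧ a = ∫ t in (0 : ℝ)..S, b r t} with h𝒜
  have hne : 𝒜.Nonempty := ⟨_, r, 0, hr, le_rfl, rfl⟩
  have hTlim : ∀ B : ℝ, 1 ≤ B → Tendsto (fun R : ℝ => (B * R) ^ 2) atTop atTop := fun B hB =>
    (tendsto_pow_atTop two_ne_zero).comp (tendsto_id.const_mul_atTop (by linarith))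
  have hwlim : ∀ B : ℝ, 1 ≤ B → ∀ S : ℝ,
      Tendsto (fun R : ℝ => (1 - S / (B * R) ^ 2) ^ k) atTop (𝓝 1) := fun B hB S => by
    have := ((tendsto_const_nhds (x := S)).div_atTop (hTlim B hB)).const_sub 1
    simpa using this.pow k
  have hsum : ∀ r R T, 0 < r → 2 * r ≤ R → 0 < T →
      weightedIntegral k T (e R) + weightedIntegral k T (b r) ≤ weightedIntegral k T (b R) :=
    fun r R T hr hrR hT => weightedIntegral_add_le hT (he R (by linarith)) (hb r hr)
      (hb R (by linarith)) (hadd r R hr hrR)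
  have hbdd : BddAbove 𝒜 := by
    -- With `B = 1` and the outer mass bounded by the total, `X ≤ 2 K β(1) X^{1/p}` bounds `X`. The
    -- leading `2` comes from taking `T` so large that the weight is at least `1/2` up to time `S`.
    refine ⟨2 * (K * β 1 * 2) ^ (1 - 1 / p)⁻¹, ?_⟩
    rintro a ⟨r, S, hr, hS, rfl⟩
    have hA : 0 ≤ ∫ t in (0 : ℝ)..S, b r t :=
      intervalIntegral.integral_nonneg hS fun t ht => hb0 r hr t ht.1
    obtain ⟨R, h1, h2, h3, h4, h5⟩ := ((hkey 1 le_rfl).and ((eventually_ge_atTop (2 * r)).and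
      (((hwlim 1 le_rfl S).eventually (lt_mem_nhds one_half_lt_one)).and
      (((hTlim 1 le_rfl).eventually_ge_atTop S).and
      ((hTlim 1 le_rfl).eventually_gt_atTop 0))))).exists
    have hR : 0 < R := by linarith
    set T := (1 * R) ^ 2
    have hX := weightedIntegral_nonneg (k := k) h5 (hb0 R hR)
    have hE := weightedIntegral_nonneg (k := k) h5 (he0 R hR)
    have hr0 := weightedIntegral_nonneg (k := k) h5 (hb0 r hr)
    have h6 := hsum r R T hr h2 h5
    have h7 : weightedIntegral k T (e R) ^ (1 / p) ≤ weightedIntegral k T (b R) ^ (1 / p) :=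
      Real.rpow_le_rpow hE (by linarith) hip.le
    have hKβ : 0 ≤ K * β 1 := mul_nonneg hK (hβ0 1 le_rfl)
    have h8 : weightedIntegral k T (b R) ≤ K * β 1 * 2 * weightedIntegral k T (b R) ^ (1 / p) := by
      refine h1.trans ?_
      rw [mul_assoc (K * β 1)]
      refine mul_le_mul_of_nonneg_left ?_ hKβ
      linarith
    have h9 := le_rpow_of_le_mul_rpow hp hX (by positivity) h8
    have h10 := mul_integral_le_weightedIntegral (k := k) hS h4 h5 (hb r hr) (hb0 r hr)
    have h11 := mul_le_mul_of_nonneg_right h3.le hA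
    linarith
  set I := sSup 𝒜 with hI
  have hI0 : 0 ≤ I := by
    refine le_csSup hbdd ⟨r, 0, hr, le_rfl, ?_⟩
    simp
  -- Some bounded range carries mass above `I - ε`. For large `R` its weighted mass exceeds `I -
  -- 2ε`, so the outer mass is at most `2ε`.
  have hstep : ∀ B, 1 ≤ B → ∀ ε, 0 < ε →
      I - 2 * ε ≤ K * β B * (I ^ (1 / p) + B ^ 2 * (2 * ε) ^ (1 / p)) := by
    intro B hB ε hε
    obtain ⟨a, ⟨r, S, hr, hS, rfl⟩, ha⟩ := exists_lt_of_lt_csSup hne (sub_lt_self I hε)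
    have hwA := (hwlim B hB S).mul_const (∫ t in (0 : ℝ)..S, b r t)
    rw [one_mul] at hwA
    obtain ⟨R, h1, h2, h3, h4, h5⟩ := ((hkey B hB).and ((eventually_ge_atTop (2 * r)).and
      ((hwA.eventually (lt_mem_nhds (sub_lt_self _ hε))).and
      (((hTlim B hB).eventually_ge_atTop S).and
      ((hTlim B hB).eventually_gt_atTop 0))))).exists
    have hR : 0 < R := by linarith
    set T := (B * R) ^ 2
    have hX := weightedIntegral_nonneg (k := k) h5 (hb0 R hR)
    have hE := weightedIntegral_nonneg (k := k) h5 (he0 R hR)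
    have h6 := hsum r R T hr h2 h5
    have h7 := mul_integral_le_weightedIntegral (k := k) hS h4 h5 (hb r hr) (hb0 r hr)
    have h8 : weightedIntegral k T (b R) ≤ I :=
      (weightedIntegral_le_integral h5 (hb R hR) (hb0 R hR)).trans
        (le_csSup hbdd ⟨R, T, hR, h5.le, rfl⟩)
    have h9 : weightedIntegral k T (b R) ^ (1 / p) ≤ I ^ (1 / p) :=
      Real.rpow_le_rpow hX h8 hip.le
    have h10 : weightedIntegral k T (e R) ^ (1 / p) ≤ (2 * ε) ^ (1 / p) :=
      Real.rpow_le_rpow hE (by linarith) hip.le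
    have hKβ : 0 ≤ K * β B := mul_nonneg hK (hβ0 B hB)
    calc I - 2 * ε ≤ weightedIntegral k T (b R) := by linarith
      _ ≤ _ := h1
      _ ≤ _ := by gcongr
  -- The limit `ε → 0` is taken with `B` fixed, so the factor `B²` is harmless; only afterwards does
  -- `B` tend to infinity.
  have hstep' : ∀ B, 1 ≤ B → I ≤ K * β B * I ^ (1 / p) := by
    intro B hB
    have l1 : Tendsto (fun ε : ℝ => I - 2 * ε) (𝓝[>] 0) (𝓝 (I - 2 * 0)) :=
      ((continuous_const.sub (continuous_const.mul continuous_id)).tendsto 0).mono_left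
        nhdsWithin_le_nhds
    have hrc : Continuous fun ε : ℝ => (2 * ε) ^ (1 / p) :=
      (continuous_const.mul continuous_id).rpow_const fun _ => Or.inr hip.le
    have l2 : Tendsto (fun ε : ℝ => K * β B * (I ^ (1 / p) + B ^ 2 * (2 * ε) ^ (1 / p)))
        (𝓝[>] 0) (𝓝 (K * β B * (I ^ (1 / p) + B ^ 2 * (2 * 0) ^ (1 / p)))) :=
      ((continuous_const.mul (continuous_const.add (continuous_const.mul hrc))).tendsto 0).mono_left
        nhdsWithin_le_nhds
    have := le_of_tendsto_of_tendsto l1 l2 (by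
      filter_upwards [self_mem_nhdsWithin] with ε hε using hstep B hB ε hε)
    simpa [Real.zero_rpow (inv_pos.2 hp0).ne'] using this
  have hIle : I ≤ 0 := by
    have l : Tendsto (fun B => K * β B * I ^ (1 / p)) atTop (𝓝 (K * 0 * I ^ (1 / p))) :=
      (hβ.const_mul K).mul_const _
    rw [mul_zero, zero_mul] at l
    refine ge_of_tendsto l ?_
    filter_upwards [eventually_ge_atTop 1] with B hB using hstep' B hB
  by_contra hne0
  have hpos : 0 < b r 0 := lt_of_le_of_ne (hb0 r hr 0 le_rfl) (Ne.symm hne0)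
  have h1 : 0 < ∫ t in (0 : ℝ)..1, b r t := intervalIntegral.integral_pos one_pos
    ((hb r hr).mono Icc_subset_Ici_self) (fun t ht => hb0 r hr t ht.1.le)
    ⟨0, ⟨le_rfl, zero_le_one⟩, hpos⟩
  have h2 : ∫ t in (0 : ℝ)..1, b r t ≤ I := le_csSup hbdd ⟨r, 1, hr, zero_le_one, rfl⟩
  linarith

end Vanishing

end DampedWave
end

/-! ### Nonexistence of global solutions and the conclusion. -/

noncomputable section

namespace DampedWave

open Filter Topology Set
open scoped ENNReal

variable {n : ℕ}

section Nonexistence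

variable {γ p : ℝ} {u₀ u₁ : L2 n} {u : ℝ → L2 n}

/-- The exponent condition of `p ≤ p_γ`, cleared of denominators. -/
lemma mul_le_of_le_pGamma (h : (p : EReal) ≤ pGamma n γ) (hp : 0 ≤ p) :
    p * ((n : ℝ) - 2 + 2 * γ) ≤ n + 2 := by
  rw [pGamma] at h
  split_ifs at h with hpos
  · have h' := EReal.coe_le_coe_iff.1 h
    have : (1 + 2 * (2 - γ) / ((n : ℝ) - 2 + 2 * γ)) * ((n : ℝ) - 2 + 2 * γ) = n + 2 := by
      field_simp; ring
    rw [← this]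
    exact mul_le_mul_of_nonneg_right h' hpos.le
  · have h1 : p * ((n : ℝ) - 2 + 2 * γ) ≤ 0 := mul_nonpos_of_nonneg_of_nonpos hp (not_lt.1 hpos)
    linarith [(Nat.cast_nonneg n : (0 : ℝ) ≤ n)]

/-- With `W = BR` one has `c Rⁿ (BR)² = c B^{-n} W^{n+2}`. The remaining power of `W` is `(n+2)q - 2
+ 2(γ-1) ≤ 0`, and `W ≥ 1`. -/
lemma rpow_scaling_le {q c B R : ℝ} (hc : 0 ≤ c) (hB : 0 < B) (hBR : 1 ≤ B * R)
    (hR : 0 < R) (hq : (n + 2) * q ≤ 2 * (2 - γ)) :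
    (c * R ^ n * (B * R) ^ 2) ^ q * ((B * R) ^ 2)⁻¹ * ((B * R) ^ 2) ^ (γ - 1) ≤
      c ^ q * ((B ^ n)⁻¹) ^ q := by
  have hW : 0 < B * R := by positivity
  have e1 : c * R ^ n * (B * R) ^ 2 = c * (B ^ n)⁻¹ * (B * R) ^ (n + 2) := by
    have : B ^ n ≠ 0 := by positivity
    rw [pow_add, mul_pow B R n]; field_simp
  have e2 : ((B * R) ^ (n + 2)) ^ q = (B * R) ^ ((n + 2) * q) := by
    rw [← Real.rpow_natCast, ← Real.rpow_mul hW.le]; push_cast; rfl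
  have e3 : ((B * R) ^ 2)⁻¹ = (B * R) ^ (-2 : ℝ) := by
    rw [Real.rpow_neg hW.le, ← Real.rpow_natCast]; norm_num
  have e4 : ((B * R) ^ 2) ^ (γ - 1) = (B * R) ^ (2 * (γ - 1)) := by
    rw [← Real.rpow_natCast, ← Real.rpow_mul hW.le]; norm_num
  rw [e1, Real.mul_rpow (by positivity) (by positivity), Real.mul_rpow hc (by positivity), e2, e3,
    e4, mul_assoc, mul_assoc, ← Real.rpow_add hW, ← Real.rpow_add hW]
  refine mul_le_of_le_one_right (by positivity) ?_
  exact Real.rpow_le_one_of_one_le_of_nonpos hBR (by linarith)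

lemma IsCutoff.eventually_inner_pos {φ : Space n → ℝ} (hφ : IsCutoff p φ) {v : L2 n}
    (hv : 0 < ∫ x, v x) : ∀ᶠ R : ℝ in atTop, ∀ Φ : L2 n,
      Φ =ᵐ[volume] (fun x => φ (R⁻¹ • x)) → 0 < inner ℝ v Φ := by
  have hint : Integrable v volume := by
    -- A nonintegrable function has integral zero by convention, so positivity of the integral
    -- implies integrability.
    by_contra h
    rw [integral_undef h] at hv
    exact lt_irrefl _ hv
  filter_upwards [(tendsto_integral_cutoff hφ hint).eventually (lt_mem_nhds hv)] with R hR Φ hΦ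
  rw [inner_eq_integral]
  refine hR.trans_le (le_of_eq (integral_congr_ae ?_))
  filter_upwards [hΦ] with x e
  rw [e]

/-- There is no global solution below the critical exponent. -/
theorem not_isGlobalSolution (hn : 1 ≤ n) (hγ0 : 0 < γ) (hγ1 : γ < 1) (hp : 1 < p)
    (hpγ : p * ((n : ℝ) - 2 + 2 * γ) ≤ n + 2) (hpos₀ : 0 < ∫ x, u₀ x) (hpos₁ : 0 < ∫ x, u₁ x) :
    ¬ IsGlobalSolution γ p u₀ u₁ u := by
  intro h
  have hp0 : 0 < p := by linarith
  obtain ⟨φ, hφ⟩ := exists_isCutoff n hp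
  obtain ⟨C, hC, hsc⟩ := hφ.exists_scaled hp
  choose! Φ L Ψ hs using hsc
  -- This is the condition `(m + 3)/p ≤ m` solved for `m`.
  obtain ⟨m, hm⟩ := exists_nat_ge (3 / (p - 1))
  have hm' : ((m + 3 : ℕ) : ℝ) / p ≤ m := by
    rw [div_le_iff₀ (by linarith)] at hm
    rw [div_le_iff₀ hp0]
    push_cast; linarith
  set q := 1 - 1 / p with hq
  have hq0 : 0 < q := by rw [hq, sub_pos, div_lt_one hp0]; exact hp
  have hqle : (n + 2) * q ≤ 2 * (2 - γ) := by
    have : (n + 2) * q = (n + 2) * (p - 1) / p := by rw [hq]; field_simp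
    rw [this, div_le_iff₀ hp0]
    linarith
  set c := 2 ^ n * volume.real (Metric.ball (0 : Space n) 1) with hc
  have hc0 : 0 ≤ c := mul_nonneg (by positivity) measureReal_nonneg
  set K := (m + 3) * c ^ q * ((m + 2) ^ 2 + C) with hK
  have hK0 : 0 ≤ K := by positivity
  set b : ℝ → ℝ → ℝ := fun R t => inner ℝ (absPow p (u t)) (Φ R) with hb
  set e : ℝ → ℝ → ℝ := fun R t => inner ℝ (absPow p (u t)) (Ψ R) with he
  have hb0 : ∀ R, 0 < R → ∀ t, 0 ≤ t → 0 ≤ b R t := fun R hR t ht =>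
    inner_nonneg_of_ae (absPow_nonneg (h.memLp t ht)) ((hs R hR).nonneg hφ)
  have he0 : ∀ R, 0 < R → ∀ t, 0 ≤ t → 0 ≤ e R t := fun R hR t ht =>
    inner_nonneg_of_ae (absPow_nonneg (h.memLp t ht)) ((hs R hR).outer_nonneg hφ)
  have hadd : ∀ r R, 0 < r → 2 * r ≤ R → ∀ t, 0 ≤ t → e R t + b r t ≤ b R t := by
    intro r R hr hrR t ht
    have hR : 0 < R := by linarith
    have h1 : 0 ≤ inner ℝ (absPow p (u t)) (Φ R - (Ψ R + Φ r)) := by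
      refine inner_nonneg_of_ae (absPow_nonneg (h.memLp t ht)) ?_
      filter_upwards [(hs R hR).add_le (hs r hr) hφ hr hrR, Lp.coeFn_sub (Φ R) (Ψ R + Φ r),
        Lp.coeFn_add (Ψ R) (Φ r)] with x e1 e2 e3
      rw [e2, Pi.sub_apply, e3, Pi.add_apply]; linarith
    rw [inner_sub_right, inner_add_right] at h1
    simp only [hb, he]; linarith
  have hβ : Tendsto (fun B : ℝ => ((B ^ n)⁻¹) ^ q) atTop (𝓝 0) := by
    have h1 : Tendsto (fun B : ℝ => (B ^ n)⁻¹) atTop (𝓝 0) :=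
      (tendsto_pow_atTop (by omega)).inv_tendsto_atTop
    have h2 := h1.rpow_const (p := q) (Or.inr hq0.le)
    rwa [Real.zero_rpow hq0.ne'] at h2
  have hβ0 : ∀ B : ℝ, 1 ≤ B → 0 ≤ ((B ^ n)⁻¹) ^ q := fun B hB => by
    have : 0 < B := by linarith
    positivity
  have hkey : ∀ B, 1 ≤ B → ∀ᶠ R in atTop, weightedIntegral (m + 3) ((B * R) ^ 2) (b R) ≤
      K * ((B ^ n)⁻¹) ^ q * (weightedIntegral (m + 3) ((B * R) ^ 2) (b R) ^ (1 / p) +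
        B ^ 2 * weightedIntegral (m + 3) ((B * R) ^ 2) (e R) ^ (1 / p)) := by
    intro B hB
    -- For `R` large both data pair positively with the cut-off, so their terms can be dropped from
    -- the basic inequality.
    filter_upwards [hφ.eventually_inner_pos hpos₀, hφ.eventually_inner_pos hpos₁,
      eventually_ge_atTop 1] with R h0 h1 hR1
    have hR : 0 < R := by linarith
    have hB0 : 0 < B := by linarith
    have hBR : 1 ≤ B * R := by nlinarith
    have d0 := h0 (Φ R) (hs R hR).coe_eq
    have d1 := h1 (Φ R) (hs R hR).coe_eq
    have hT1 : 1 ≤ (B * R) ^ 2 := one_le_pow₀ hBR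
    have main := h.weightedMass_le hγ0 hγ1 hp hφ hC (hs R hR) hR hm' hT1
    have hsc := rpow_scaling_le (n := n) (γ := γ) hc0 hB0 hBR hR hqle
    rw [volume_real_ball n hR, ← hc, ← hq] at main
    -- The price of choosing `T = (BR)²` rather than `R²`: the Laplacian term carries an extra `B²`,
    -- but it multiplies only the outer mass.
    have eR : (R ^ 2)⁻¹ = B ^ 2 * ((B * R) ^ 2)⁻¹ := by field_simp
    rw [eR] at main
    set T := (B * R) ^ 2 with hT
    have hT0 : 0 < T := by linarith
    set X := weightedIntegral (m + 3) T (b R) with hX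
    set Y := weightedIntegral (m + 3) T (e R) with hY
    have hX0 : 0 ≤ X := weightedIntegral_nonneg hT0 (hb0 R hR)
    have hY0 : 0 ≤ Y := weightedIntegral_nonneg hT0 (he0 R hR)
    have main' : T ^ (1 - γ) / (m + 3) * X ≤
        (c * R ^ n * T) ^ q * T⁻¹ * (((m + 2) ^ 2 + C) * (X ^ (1 / p) + B ^ 2 * Y ^ (1 / p))) := by
      have hD : 0 ≤ (1 + (m + 2) / T) * inner ℝ u₀ (Φ R) + inner ℝ u₁ (Φ R) := by positivity
      have e1 : T ^ (1 - γ) / (m + 3) * X ≤ (c * R ^ n * T) ^ q *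
          ((m + 2) ^ 2 / T * X ^ (1 / p) + C * (B ^ 2 * T⁻¹) * Y ^ (1 / p)) :=
        le_trans (le_add_of_nonneg_right hD) main
      refine e1.trans ?_
      rw [mul_assoc ((c * R ^ n * T) ^ q)]
      refine mul_le_mul_of_nonneg_left ?_ (by positivity)
      have e2 : 0 ≤ T⁻¹ * ((m + 2) ^ 2 * (B ^ 2 * Y ^ (1 / p)) + C * X ^ (1 / p)) := by positivity
      have e3 : T⁻¹ * (((m + 2) ^ 2 + C) * (X ^ (1 / p) + B ^ 2 * Y ^ (1 / p))) =
          (m + 2) ^ 2 / T * X ^ (1 / p) + C * (B ^ 2 * T⁻¹) * Y ^ (1 / p) +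
          T⁻¹ * ((m + 2) ^ 2 * (B ^ 2 * Y ^ (1 / p)) + C * X ^ (1 / p)) := by
        field_simp; ring
      rw [e3]; linarith
    have hTT : T ^ (γ - 1) * T ^ (1 - γ) = 1 := by
      rw [← Real.rpow_add hT0]; simp
    have hZ : 0 ≤ ((m + 2) ^ 2 + C) * (X ^ (1 / p) + B ^ 2 * Y ^ (1 / p)) := by positivity
    calc X = ((m + 3) * T ^ (γ - 1)) * (T ^ (1 - γ) / (m + 3) * X) := by
          have : (m + 3 : ℝ) ≠ 0 := by positivity
          calc X = (T ^ (γ - 1) * T ^ (1 - γ)) * X := by rw [hTT, one_mul]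
            _ = _ := by field_simp
      _ ≤ ((m + 3) * T ^ (γ - 1)) * ((c * R ^ n * T) ^ q * T⁻¹ *
          (((m + 2) ^ 2 + C) * (X ^ (1 / p) + B ^ 2 * Y ^ (1 / p)))) :=
          mul_le_mul_of_nonneg_left main' (by positivity)
      _ = (m + 3) * ((c * R ^ n * T) ^ q * T⁻¹ * T ^ (γ - 1)) *
          (((m + 2) ^ 2 + C) * (X ^ (1 / p) + B ^ 2 * Y ^ (1 / p))) := by ring
      _ ≤ (m + 3) * (c ^ q * ((B ^ n)⁻¹) ^ q) *
          (((m + 2) ^ 2 + C) * (X ^ (1 / p) + B ^ 2 * Y ^ (1 / p))) :=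
          mul_le_mul_of_nonneg_right (mul_le_mul_of_nonneg_left hsc (by positivity)) hZ
      _ = _ := by rw [hK]; ring
  have hzero : ∀ r, 0 < r → b r 0 = 0 := fun r hr =>
    eq_zero_of_weightedIntegral_le hp hK0 hβ0 hβ
      (fun R _ => h.continuousOn_inner (Φ R)) (fun R _ => h.continuousOn_inner (Ψ R)) hb0 he0 hadd
      hkey hr
  obtain ⟨r, h0, hr⟩ := ((hφ.eventually_inner_pos hpos₀).and (eventually_gt_atTop (0 : ℝ))).exists
  have hu0 : u 0 = u₀ := by
    rw [h.eq 0 le_rfl, linearPart, op_symK0_zero, op_symK1_zero, duhamel]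
    simp
  -- Vanishing of `⟨|u₀|^p, Φ r⟩` forces `⟨u₀, Φ r⟩ = 0` by Hölder, whereas `r` was chosen to make
  -- this pairing positive.
  have hle := abs_inner_le_rpow hp (h.memLp 0 le_rfl) ((hs r hr).nonneg hφ) ((hs r hr).le_rpow hφ hp)
    ((hs r hr).eq_zero hφ hr) zero_le_one
  rw [show inner ℝ (absPow p (u 0)) (Φ r) = 0 from hzero r hr, Real.zero_rpow (one_div_pos.2 hp0).ne',
    mul_zero, zero_mul, hu0] at hle
  have := h0 (Φ r) (hs r hr).coe_eq
  rw [abs_of_pos this] at hle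
  linarith

theorem blowsUpInFiniteTime (hn : 1 ≤ n) (hγ0 : 0 < γ) (hγ1 : γ < 1) (h : IsAdmissible n p)
    (hpγ : p * ((n : ℝ) - 2 + 2 * γ) ≤ n + 2) (hu₀ : MemH1 u₀) (hpos₀ : 0 < ∫ x, u₀ x)
    (hpos₁ : 0 < ∫ x, u₁ x) : BlowsUpInFiniteTime γ p u₀ u₁ := by
  obtain ⟨T, u, hu⟩ := exists_isMaximalMildSolution (u₁ := u₁) hγ1 h hu₀
  refine ⟨T, u, hu, lt_top_iff_ne_top.2 ?_⟩
  rintro rfl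
  exact not_isGlobalSolution hn hγ0 hγ1 h.2.1 hpγ hpos₀ hpos₁ (hu.1.isGlobalSolution hγ1 h)

end Nonexistence

end DampedWave
end

theorem theorem2 (n : ℕ) (hn : 1 ≤ n) (γ p : ℝ) (hγ0 : 0 < γ) (hγ1 : γ < 1)
    (hp1 : 1 < p) (hp : 3 ≤ n → p ≤ (n : ℝ) / ((n : ℝ) - 2))
    (u₀ u₁ : DampedWave.L2 n) (hu₀ : DampedWave.MemH1 u₀)
    (hpos₀ : 0 < ∫ x, u₀ x) (hpos₁ : 0 < ∫ x, u₁ x) :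
    (((n : ℝ) - 2) / (n : ℝ) < γ → DampedWave.CompactlySupportedData u₀ u₁ →
      (p : EReal) ≤ DampedWave.pGamma n γ → DampedWave.BlowsUpInFiniteTime γ p u₀ u₁) ∧
    (3 ≤ n → γ ≤ ((n : ℝ) - 2) / (n : ℝ) → DampedWave.BlowsUpInFiniteTime γ p u₀ u₁) := by
  have hadm := DampedWave.isAdmissible_of_le hn hp1 hp
  refine ⟨fun _ _ hpγ => ?_, fun hn3 hγ => ?_⟩
  · exact DampedWave.blowsUpInFiniteTime hn hγ0 hγ1 hadm
      (DampedWave.mul_le_of_le_pGamma hpγ (by linarith)) hu₀ hpos₀ hpos₁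
  · refine DampedWave.blowsUpInFiniteTime hn hγ0 hγ1 hadm ?_ hu₀ hpos₀ hpos₁
    have h3 : (3 : ℝ) ≤ n := by exact_mod_cast hn3
    have hp' := hp hn3
    rw [le_div_iff₀ (by linarith)] at hp' hγ
    -- From `γ n ≤ n - 2` the left side is at most `p (n - 2)(n + 2)`, and `p (n - 2) ≤ n`
    -- concludes.
    have e : (p * ((n : ℝ) - 2 + 2 * γ)) * n ≤ (n + 2) * n := by nlinarith
    exact le_of_mul_le_mul_right e (by linarith)
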